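/- Setting. Let $(X,Y)$ be a couple of random variables with values in $\mathbb R^d\times\mathbb R$, with $\mathbb E\|X\|^2<\infty$ and $\mathbb E(Y^2)<\infty$. Put $R(\theta)=\mathbb E[(Y-\langle\theta,X\rangle)^2]$, $N(\theta,\xi)=\mathbb E[(\xi Y-\langle\theta,X\rangle)^2]$, $G=\mathbb E(XX^\top)$, and let $G^{-1/2}=U\,\mathrm{diag}\bigl(\mathbf 1(\lambda_i>0)\lambda_i^{-1/2}\bigr)U^\top$ where $G=U\,\mathrm{diag}(\lambda_i)U^\top$ with $U$ orthogonal. Let $\theta_*\in\arg\min_{\theta\in\mathbb R^d}R(\theta)$. Define $$\kappa_1=\sup\bigl\{\mathbb E(\langle\theta,X\rangle^4):\theta\in\mathbb R^d,\ \mathbb E(\langle\theta,X\rangle^2)\le 1\bigr\},\qquad \kappa_2=\frac{\mathbb E[(Y-\langle\theta_*,X\rangle)^4]}{R(\theta_*)^2}\ \text{ if } R(\theta_*)>0,\qquad \kappa_2=0\ \text{ otherwise},$$ and $K=(\sqrt{\kappa_1}+\sqrt{\kappa_2})^2$. Assume that $K>1$ (this is automatic when $R(\theta_*)>0$ and $\mathbb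 P(X\ne 0)>0$, in which case $K\ge 4$). Assume that for some $p,q\in(0,1]$ and some positive constants $\alpha_1,\alpha_2,\eta_1,\eta_2$, $$\mathbb E\Bigl\{\exp\Bigl[\tfrac{\alpha_1}{2}\bigl(\|G^{-1/2}X\|^{2p}-d^p-\eta_1\bigr)\Bigr]\Bigr\}\le 1,\qquad \mathbb E\Bigl\{\exp\Bigl[\tfrac{\alpha_2}{2}\Bigl(\frac{|Y-\langle\theta_*,X\rangle|^{2q}}{R(\theta_*)^q}-1-\eta_2\Bigr)\Bigr]\Bigr\}\le 1$$ (with $0/0=0$ in the second condition). Let $(X_i,Y_i)$, $i=1,\dots,n$, be independent copies of $(X,Y)$, let $\bar N(\theta,\xi)=\frac1n\sum_{i=1}^n(\xi Y_i-\langle\theta,X_i\rangle)^2$ and $$R=\max_{i=1,\dots,n}\sup\bigl\{\xi Y_i-\langle\theta,X_i\rangle:(\theta,\xi)\in\mathbb R^{d+1},\ N(\theta,\xi)\le 1\bigr\}.$$ For $\epsilon>0$, put $L=\log(\epsilon^{-1})+0.73\,(d+1)$ and $$\mu=\sqrt{\frac{2(K-1)L}{n}}+6.81\sqrt K\sqrt{\frac{2(d+1)}{n}},\qquad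 \hat\delta=\frac{\mu}{1-2\mu},\qquad \gamma_-=\frac{2L}{3(K-1)n},\qquad \gamma_+=\gamma_-R^4(1+\hat\delta)^2,$$ $$\hat\gamma_+=\frac{2L(1+\hat\delta)^2}{3(K-1)n}\Bigl[\bigl(d^p+\eta_1+2\alpha_1^{-1}\log(n/\epsilon)\bigr)^{2/p}+\bigl(1+\eta_2+2\alpha_2^{-1}\log(n/\epsilon)\bigr)^{2/q}\Bigr]^2,$$ $$n_0=\Bigl[20\sqrt K\sqrt{d+1}+\Bigl(\frac52+\frac1{2(K-1)}\Bigr)\sqrt{2(K-1)L}\Bigr]^2,\qquad \delta=\frac{\hat\delta+\hat\gamma_+}{(1-\hat\delta)(1-\hat\gamma_+)}.$$ Divisions by zero below follow the conventions $0/0=1$ and $z/0=+\infty$ for $z>0$. Proposition 4.5. (i) For any $\epsilon>0$ and any $n>n_0$, with probability at least $1-4\epsilon$ (that is, on some measurable event of at least that probability), the following holds. For any $\theta\in\mathbb R^d$ and $\xi\in\mathbb R$, $$-\frac{\hat\delta+\gamma_-}{1+\hat\delta}\le\frac{\bar N(\theta,\xi)}{N(\theta,\xi)}-1\le\frac{\hat\delta+\gamma_+}{(1-\hat\delta)_+(1-\gamma_+)_+}\le\frac{\hat\delta+\hat\gamma_+}{(1-\hat\delta)_+(1-\hat\gamma_+)_+},$$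 and $$\Bigl|\frac{\bar N(\theta,\xi)}{N(\theta,\xi)}-1\Bigr|\le\frac{\hat\delta+\hat\gamma_+}{(1-\hat\delta)_+(1-\hat\gamma_+)_+}.$$ Moreover, if $\hat\delta<1$, $\hat\gamma_+<1$ and $\delta<1$, then any $\hat\theta\in\arg\min_{\theta}\sum_{i=1}^n(Y_i-\langle\theta,X_i\rangle)^2$ satisfies $$R(\hat\theta)-R(\theta_*)\le\frac{\delta^2}{(1-\delta)(1-\delta^2)n}\sum_{i=1}^n(Y_i-\langle\hat\theta,X_i\rangle)^2\le\frac{\delta^2}{(1-\delta)^2}R(\theta_*).$$ (ii) There is a numerical constant $C$ (depending on nothing) such that, for any $\epsilon\in(0,1)$: if $R(\theta_*)>0$ and $\mathbb P(X\neq0)>0$, then $n_0\le C(\kappa_1+\kappa_2)[d+\log(\epsilon^{-1})]$; and if $d\ge1$, then for all $n$ large enough (depending on all the other parameters and on the law of $(X,Y)$) $$\frac{\hat\delta+\hat\gamma_+}{(1-\hat\delta)_+(1-\hat\gamma_+)_+}\le C\sqrt{\frac{(\kappa_1+\kappa_2)[d+\log(\epsilon^{-1})]}{n}},\qquad \delta^2\le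 C\,\frac{(\kappa_1+\kappa_2)[d+\log(\epsilon^{-1})]}{n}.$$ -/

import Mathlib

open MeasureTheory ProbabilityTheory Filter
open scoped ENNReal

noncomputable section

namespace OLS

/-- The value space of the couple `(X, Y)`, with `X ∈ ℝ^d` (Euclidean norm) and `Y ∈ ℝ`. -/
abbrev Obs (d : ℕ) : Type := EuclideanSpace ℝ (Fin d) × ℝ

/-- The residual `ξ Y - ⟨θ, X⟩` at the observation `z = (X, Y)`. -/
def resid {d : ℕ} (θ : EuclideanSpace ℝ (Fin d)) (ξ : ℝ) (z : Obs d) : ℝ :=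
  ξ * z.2 - inner ℝ θ z.1

/-- `N(θ, ξ) = E[(ξ Y - ⟨θ, X⟩)²]`, where `P` is the law of `(X, Y)`. -/
def quadForm {d : ℕ} (P : Measure (Obs d)) (θ : EuclideanSpace ℝ (Fin d)) (ξ : ℝ) : ℝ :=
  ∫ z, resid θ ξ z ^ 2 ∂P

/-- The quadratic risk `R(θ) = E[(Y - ⟨θ, X⟩)²]`. -/
def risk {d : ℕ} (P : Measure (Obs d)) (θ : EuclideanSpace ℝ (Fin d)) : ℝ :=
  ∫ z, (z.2 - inner ℝ θ z.1) ^ 2 ∂P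

/-- The Gram matrix `G = E[X Xᵀ]`. -/
def gram {d : ℕ} (P : Measure (Obs d)) : Matrix (Fin d) (Fin d) ℝ :=
  Matrix.of fun i j => ∫ z, z.1 i * z.1 j ∂P

theorem gram_isHermitian {d : ℕ} (P : Measure (Obs d)) : (gram P).IsHermitian := by
  ext i j
  simp [gram, mul_comm]

/-- `G^{-1/2} = U diag(1(λ_i > 0) λ_i^{-1/2}) Uᵀ`, where `G = U diag(λ_i) Uᵀ`.
(In Lean `(√0)⁻¹ = 0`, so that the indicator is built in.) -/
def gramInvSqrt {d : ℕ} (P : Measure (Obs d)) : Matrix (Fin d) (Fin d) ℝ :=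
  ((gram_isHermitian P).eigenvectorUnitary : Matrix (Fin d) (Fin d) ℝ) *
    Matrix.diagonal (fun i => (√((gram_isHermitian P).eigenvalues i))⁻¹) *
    star ((gram_isHermitian P).eigenvectorUnitary : Matrix (Fin d) (Fin d) ℝ)

/-- The Euclidean norm `‖G^{-1/2} x‖`. -/
def whiteNorm {d : ℕ} (P : Measure (Obs d)) (x : EuclideanSpace ℝ (Fin d)) : ℝ :=
  ‖Matrix.toEuclideanLin (gramInvSqrt P) x‖

/-- `κ₁ = sup {E⟨θ, X⟩⁴ : E⟨θ, X⟩² ≤ 1}`. -/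
def kurtDesign {d : ℕ} (P : Measure (Obs d)) : ℝ :=
  sSup {m : ℝ | ∃ θ : EuclideanSpace ℝ (Fin d),
    ∫ z, (inner ℝ θ z.1) ^ 2 ∂P ≤ 1 ∧ m = ∫ z, (inner ℝ θ z.1) ^ 4 ∂P}

open Classical in
/-- `κ₂`, the kurtosis of the noise `Y - ⟨θs, X⟩` (`0` when the noise vanishes). -/
def kurtNoise {d : ℕ} (P : Measure (Obs d)) (θs : EuclideanSpace ℝ (Fin d)) : ℝ :=
  if 0 < risk P θs then (∫ z, (z.2 - inner ℝ θs z.1) ^ 4 ∂P) / risk P θs ^ 2 else 0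

/-- `K = (√κ₁ + √κ₂)²`. -/
def kurtSum {d : ℕ} (P : Measure (Obs d)) (θs : EuclideanSpace ℝ (Fin d)) : ℝ :=
  (√(kurtDesign P) + √(kurtNoise P θs)) ^ 2

/-- The exponential moment condition on the design,
`E exp[(α/2) (‖G^{-1/2} X‖^{2p} - d^p - η)] ≤ 1`. -/
def DesignExpMoment {d : ℕ} (P : Measure (Obs d)) (p α η : ℝ) : Prop :=
  ∫⁻ z, ENNReal.ofReal
    (Real.exp (α / 2 * (whiteNorm P z.1 ^ (2 * p) - (d : ℝ) ^ p - η))) ∂P ≤ 1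

/-- The exponential moment condition on the normalized noise,
`E exp[(α/2) ((Y - ⟨θs, X⟩)^{2q} / R(θs)^q - 1 - η)] ≤ 1`, with the convention `0/0 = 0`. -/
def NoiseExpMoment {d : ℕ} (P : Measure (Obs d)) (θs : EuclideanSpace ℝ (Fin d))
    (q α η : ℝ) : Prop :=
  ∫⁻ z, ENNReal.ofReal
    (Real.exp (α / 2 * (((z.2 - inner ℝ θs z.1) ^ 2) ^ q / risk P θs ^ q - 1 - η))) ∂P ≤ 1

/-- `log(ε⁻¹) + 0.73 (d + 1)`. -/
def logTerm (d : ℕ) (ε : ℝ) : ℝ := Real.log ε⁻¹ + 0.73 * ((d : ℝ) + 1)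

/-- `μ`; here and below `K` stands for `(√κ₁ + √κ₂)²`. -/
def mu (K : ℝ) (d n : ℕ) (ε : ℝ) : ℝ :=
  √(2 * (K - 1) / n * logTerm d ε) + 6.81 * √K * √(2 * ((d : ℝ) + 1) / n)

/-- `δ̂ = μ / (1 - 2 μ)`. -/
def deltaHat (K : ℝ) (d n : ℕ) (ε : ℝ) : ℝ := mu K d n ε / (1 - 2 * mu K d n ε)

/-- `γ₋`. -/
def gammaMinus (K : ℝ) (d n : ℕ) (ε : ℝ) : ℝ := 2 * logTerm d ε / (3 * (K - 1) * n)

/-- `γ₊ = γ₋ R⁴ (1 + δ̂)²`. -/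
def gammaPlus (K : ℝ) (d n : ℕ) (ε R : ℝ) : ℝ :=
  gammaMinus K d n ε * R ^ 4 * (1 + deltaHat K d n ε) ^ 2

/-- `γ̂₊`, the deterministic counterpart of `γ₊`. -/
def gammaHat (K : ℝ) (d n : ℕ) (ε p q α₁ α₂ η₁ η₂ : ℝ) : ℝ :=
  2 * logTerm d ε * (1 + deltaHat K d n ε) ^ 2 / (3 * (K - 1) * n) *
    (((d : ℝ) ^ p + η₁ + 2 * α₁⁻¹ * Real.log (n / ε)) ^ (2 / p) +
      (1 + η₂ + 2 * α₂⁻¹ * Real.log (n / ε)) ^ (2 / q)) ^ 2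

/-- The right-hand side of the condition on the sample size. -/
def sampleThreshold (K : ℝ) (d : ℕ) (ε : ℝ) : ℝ :=
  (20 * √K * √((d : ℝ) + 1) +
    (5 / 2 + 1 / (2 * (K - 1))) * √(2 * (K - 1) * logTerm d ε)) ^ 2

/-- `N̄(θ, ξ) = (1/n) ∑ (ξ Y_i - ⟨θ, X_i⟩)²`, for the sample `s`. -/
def empForm {d n : ℕ} (s : Fin n → Obs d) (θ : EuclideanSpace ℝ (Fin d)) (ξ : ℝ) : ℝ :=
  (1 / (n : ℝ)) * ∑ i, resid θ ξ (s i) ^ 2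

/-- `∑ (Y_i - ⟨θ, X_i⟩)²`. -/
def sumSq {d n : ℕ} (s : Fin n → Obs d) (θ : EuclideanSpace ℝ (Fin d)) : ℝ :=
  ∑ i, ((s i).2 - inner ℝ θ (s i).1) ^ 2

/-- `R = max_i sup {ξ Y_i - ⟨θ, X_i⟩ : E[(ξ Y - ⟨θ, X⟩)²] ≤ 1}`.
(The supremum is almost surely finite when `(X, Y)` is square integrable.) -/
def radius {d n : ℕ} (P : Measure (Obs d)) (s : Fin n → Obs d) : ℝ :=
  ⨆ i : Fin n, sSup {t : ℝ | ∃ (θ : EuclideanSpace ℝ (Fin d)) (ξ : ℝ),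
    quadForm P θ ξ ≤ 1 ∧ t = resid θ ξ (s i)}

open Classical in
/-- Division of non-negative reals with the conventions `0/0 = 1` and `a/0 = +∞` for `a > 0`. -/
def extDiv (a b : ℝ) : EReal :=
  if b = 0 then (if a = 0 then 1 else ⊤) else ((a / b : ℝ) : EReal)

/-- The upper bound `(δ + γ) / ((1 - δ)₊ (1 - γ)₊)`, equal to `+∞` when `δ ≥ 1` or `γ ≥ 1`. -/
def upperBound (δ γ : ℝ) : EReal := extDiv (δ + γ) (max (1 - δ) 0 * max (1 - γ) 0)

end OLS

end

open OLS

/-! The residuals `ξ Y - ⟨θ, X⟩` span a subspace of `L²` of dimension at most `d + 1`. In an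
orthonormal basis of it they become `⟨t, W⟩` with `W` isotropic and `N(θ, ξ) = ‖t‖²`, so the claim
is a uniform control over unit vectors `t` of the empirical mean of `⟨t, W⟩²`. Two facts feed it.
The noise is orthogonal to the design, so Cauchy–Schwarz and Minkowski give `E⟨t, W⟩⁴ ≤ K ‖t‖⁴` with
`K = (√κ₁ + √κ₂)²`. And `‖W(Z i)‖ ≤ R` almost surely.

Uniformity comes from a PAC-Bayesian argument (`pacBayes_quadratic`) with a standard Gaussian prior
and its shifts by `√β • t` as posteriors: Markov's inequality is used once, on a prior average, and
each shift then costs only its relative entropy `β / 2`. Averaging the exponential moment over the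
posterior is an explicit Gaussian integral, which is bounded by a polynomial in `⟨t, W⟩²` and `‖W‖²`
of total degree four in `W`, so that four moments suffice. For lower deviations
(`IsIsotropic.lower_deviation`) the exponent is bounded above by `l`, and its cubic remainder is a
deterministic `O(l³)`; this becomes `γ₋ = l² / 3`. For upper deviations
(`IsIsotropic.upper_deviation`) no such bound exists, and `⟨t, W⟩²` is multiplied by the weight `(1
- l² ‖W‖⁴ / 3)₊`, which cancels the cubic term. Removing the weight afterwards costs `l² R⁴ / 3`,
whence `γ₊`. The choice of `l` and `β` in `exists_parameters` turns both budgets into `μ`. Markov's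
inequality for the two exponential moments and a union bound over the sample replace `R` by its
deterministic bound, so four events, each failing with probability at most `ε`, are intersected.

For least squares, the empirical risk is symmetric about its minimiser `θhat`. Comparing population
risks at `θhat ± u / δ`, where `u = θhat - θs`, turns a relative error `δ` on the quadratic form
into an excess risk of order `δ²` (`excess_risk_le`). -/

namespace OLS

/-! ### Gaussian measures: shifts, second moments and Laplace transforms of squares. -/

section Gaussian

variable {r : ℕ}

/-- The Lebesgue density of the standard Gaussian measure. -/
theorem stdGaussian_eq_withDensity :
    stdGaussian (EuclideanSpace ℝ (Fin r)) =
      (volume : Measure (EuclideanSpace ℝ (Fin r))).withDensity (fun v =>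
        ENNReal.ofReal ((Real.pi / (1 / 2 : ℝ)) ^ (-(r : ℝ) / 2) *
          Real.exp (-(1 / 2 : ℝ) * ‖v‖ ^ 2))) := by
  have hc : (0 : ℝ) < (Real.pi / (1 / 2 : ℝ)) ^ (-(r : ℝ) / 2) := by positivity
  have hint : Integrable (fun v : EuclideanSpace ℝ (Fin r) =>
      (Real.pi / (1 / 2 : ℝ)) ^ (-(r : ℝ) / 2) * Real.exp (-(1 / 2 : ℝ) * ‖v‖ ^ 2)) := by
    refine Integrable.const_mul ?_ _
    have h := GaussianFourier.integral_rexp_neg_mul_sq_norm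
      (V := EuclideanSpace ℝ (Fin r)) (b := 1 / 2) (by norm_num)
    by_contra hn
    rw [integral_undef hn] at h
    have : (0 : ℝ) < (Real.pi / (1 / 2 : ℝ)) ^
        ((Module.finrank ℝ (EuclideanSpace ℝ (Fin r)) : ℝ) / 2) := by positivity
    linarith
  have hfin : IsFiniteMeasure ((volume : Measure (EuclideanSpace ℝ (Fin r))).withDensity (fun v =>
        ENNReal.ofReal ((Real.pi / (1 / 2 : ℝ)) ^ (-(r : ℝ) / 2) *
          Real.exp (-(1 / 2 : ℝ) * ‖v‖ ^ 2)))) :=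
    isFiniteMeasure_withDensity_ofReal hint.2
  apply Measure.ext_of_charFun
  ext t
  rw [charFun_stdGaussian, charFun_apply, integral_withDensity_eq_integral_toReal_smul
    (by fun_prop) (by simp)]
  have h := GaussianFourier.integral_cexp_neg_mul_sq_norm_add_of_euclideanSpace
    (ι := Fin r) (b := (1 / 2 : ℂ)) (by norm_num) Complex.I t
  have h1 : ∀ v : EuclideanSpace ℝ (Fin r),
      (ENNReal.ofReal ((Real.pi / (1 / 2 : ℝ)) ^ (-(r : ℝ) / 2) *
          Real.exp (-(1 / 2 : ℝ) * ‖v‖ ^ 2))).toReal • Complex.exp ((inner ℝ v t : ℝ) * Complex.I)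
      = (((Real.pi / (1 / 2 : ℝ)) ^ (-(r : ℝ) / 2) : ℝ) : ℂ) *
        Complex.exp (- (1 / 2 : ℂ) * ‖v‖ ^ 2 + Complex.I * (inner ℝ t v : ℝ)) := by
    intro v
    rw [ENNReal.toReal_ofReal (by positivity), Complex.exp_add, real_inner_comm, Complex.real_smul]
    push_cast
    ring_nf
  simp_rw [h1]
  rw [integral_const_mul, h, ← mul_assoc]
  have h2 : ((Real.pi : ℂ) / (1 / 2 : ℂ)) ^ ((Fintype.card (Fin r) : ℂ) / 2) =
      (((Real.pi / (1 / 2 : ℝ)) ^ ((r : ℝ) / 2) : ℝ) : ℂ) := by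
    rw [Complex.ofReal_cpow (by positivity)]
    simp
  rw [h2, ← Complex.ofReal_mul, ← Real.rpow_add (by positivity)]
  have h3 : -(r : ℝ) / 2 + (r : ℝ) / 2 = 0 := by ring
  rw [h3, Real.rpow_zero]
  simp only [Complex.ofReal_one, one_mul]
  congr 1
  rw [Complex.I_sq]
  ring

/-- The Cameron–Martin formula: Lebesgue measure is translation invariant, and the exponential is
the ratio of the two densities. -/
theorem lintegral_stdGaussian_shift (t : EuclideanSpace ℝ (Fin r))
    {f : EuclideanSpace ℝ (Fin r) → ℝ≥0∞} (hf : Measurable f) :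
    ∫⁻ g, f g ∂(stdGaussian (EuclideanSpace ℝ (Fin r))) =
      ∫⁻ g, ENNReal.ofReal (Real.exp (-(inner ℝ t g) - ‖t‖ ^ 2 / 2)) * f (t + g)
        ∂(stdGaussian (EuclideanSpace ℝ (Fin r))) := by
  rw [stdGaussian_eq_withDensity, lintegral_withDensity_eq_lintegral_mul _ (by fun_prop) hf,
    lintegral_withDensity_eq_lintegral_mul _ (by fun_prop) (by fun_prop),
    ← lintegral_add_left_eq_self _ t]
  refine lintegral_congr fun g => ?_
  simp only [Pi.mul_apply]
  rw [← mul_assoc, ← ENNReal.ofReal_mul (by positivity), mul_assoc, ← Real.exp_add,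
    norm_add_sq_real]
  ring_nf

theorem integrable_inner_stdGaussian (t : EuclideanSpace ℝ (Fin r)) :
    Integrable (fun g => inner ℝ t g) (stdGaussian (EuclideanSpace ℝ (Fin r))) :=
  (innerSL ℝ t).integrable_comp IsGaussian.integrable_id

theorem integral_inner_stdGaussian (t : EuclideanSpace ℝ (Fin r)) :
    ∫ g, inner ℝ t g ∂(stdGaussian (EuclideanSpace ℝ (Fin r))) = 0 :=
  integral_strongDual_stdGaussian (innerSL ℝ t)

/-- The Donsker–Varadhan lower bound for the Gaussian shift by `t`. -/
theorem exp_integral_shift_le_lintegral_exp (t : EuclideanSpace ℝ (Fin r))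
    {Φ : EuclideanSpace ℝ (Fin r) → ℝ} (hΦ : Measurable Φ)
    (hint : Integrable (fun g => Φ (t + g)) (stdGaussian (EuclideanSpace ℝ (Fin r)))) :
    ENNReal.ofReal (Real.exp (∫ g, Φ (t + g) ∂(stdGaussian (EuclideanSpace ℝ (Fin r)))
        - ‖t‖ ^ 2 / 2)) ≤
      ∫⁻ g, ENNReal.ofReal (Real.exp (Φ g)) ∂(stdGaussian (EuclideanSpace ℝ (Fin r))) := by
  set γ := stdGaussian (EuclideanSpace ℝ (Fin r)) with hγ
  rw [hγ, lintegral_stdGaussian_shift t (by fun_prop), ← hγ]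
  have hΨ₀ : Integrable (fun g => Φ (t + g) - inner ℝ t g) γ :=
    hint.sub (integrable_inner_stdGaussian t)
  have hΨ : Integrable (fun g => Φ (t + g) - inner ℝ t g - ‖t‖ ^ 2 / 2) γ :=
    hΨ₀.sub (integrable_const _)
  have hΨ' : ∫ g, (Φ (t + g) - inner ℝ t g - ‖t‖ ^ 2 / 2) ∂γ
      = ∫ g, Φ (t + g) ∂γ - ‖t‖ ^ 2 / 2 := by
    rw [integral_sub hΨ₀ (integrable_const _),
      integral_sub hint (integrable_inner_stdGaussian t), integral_inner_stdGaussian]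
    simp
  have hexp : ∀ g, ENNReal.ofReal (Real.exp (-(inner ℝ t g) - ‖t‖ ^ 2 / 2)) *
      ENNReal.ofReal (Real.exp (Φ (t + g))) =
      ENNReal.ofReal (Real.exp (Φ (t + g) - inner ℝ t g - ‖t‖ ^ 2 / 2)) := by
    intro g
    rw [← ENNReal.ofReal_mul (by positivity), ← Real.exp_add]
    ring_nf
  simp_rw [hexp]
  by_cases htop : ∫⁻ g, ENNReal.ofReal (Real.exp (Φ (t + g) - inner ℝ t g - ‖t‖ ^ 2 / 2)) ∂γ = ⊤
  · rw [htop]; exact le_top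
  have hm : AEStronglyMeasurable
      (fun g => Real.exp (Φ (t + g) - inner ℝ t g - ‖t‖ ^ 2 / 2)) γ := by
    apply Measurable.aestronglyMeasurable
    fun_prop
  have hei : Integrable (fun g => Real.exp (Φ (t + g) - inner ℝ t g - ‖t‖ ^ 2 / 2)) γ := by
    refine (lintegral_ofReal_ne_top_iff_integrable hm ?_).1 htop
    exact Eventually.of_forall fun g => (Real.exp_pos _).le
  rw [← ofReal_integral_eq_lintegral_ofReal hei (Eventually.of_forall fun g => (Real.exp_pos _).le),
    ← hΨ']
  apply ENNReal.ofReal_le_ofReal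
  -- Jensen's inequality after the Cameron–Martin shift. The linear term is centred, so only `‖t‖² /
  -- 2` is lost, the relative entropy of the shifted measure.
  exact convexOn_exp.map_integral_le Real.continuous_exp.continuousOn isClosed_univ
    (Eventually.of_forall fun _ => Set.mem_univ _) hΨ hei

theorem map_inner_stdGaussian (v : EuclideanSpace ℝ (Fin r)) :
    (stdGaussian (EuclideanSpace ℝ (Fin r))).map (fun g => inner ℝ g v) =
      gaussianReal 0 (‖v‖₊ ^ 2) := by
  have h := IsGaussian.map_eq_gaussianReal (μ := stdGaussian (EuclideanSpace ℝ (Fin r)))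
    (innerSL ℝ v)
  rw [integral_strongDual_stdGaussian, variance_dual_stdGaussian, innerSL_apply_norm] at h
  have h2 : (fun g => inner ℝ g v) = (innerSL ℝ v : EuclideanSpace ℝ (Fin r) → ℝ) := by
    ext g; simp [real_inner_comm]
  rw [h2, h]
  congr 1
  ext; simp

theorem integrable_sq_shift_stdGaussian (t v : EuclideanSpace ℝ (Fin r)) :
    Integrable (fun g => (inner ℝ (t + g) v) ^ 2) (stdGaussian (EuclideanSpace ℝ (Fin r))) := by
  have h : MemLp (fun g => inner ℝ (t + g) v) 2 (stdGaussian (EuclideanSpace ℝ (Fin r))) := by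
    have h1 : MemLp (fun g => innerSL ℝ v g) 2 (stdGaussian (EuclideanSpace ℝ (Fin r))) :=
      (innerSL ℝ v).comp_memLp' IsGaussian.memLp_two_id
    have h2 := (memLp_const (μ := stdGaussian (EuclideanSpace ℝ (Fin r)))
      (p := 2) (inner ℝ t v : ℝ)).add h1
    refine h2.congr_norm (by apply Measurable.aestronglyMeasurable; fun_prop) ?_
    refine Eventually.of_forall fun g => ?_
    simp [inner_add_left, real_inner_comm]
  exact h.integrable_sq

theorem integral_sq_shift_stdGaussian (t v : EuclideanSpace ℝ (Fin r)) :
    ∫ g, (inner ℝ (t + g) v) ^ 2 ∂(stdGaussian (EuclideanSpace ℝ (Fin r))) =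
      (inner ℝ t v) ^ 2 + ‖v‖ ^ 2 := by
  have h0 := integrable_sq_shift_stdGaussian (0 : EuclideanSpace ℝ (Fin r)) v
  simp only [zero_add] at h0
  have h1 : ∫ g, (inner ℝ g v) ^ 2 ∂(stdGaussian (EuclideanSpace ℝ (Fin r))) = ‖v‖ ^ 2 := by
    have hv := variance_dual_stdGaussian (innerSL ℝ v)
    rw [variance_eq_integral (by fun_prop), integral_strongDual_stdGaussian,
      innerSL_apply_norm] at hv
    rw [← hv]
    refine integral_congr_ae (Eventually.of_forall fun g => ?_)
    simp [real_inner_comm]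
  have h2 : ∀ g : EuclideanSpace ℝ (Fin r), (inner ℝ (t + g) v) ^ 2 =
      (inner ℝ t v : ℝ) ^ 2 + (2 * inner ℝ t v) * inner ℝ v g + (inner ℝ g v) ^ 2 := by
    intro g
    rw [inner_add_left, real_inner_comm v g]; ring
  simp_rw [h2]
  have h3 : Integrable (fun g => (inner ℝ t v : ℝ) ^ 2 + (2 * inner ℝ t v) * inner ℝ v g)
      (stdGaussian (EuclideanSpace ℝ (Fin r))) :=
    (integrable_const _).add ((integrable_inner_stdGaussian v).const_mul _)
  rw [integral_add h3 h0,
    integral_add (integrable_const _) ((integrable_inner_stdGaussian v).const_mul _), h1,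
    integral_const_mul, integral_inner_stdGaussian]
  simp

end Gaussian

/-- The Laplace transform of a shifted squared Gaussian variable. -/
theorem lintegral_exp_sq_gaussianReal (a c : ℝ) (v : NNReal) (hcv : 2 * c * v < 1) :
    ∫⁻ y, ENNReal.ofReal (Real.exp (c * (a + y) ^ 2)) ∂(gaussianReal 0 v) =
      ENNReal.ofReal ((√(1 - 2 * c * v))⁻¹ * Real.exp (c * a ^ 2 / (1 - 2 * c * v))) := by
  by_cases hv : v = 0
  · subst hv
    simp
  have hv' : (0 : ℝ) < v := by positivity
  have hb : 0 < 1 - 2 * c * v := by linarith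
  set b := 1 - 2 * c * v with hbdef
  have hw : (⟨v / b, by positivity⟩ : NNReal) ≠ 0 := by
    intro h
    have h' : (v : ℝ) / (1 - 2 * c * v) = 0 := congrArg NNReal.toReal h
    exact (div_pos hv' hb).ne' h'
  set w : NNReal := ⟨v / b, by positivity⟩ with hwdef
  have hwv : (w : ℝ) = v / b := rfl
  rw [gaussianReal_of_var_ne_zero _ hv,
    lintegral_withDensity_eq_lintegral_mul _ (measurable_gaussianPDF _ _) (by fun_prop)]
  -- Completing the square: up to a constant, the integrand is again a Gaussian density, with
  -- variance `v / b`, and integrates to one.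
  have key : ∀ y : ℝ, gaussianPDF 0 v y * ENNReal.ofReal (Real.exp (c * (a + y) ^ 2)) =
      ENNReal.ofReal ((√b)⁻¹ * Real.exp (c * a ^ 2 / b)) *
        gaussianPDF (2 * c * a * v / b) w y := by
    intro y
    rw [gaussianPDF, gaussianPDF, ← ENNReal.ofReal_mul (gaussianPDFReal_nonneg _ _ _),
      ← ENNReal.ofReal_mul (by positivity)]
    congr 1
    rw [gaussianPDFReal, gaussianPDFReal, hwv]
    have e1 : √(2 * Real.pi * (v / b)) = √(2 * Real.pi * v) / √b := by
      rw [← Real.sqrt_div (by positivity)]; congr 1; ring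
    rw [e1]
    have e2 : ∀ A B C D s t : ℝ, 0 < s → A + B = C + D → 
        t⁻¹ * Real.exp A * Real.exp B = s⁻¹ * Real.exp C * ((t / s)⁻¹ * Real.exp D) := by
      intro A B C D s t hs h
      rw [mul_assoc, ← Real.exp_add, h, Real.exp_add]
      field_simp
    apply e2
    · positivity
    · have hbc : b = 1 - 2 * c * v := hbdef
      have hc : c = (1 - b) / (2 * v) := by rw [hbc]; field_simp; ring
      rw [hc]
      field_simp
      ring
  simp only [Pi.mul_apply]
  simp_rw [key]
  rw [lintegral_const_mul _ (measurable_gaussianPDF _ _), lintegral_gaussianPDF_eq_one _ hw,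
    mul_one]

theorem lintegral_exp_sq_stdGaussian {r : ℕ} (t v : EuclideanSpace ℝ (Fin r)) (c : ℝ)
    (hcv : 2 * c * ‖v‖ ^ 2 < 1) :
    ∫⁻ g, ENNReal.ofReal (Real.exp (c * (inner ℝ (t + g) v) ^ 2))
        ∂(stdGaussian (EuclideanSpace ℝ (Fin r))) =
      ENNReal.ofReal ((√(1 - 2 * c * ‖v‖ ^ 2))⁻¹ *
        Real.exp (c * (inner ℝ t v) ^ 2 / (1 - 2 * c * ‖v‖ ^ 2))) := by
  have h := lintegral_exp_sq_gaussianReal (inner ℝ t v) c (‖v‖₊ ^ 2) (by simpa using hcv)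
  rw [← map_inner_stdGaussian v, lintegral_map (by fun_prop) (by fun_prop)] at h
  simp only [NNReal.coe_pow, coe_nnnorm] at h
  rw [← h]
  simp_rw [inner_add_left]

end OLS

/-! ### PAC-Bayesian inequalities. -/

namespace OLS

/-- A PAC-Bayesian deviation inequality with Gaussian prior and shifted Gaussian posteriors. -/
theorem pacBayes_gaussian {Ω : Type*} [MeasurableSpace Ω] {μ : Measure Ω} [IsProbabilityMeasure μ]
    {S : Type*} [MeasurableSpace S] {P : Measure S} [IsProbabilityMeasure P] {n r : ℕ}
    {Z : Fin n → Ω → S} (hZ : ∀ i, Measurable (Z i)) (hind : iIndepFun Z μ)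
    (hlaw : ∀ i, μ.map (Z i) = P)
    {h : EuclideanSpace ℝ (Fin r) → S → ℝ} (hm : Measurable (Function.uncurry h))
    (hfin : ∀ g, ∫⁻ z, ENNReal.ofReal (Real.exp (h g z)) ∂P ≠ ⊤) {ε : ℝ} (hε : 0 < ε) :
    ∃ B : Set Ω, MeasurableSet B ∧ μ Bᶜ ≤ ENNReal.ofReal ε ∧ ∀ ω ∈ B, ∀ t,
      (∀ i, Integrable (fun g => h (t + g) (Z i ω)) (stdGaussian (EuclideanSpace ℝ (Fin r)))) →
      Integrable (fun g => (∫⁻ z, ENNReal.ofReal (Real.exp (h (t + g) z)) ∂P).toReal)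
        (stdGaussian (EuclideanSpace ℝ (Fin r))) →
      ∑ i, ∫ g, h (t + g) (Z i ω) ∂(stdGaussian (EuclideanSpace ℝ (Fin r))) ≤
        n * (∫ g, (∫⁻ z, ENNReal.ofReal (Real.exp (h (t + g) z)) ∂P).toReal
          ∂(stdGaussian (EuclideanSpace ℝ (Fin r))) - 1) + ‖t‖ ^ 2 / 2 + Real.log ε⁻¹ := by
  set γ := stdGaussian (EuclideanSpace ℝ (Fin r)) with hγ
  set F : EuclideanSpace ℝ (Fin r) → ℝ :=
    fun g => (∫⁻ z, ENNReal.ofReal (Real.exp (h g z)) ∂P).toReal with hF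
  have hexpm : Measurable (Function.uncurry fun g z => ENNReal.ofReal (Real.exp (h g z))) :=
    ENNReal.measurable_ofReal.comp (Real.measurable_exp.comp hm)
  have hFm : Measurable F := (Measurable.lintegral_prod_right hexpm).ennreal_toReal
  have hhg : ∀ g, Measurable (h g) := fun g => hm.comp (measurable_const.prodMk measurable_id)
  have hhz : ∀ z, Measurable (fun g => h g z) := fun z =>
    hm.comp (measurable_id.prodMk measurable_const)
  have hhi : ∀ i, Measurable (fun p : Ω × EuclideanSpace ℝ (Fin r) => h p.2 (Z i p.1)) := fun i =>
    hm.comp (measurable_snd.prodMk ((hZ i).comp measurable_fst))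
  -- The compensator is `n (F - 1)` and not `n log F`. The bound `F exp(-(F - 1)) ≤ 1` still gives
  -- mean at most one, and linearity in `F` lets the posterior average be computed by exchanging
  -- integrals.
  set Φ : Ω → EuclideanSpace ℝ (Fin r) → ℝ :=
    fun ω g => ∑ i, h g (Z i ω) - n * (F g - 1) with hΦ
  have hΦm : Measurable (Function.uncurry Φ) := by
    refine Measurable.sub ?_ ?_
    · exact Finset.measurable_sum _ fun i _ => hhi i
    · exact ((hFm.comp measurable_snd).sub_const 1).const_mul _
  have hΦem : Measurable (Function.uncurry fun ω g => ENNReal.ofReal (Real.exp (Φ ω g))) :=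
    ENNReal.measurable_ofReal.comp (Real.measurable_exp.comp hΦm)
  set M : Ω → ℝ≥0∞ := fun ω => ∫⁻ g, ENNReal.ofReal (Real.exp (Φ ω g)) ∂γ with hM
  have hMm : Measurable M := Measurable.lintegral_prod_right hΦem
  have hone : ∀ g, ∫⁻ ω, ENNReal.ofReal (Real.exp (Φ ω g)) ∂μ ≤ 1 := by
    intro g
    have e1 : ∀ ω, ENNReal.ofReal (Real.exp (Φ ω g)) =
        ∏ i : Fin n, ENNReal.ofReal (Real.exp (h g (Z i ω) - (F g - 1))) := by
      intro ω
      rw [← ENNReal.ofReal_prod_of_nonneg (fun i _ => (Real.exp_pos _).le), ← Real.exp_sum,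
        Finset.sum_sub_distrib]
      simp only [hΦ, Finset.sum_const, Finset.card_univ, Fintype.card_fin, nsmul_eq_mul]
    simp_rw [e1]
    have hcomp : Measurable (fun z => ENNReal.ofReal (Real.exp (h g z - (F g - 1)))) := by
      have := hhg g
      fun_prop
    rw [lintegral_prod_eq_prod_lintegral_of_indepFun Finset.univ
      (fun i ω => ENNReal.ofReal (Real.exp (h g (Z i ω) - (F g - 1))))
      (hind.comp (fun _ z => ENNReal.ofReal (Real.exp (h g z - (F g - 1)))) (fun _ => hcomp))
      (fun i => hcomp.comp (hZ i))]
    refine Finset.prod_le_one' fun i _ => ?_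
    have e2 : ∫⁻ ω, ENNReal.ofReal (Real.exp (h g (Z i ω) - (F g - 1))) ∂μ =
        ∫⁻ z, ENNReal.ofReal (Real.exp (h g z - (F g - 1))) ∂P := by
      rw [← hlaw i, lintegral_map hcomp (hZ i)]
    rw [e2]
    have e3 : ∀ z, ENNReal.ofReal (Real.exp (h g z - (F g - 1))) =
        ENNReal.ofReal (Real.exp (h g z)) * ENNReal.ofReal (Real.exp (-(F g - 1))) := by
      intro z
      rw [← ENNReal.ofReal_mul (Real.exp_pos _).le, ← Real.exp_add, sub_eq_add_neg]
    simp_rw [e3]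
    rw [lintegral_mul_const' _ _ ENNReal.ofReal_ne_top, ← ENNReal.ofReal_toReal (hfin g),
      ← ENNReal.ofReal_mul ENNReal.toReal_nonneg, ← ENNReal.ofReal_one]
    apply ENNReal.ofReal_le_ofReal
    change F g * Real.exp (-(F g - 1)) ≤ 1
    have h1 := Real.add_one_le_exp (F g - 1)
    calc F g * Real.exp (-(F g - 1)) ≤ Real.exp (F g - 1) * Real.exp (-(F g - 1)) := by
          gcongr; linarith
      _ = 1 := by rw [← Real.exp_add]; simp
  have hEM : ∫⁻ ω, M ω ∂μ ≤ 1 := by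
    rw [hM, lintegral_lintegral_swap hΦem.aemeasurable]
    calc _ ≤ ∫⁻ _ : EuclideanSpace ℝ (Fin r), 1 ∂γ := lintegral_mono hone
      _ = 1 := by simp
  -- `M` averages over the prior only, so this event does not depend on `t`; that is the source of
  -- uniformity.
  refine ⟨{ω | M ω < ENNReal.ofReal ε⁻¹}, measurableSet_lt hMm measurable_const, ?_, ?_⟩
  · have e4 : {ω | M ω < ENNReal.ofReal ε⁻¹}ᶜ = {ω | ENNReal.ofReal ε⁻¹ ≤ M ω} := by
      ext ω; simp
    rw [e4]
    refine (meas_ge_le_lintegral_div hMm.aemeasurable (by simpa using hε)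
      ENNReal.ofReal_ne_top).trans ?_
    rw [ENNReal.div_le_iff (by simpa using hε) ENNReal.ofReal_ne_top,
      ← ENNReal.ofReal_mul hε.le, mul_inv_cancel₀ hε.ne']
    simpa using hEM
  · intro ω hω t hint hFint
    have hF₁ : Integrable (fun g => F (t + g) - 1) γ := hFint.sub (integrable_const 1)
    have hF₂ : Integrable (fun g => n * (F (t + g) - 1)) γ := hF₁.const_mul _
    have hs : Integrable (fun g => ∑ i, h (t + g) (Z i ω)) γ :=
      integrable_finsetSum _ fun i _ => hint i
    have hΦi : Integrable (fun g => Φ ω (t + g)) γ := hs.sub hF₂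
    have hΦω : Measurable (Φ ω) := hΦm.comp (measurable_const.prodMk measurable_id)
    have h1 := exp_integral_shift_le_lintegral_exp t hΦω hΦi
    have h2 := h1.trans (le_of_lt hω)
    rw [ENNReal.ofReal_le_ofReal_iff (by positivity)] at h2
    have h3 := (Real.le_log_iff_exp_le (by positivity)).2 h2
    have h4 : ∫ g, Φ ω (t + g) ∂γ = ∑ i, ∫ g, h (t + g) (Z i ω) ∂γ -
        n * (∫ g, F (t + g) ∂γ - 1) := by
      simp only [hΦ]
      rw [integral_sub hs hF₂, integral_finsetSum _ fun i _ => hint i,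
        integral_const_mul, integral_sub hFint (integrable_const 1)]
      simp [hF]
    rw [← hγ, h4] at h3
    linarith

/-- The PAC-Bayesian inequality for the quadratic forms `a (⟨t, V⟩² - 1)`. -/
theorem pacBayes_quadratic {Ω : Type*} [MeasurableSpace Ω] {μ : Measure Ω}
    [IsProbabilityMeasure μ]
    {S : Type*} [MeasurableSpace S] {P : Measure S} [IsProbabilityMeasure P] {n r : ℕ}
    {Z : Fin n → Ω → S} (hZ : ∀ i, Measurable (Z i)) (hind : iIndepFun Z μ)
    (hlaw : ∀ i, μ.map (Z i) = P)
    {V : S → EuclideanSpace ℝ (Fin r)} (hV : Measurable V) {M a : ℝ} (hM : ∀ z, ‖V z‖ ≤ M)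
    (ha : ∀ z, 2 * a * ‖V z‖ ^ 2 < 1) {ε : ℝ} (hε : 0 < ε) :
    ∃ B : Set Ω, MeasurableSet B ∧ μ Bᶜ ≤ ENNReal.ofReal ε ∧ ∀ ω ∈ B,
      ∀ (t : EuclideanSpace ℝ (Fin r)) (G : S → ℝ), Integrable G P →
      (∀ z, Real.exp (-a * (‖V z‖ ^ 2 + 1)) * ((√(1 - 2 * a * ‖V z‖ ^ 2))⁻¹ *
        Real.exp (a * (inner ℝ t (V z)) ^ 2 / (1 - 2 * a * ‖V z‖ ^ 2))) ≤ G z) →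
      ∑ i, a * ((inner ℝ t (V (Z i ω))) ^ 2 - 1) ≤
        n * (∫ z, G z ∂P - 1) + ‖t‖ ^ 2 / 2 + Real.log ε⁻¹ := by
  set γ := stdGaussian (EuclideanSpace ℝ (Fin r)) with hγ
  -- Under the posterior, `⟨g, V⟩²` has mean `⟨t, V⟩² + ‖V‖²`; subtracting `‖V‖²` removes the bias
  -- due to the spread of the posterior.
  obtain ⟨h, hh'⟩ : ∃ h : EuclideanSpace ℝ (Fin r) → S → ℝ,
      ∀ g z, h g z = a * ((inner ℝ g (V z)) ^ 2 - ‖V z‖ ^ 2 - 1) := ⟨_, fun _ _ => rfl⟩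
  have hm : Measurable (Function.uncurry h) := by
    have hV' := hV.comp (measurable_snd : Measurable (Prod.snd : EuclideanSpace ℝ (Fin r) × S → S))
    have h1 : Measurable (fun p : EuclideanSpace ℝ (Fin r) × S => (inner ℝ p.1 (V p.2) : ℝ)) :=
      measurable_fst.inner hV'
    have h2 : Function.uncurry h = fun p : EuclideanSpace ℝ (Fin r) × S =>
        a * ((inner ℝ p.1 (V p.2)) ^ 2 - ‖V p.2‖ ^ 2 - 1) := by
      ext p; exact hh' _ _
    rw [h2]
    exact (((h1.pow_const 2).sub (hV'.norm.pow_const 2)).sub_const 1).const_mul a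
  have hfin : ∀ g, ∫⁻ z, ENNReal.ofReal (Real.exp (h g z)) ∂P ≠ ⊤ := by
    intro g
    have hb : ∀ z, h g z ≤ |a| * (‖g‖ ^ 2 * M ^ 2 + M ^ 2 + 1) := by
      intro z
      have hVM : ‖V z‖ ^ 2 ≤ M ^ 2 := by gcongr; exact hM z
      have h1 : (inner ℝ g (V z)) ^ 2 ≤ ‖g‖ ^ 2 * M ^ 2 := by
        have h2 := abs_real_inner_le_norm g (V z)
        calc (inner ℝ g (V z)) ^ 2 = |inner ℝ g (V z)| ^ 2 := (sq_abs _).symm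
          _ ≤ (‖g‖ * ‖V z‖) ^ 2 := by gcongr
          _ = ‖g‖ ^ 2 * ‖V z‖ ^ 2 := by ring
          _ ≤ _ := by gcongr
      rw [hh']
      calc _ ≤ |a * ((inner ℝ g (V z)) ^ 2 - ‖V z‖ ^ 2 - 1)| := le_abs_self _
        _ = |a| * |(inner ℝ g (V z)) ^ 2 - ‖V z‖ ^ 2 - 1| := abs_mul _ _
        _ ≤ _ := by
          gcongr
          rw [abs_le]
          constructor <;> nlinarith [sq_nonneg (inner ℝ g (V z)), sq_nonneg ‖V z‖]
    refine ne_top_of_le_ne_top (b := ENNReal.ofReal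
      (Real.exp (|a| * (‖g‖ ^ 2 * M ^ 2 + M ^ 2 + 1)))) ENNReal.ofReal_ne_top ?_
    calc _ ≤ ∫⁻ _ : S, ENNReal.ofReal (Real.exp (|a| * (‖g‖ ^ 2 * M ^ 2 + M ^ 2 + 1))) ∂P :=
          lintegral_mono fun z => ENNReal.ofReal_le_ofReal (Real.exp_le_exp.2 (hb z))
      _ = _ := by simp
  obtain ⟨B, hB, hBε, hBt⟩ := pacBayes_gaussian hZ hind hlaw hm hfin hε
  refine ⟨B, hB, hBε, fun ω hω t G hG hGz => ?_⟩
  have hsq₁ : ∀ z, Integrable (fun g => (inner ℝ (t + g) (V z)) ^ 2 - ‖V z‖ ^ 2) γ := fun z =>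
    (integrable_sq_shift_stdGaussian t (V z)).sub (integrable_const _)
  have hsq₂ : ∀ z, Integrable (fun g => (inner ℝ (t + g) (V z)) ^ 2 - ‖V z‖ ^ 2 - 1) γ := fun z =>
    (hsq₁ z).sub (integrable_const _)
  have hsq : ∀ z, Integrable (fun g => h (t + g) z) γ := fun z => by
    simp only [hh']; exact (hsq₂ z).const_mul a
  have hsqi : ∀ z, ∫ g, h (t + g) z ∂γ = a * ((inner ℝ t (V z)) ^ 2 - 1) := by
    intro z
    simp only [hh']
    have i2 : ∫ g, ((inner ℝ (t + g) (V z)) ^ 2 - ‖V z‖ ^ 2 - 1) ∂γ =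
        ∫ g, ((inner ℝ (t + g) (V z)) ^ 2 - ‖V z‖ ^ 2) ∂γ - ∫ _, (1 : ℝ) ∂γ :=
      integral_sub (hsq₁ z) (integrable_const _)
    have i1 : ∫ g, ((inner ℝ (t + g) (V z)) ^ 2 - ‖V z‖ ^ 2) ∂γ =
        ∫ g, (inner ℝ (t + g) (V z)) ^ 2 ∂γ - ∫ _, ‖V z‖ ^ 2 ∂γ :=
      integral_sub (integrable_sq_shift_stdGaussian t (V z)) (integrable_const _)
    rw [integral_const_mul, i2, i1, hγ, integral_sq_shift_stdGaussian]
    simp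
  have hG0 : ∀ z, 0 ≤ G z := fun z => le_trans (by positivity) (hGz z)
  have hexpm : Measurable (Function.uncurry fun g z => ENNReal.ofReal (Real.exp (h (t + g) z))) := by
    have : Measurable (fun p : EuclideanSpace ℝ (Fin r) × S => h (t + p.1) p.2) :=
      hm.comp ((measurable_fst.const_add t).prodMk measurable_snd)
    exact ENNReal.measurable_ofReal.comp (Real.measurable_exp.comp this)
  -- With the integral over `g` performed first, the integrand is the explicit Laplace transform of
  -- a squared Gaussian variable.
  have hbound : ∫⁻ g, ∫⁻ z, ENNReal.ofReal (Real.exp (h (t + g) z)) ∂P ∂γ ≤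
      ENNReal.ofReal (∫ z, G z ∂P) := by
    rw [lintegral_lintegral_swap hexpm.aemeasurable,
      ofReal_integral_eq_lintegral_ofReal hG (Eventually.of_forall hG0)]
    refine lintegral_mono fun z => ?_
    have e1 : ∀ g, ENNReal.ofReal (Real.exp (h (t + g) z)) =
        ENNReal.ofReal (Real.exp (-a * (‖V z‖ ^ 2 + 1))) *
          ENNReal.ofReal (Real.exp (a * (inner ℝ (t + g) (V z)) ^ 2)) := by
      intro g
      rw [← ENNReal.ofReal_mul (Real.exp_pos _).le, ← Real.exp_add]
      simp only [hh']
      congr 2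
      ring
    simp_rw [e1]
    rw [lintegral_const_mul' _ _ ENNReal.ofReal_ne_top, hγ, lintegral_exp_sq_stdGaussian _ _ _ (ha z),
      ← ENNReal.ofReal_mul (Real.exp_pos _).le]
    exact ENNReal.ofReal_le_ofReal (hGz z)
  have hFm : Measurable fun g => ∫⁻ z, ENNReal.ofReal (Real.exp (h (t + g) z)) ∂P :=
    Measurable.lintegral_prod_right hexpm
  have hFi : Integrable (fun g => (∫⁻ z, ENNReal.ofReal (Real.exp (h (t + g) z)) ∂P).toReal) γ :=
    integrable_toReal_of_lintegral_ne_top hFm.aemeasurable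
      (ne_top_of_le_ne_top ENNReal.ofReal_ne_top hbound)
  have hFle : ∫ g, (∫⁻ z, ENNReal.ofReal (Real.exp (h (t + g) z)) ∂P).toReal ∂γ ≤
      ∫ z, G z ∂P := by
    rw [integral_toReal hFm.aemeasurable (Eventually.of_forall fun g => (hfin _).lt_top)]
    exact ENNReal.toReal_le_of_le_ofReal (integral_nonneg hG0) hbound
  have hfinal := hBt ω hω t (fun i => hsq _) hFi
  simp only [← hγ, hsqi] at hfinal
  refine hfinal.trans ?_
  gcongr

end OLS

/-! ### Scalar inequalities for the smoothed exponential. -/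

namespace OLS

/-- The lower bound for `exp (-x)` is inverted by means of `(1 + x + x²/2)(1 - x + x²/2) = 1 + x⁴/4
≥ 1`. -/
theorem exp_le_quadratic_of_nonpos {x : ℝ} (hx : x ≤ 0) : Real.exp x ≤ 1 + x + x ^ 2 / 2 := by
  have h := Real.quadratic_le_exp_of_nonneg (neg_nonneg.2 hx)
  have h1 : Real.exp x * Real.exp (-x) = 1 := by rw [← Real.exp_add]; simp
  have h2 := Real.exp_pos x
  have h3 : 0 < 1 + -x + (-x) ^ 2 / 2 := by nlinarith
  have h4 : Real.exp x * (1 + -x + (-x) ^ 2 / 2) ≤ 1 :=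
    (mul_le_mul_of_nonneg_left h h2.le).trans h1.le
  nlinarith [sq_nonneg (x ^ 2)]

/-- The Taylor bound of `exp (x / 2)`, valid for `x / 2 ≤ 1`, is squared in order to reach `x = 2`.
The coefficient `1 / 15` in place of `1 / 24` absorbs the tail. -/
theorem exp_le_quartic {x : ℝ} (h0 : 0 ≤ x) (h2 : x ≤ 2) :
    Real.exp x ≤ 1 + x + x ^ 2 / 2 + x ^ 3 / 6 + x ^ 4 / 15 := by
  obtain ⟨y, rfl⟩ : ∃ y, x = 2 * y := ⟨x / 2, by ring⟩
  have hy0 : 0 ≤ y := by linarith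
  have hy1 : y ≤ 1 := by linarith
  have h := Real.exp_bound' hy0 hy1 (n := 6) (by norm_num)
  simp only [Finset.sum_range_succ, Finset.sum_range_zero, Nat.factorial] at h
  norm_num at h
  have he : Real.exp (2 * y) = Real.exp y ^ 2 := by rw [← Real.exp_nat_mul]; norm_num
  rw [he]
  have hpos := (Real.exp_pos y).le
  refine (pow_le_pow_left₀ hpos h 2).trans ?_
  have p1 : y ^ 2 ≤ 1 := pow_le_one₀ hy0 hy1
  have p2 : y ^ 3 ≤ 1 := pow_le_one₀ hy0 hy1
  have p3 : y ^ 4 ≤ 1 := pow_le_one₀ hy0 hy1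
  have p4 : y ^ 5 ≤ 1 := pow_le_one₀ hy0 hy1
  have p5 : y ^ 6 ≤ 1 := pow_le_one₀ hy0 hy1
  have p6 : y ^ 7 ≤ 1 := pow_le_one₀ hy0 hy1
  have p7 : y ^ 8 ≤ 1 := pow_le_one₀ hy0 hy1
  have q := pow_nonneg hy0 4
  nlinarith [mul_nonneg q (sub_nonneg.2 hy1), mul_nonneg q (sub_nonneg.2 p1),
    mul_nonneg q (sub_nonneg.2 p2), mul_nonneg q (sub_nonneg.2 p3), mul_nonneg q (sub_nonneg.2 p4),
    mul_nonneg q (sub_nonneg.2 p5), mul_nonneg q (sub_nonneg.2 p6), mul_nonneg q (sub_nonneg.2 p7)]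

/-- The terms of order three and four are replaced by their values at `l`, a constant. With `x` of
the form `l - l⟨θ, W⟩²`, only fourth moments of `W` are then needed. -/
theorem exp_le_quadratic_add {x l : ℝ} (hxl : x ≤ l) (hl0 : 0 ≤ l) (hl2 : l ≤ 2) :
    Real.exp x ≤ 1 + x + x ^ 2 / 2 + (1 / 6 + l / 15) * l ^ 3 := by
  rcases le_total x 0 with hx | hx
  · have := exp_le_quadratic_of_nonpos hx
    have : 0 ≤ (1 / 6 + l / 15) * l ^ 3 := by positivity
    linarith
  · have h := exp_le_quartic hx (hxl.trans hl2)
    have h3 : x ^ 3 ≤ l ^ 3 := by gcongr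
    have h4 : x ^ 4 ≤ l ^ 4 := by gcongr
    nlinarith

theorem exp_le_one_add_add_sq {x : ℝ} (h0 : 0 ≤ x) (h1 : x ≤ 1) :
    Real.exp x ≤ 1 + x + x ^ 2 := by
  have h := exp_le_quartic h0 (h1.trans (by norm_num))
  nlinarith [pow_nonneg h0 2, mul_nonneg (pow_nonneg h0 2) (sub_nonneg.2 h1),
    mul_nonneg (pow_nonneg h0 3) (sub_nonneg.2 h1)]

theorem exp_two_le : Real.exp 2 ≤ 7.5 := by
  have h := exp_le_quartic (x := 2) (by norm_num) le_rfl
  norm_num at h ⊢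
  linarith

/-- The bound on the Gaussian smoothing of `exp (-τ)` used for the lower deviations. -/
theorem smoothed_exp_neg_le {u τ l : ℝ} (hu0 : 0 ≤ u) (hu1 : u ≤ 1) (hτ : 0 ≤ τ)
    (hl0 : 0 ≤ l) (hl2 : l ≤ 2) :
    Real.exp (u + l) * ((√(1 + 2 * u))⁻¹ * Real.exp (-τ / (1 + 2 * u))) ≤
      1 + l + l ^ 2 / 2 + (1 / 6 + l / 15) * l ^ 3 - (1 + l) * τ + τ ^ 2 / 2 + 6 * (u * τ) +
        15 * u ^ 2 := by
  have hpos : 0 < 1 + 2 * u := by linarith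
  -- The factor `exp u`, which comes from the centring by `‖V‖²`, cancels the first-order term of
  -- `(1 + 2u)^(-1/2)` and leaves an error quadratic in `u`.
  have hlog : Real.exp u * (√(1 + 2 * u))⁻¹ ≤ Real.exp (u ^ 2) := by
    have h1 : 2 * u - 2 * u ^ 2 ≤ Real.log (1 + 2 * u) := by
      have := Real.le_log_one_add_of_nonneg (x := 2 * u) (by linarith)
      refine le_trans ?_ this
      rw [le_div_iff₀ (by linarith)]
      nlinarith [pow_nonneg hu0 3]
    have h2 : Real.exp (u - u ^ 2) ≤ √(1 + 2 * u) := by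
      apply Real.le_sqrt_of_sq_le
      rw [← Real.exp_nat_mul, ← Real.le_log_iff_exp_le hpos]
      push_cast
      linarith
    rw [← div_eq_mul_inv, div_le_iff₀ (by positivity)]
    calc Real.exp u = Real.exp (u ^ 2) * Real.exp (u - u ^ 2) := by
          rw [← Real.exp_add]; ring_nf
      _ ≤ _ := by gcongr
  set y := τ / (1 + 2 * u) with hy
  have hy0 : 0 ≤ y := by positivity
  have hyτ : y ≤ τ := div_le_self hτ (by linarith)
  have hyl : τ - 2 * (u * τ) ≤ y := by
    rw [hy, le_div_iff₀ hpos]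
    nlinarith [mul_nonneg (mul_nonneg hu0 hu0) hτ]
  have hmain := exp_le_quadratic_add (x := l - y) (by linarith) hl0 hl2
  have hu2 : u ^ 2 ≤ 1 := pow_le_one₀ hu0 hu1
  have hexp2 : Real.exp (u ^ 2) ≤ 1 + 2 * u ^ 2 := by
    have := exp_le_one_add_add_sq (sq_nonneg u) hu2
    nlinarith [sq_nonneg u]
  have hE : Real.exp (l - y) ≤ 7.5 := (Real.exp_le_exp.2 (by linarith)).trans exp_two_le
  have hrew : Real.exp (u + l) * ((√(1 + 2 * u))⁻¹ * Real.exp (-τ / (1 + 2 * u))) =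
      (Real.exp u * (√(1 + 2 * u))⁻¹) * Real.exp (l - y) := by
    rw [Real.exp_add, sub_eq_add_neg l y, Real.exp_add, hy, neg_div]; ring
  rw [hrew]
  -- The constant `15` is `2 · 7.5`, where `exp 2 ≤ 7.5`; `6` is the value of `2 (1 + l)` at `l =
  -- 2`, the factor `2` coming from `y ≥ τ - 2uτ`.
  calc (Real.exp u * (√(1 + 2 * u))⁻¹) * Real.exp (l - y)
      ≤ (1 + 2 * u ^ 2) * Real.exp (l - y) := by gcongr; exact hlog.trans hexp2
    _ ≤ Real.exp (l - y) + 15 * u ^ 2 := by nlinarith [sq_nonneg u]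
    _ ≤ _ := by
      have h5 : y ^ 2 ≤ τ ^ 2 := by gcongr
      have h6 : l * τ - 2 * l * (u * τ) ≤ l * y := by nlinarith
      have h7 : l * (u * τ) ≤ 2 * (u * τ) := by
        have : 0 ≤ u * τ := by positivity
        gcongr
      nlinarith

/-- The function `w - w³/3` peaks at `w = 1`. This makes the weighted vector bounded without
truncation and keeps its Laplace transform finite. -/
theorem weight_mul_le (w : ℝ) (hw : 0 ≤ w) : max (1 - w ^ 2 / 3) 0 * w ≤ 2 / 3 := by
  rcases le_total (1 - w ^ 2 / 3) 0 with h | h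
  · rw [max_eq_right h]; norm_num
  · rw [max_eq_left h]; nlinarith [sq_nonneg (w - 1), mul_nonneg hw (sq_nonneg (w - 1))]

/-- The ratio of the two sides is monotone: the derivative reduces to `x²/2 + x³ + x⁴/2` times a
positive factor. This dictates the weight: for `τ ≤ w`, `(1 - w²/3) τ ≤ τ - τ³/3`, so the
exponential of the weighted variable has a quadratic bound. -/
theorem sub_cube_le_log {x : ℝ} (hx : 0 ≤ x) :
    Real.exp (x - x ^ 3 / 3) ≤ 1 + x + x ^ 2 / 2 := by
  have hder : ∀ y : ℝ, HasDerivAt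
      (fun y => (1 + y + y ^ 2 / 2) * Real.exp (-(y - y ^ 3 / 3)))
      ((1 + y) * Real.exp (-(y - y ^ 3 / 3)) +
        (1 + y + y ^ 2 / 2) * (Real.exp (-(y - y ^ 3 / 3)) * (-(1 - y ^ 2)))) y := by
    intro y
    have h1 : HasDerivAt (fun y : ℝ => 1 + y + y ^ 2 / 2) (1 + y) y := by
      have := ((hasDerivAt_id y).const_add 1).add ((hasDerivAt_pow 2 y).div_const 2)
      refine this.congr_deriv ?_
      simp
    have h2 : HasDerivAt (fun y : ℝ => -(y - y ^ 3 / 3)) (-(1 - y ^ 2)) y := by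
      have := ((hasDerivAt_id y).sub ((hasDerivAt_pow 3 y).div_const 3)).neg
      refine this.congr_deriv ?_
      simp
    exact h1.mul h2.exp
  have hmono : MonotoneOn (fun y => (1 + y + y ^ 2 / 2) * Real.exp (-(y - y ^ 3 / 3)))
      (Set.Ici 0) := by
    apply monotoneOn_of_deriv_nonneg (convex_Ici 0)
    · exact fun y _ => (hder y).continuousAt.continuousWithinAt
    · exact fun y _ => (hder y).differentiableAt.differentiableWithinAt
    · intro y hy
      rw [interior_Ici, Set.mem_Ioi] at hy
      rw [(hder y).deriv]
      have : (1 + y) * Real.exp (-(y - y ^ 3 / 3)) +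
        (1 + y + y ^ 2 / 2) * (Real.exp (-(y - y ^ 3 / 3)) * (-(1 - y ^ 2))) =
        Real.exp (-(y - y ^ 3 / 3)) * (y ^ 2 / 2 + y ^ 3 + y ^ 4 / 2) := by ring
      rw [this]
      positivity
  have h := hmono (Set.mem_Ici.2 le_rfl) (Set.mem_Ici.2 hx) hx
  simp only at h
  norm_num at h
  calc Real.exp (x - x ^ 3 / 3) = 1 * Real.exp (x - x ^ 3 / 3) := (one_mul _).symm
    _ ≤ ((1 + x + x ^ 2 / 2) * Real.exp (x ^ 3 / 3 - x)) * Real.exp (x - x ^ 3 / 3) := by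
        gcongr
    _ = 1 + x + x ^ 2 / 2 := by
        rw [mul_assoc, ← Real.exp_add]; simp

/-- The bound on the Gaussian smoothing of `exp τ` used for the upper deviations, where the
weight `1 - w² / 3` compensates for the terms of order three. -/
theorem smoothed_exp_le {w τ β : ℝ} (hβ : 10 ≤ β) (hτ : 0 ≤ τ) (hτw : τ ≤ w) :
    (max (1 - w ^ 2 / 3) 0 * w / β) ≤ 1 / 15 ∧
    Real.exp (-(max (1 - w ^ 2 / 3) 0 * w / β)) *
      ((√(1 - 2 * (max (1 - w ^ 2 / 3) 0 * w / β)))⁻¹ *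
        Real.exp (max (1 - w ^ 2 / 3) 0 * τ / (1 - 2 * (max (1 - w ^ 2 / 3) 0 * w / β)))) ≤
      1 + τ + τ ^ 2 / 2 + 6 * (w / β * τ) + 5 * (w / β) ^ 2 := by
  have hw : 0 ≤ w := hτ.trans hτw
  have hg0 : 0 ≤ max (1 - w ^ 2 / 3) 0 := le_max_right _ _
  have hg1 : max (1 - w ^ 2 / 3) 0 ≤ 1 := max_le (by nlinarith [sq_nonneg w]) zero_le_one
  have hgw := weight_mul_le w hw
  have hexpg : Real.exp (max (1 - w ^ 2 / 3) 0 * τ) ≤ 1 + τ + τ ^ 2 / 2 := by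
    rcases le_total (1 - w ^ 2 / 3) 0 with h | h
    · rw [max_eq_right h, zero_mul, Real.exp_zero]; nlinarith [sq_nonneg τ]
    · rw [max_eq_left h]
      refine (Real.exp_le_exp.2 ?_).trans (sub_cube_le_log hτ)
      have : τ ^ 2 ≤ w ^ 2 := by gcongr
      nlinarith
  set g := max (1 - w ^ 2 / 3) 0 with hg
  set s := g * w / β with hs
  have hβ0 : 0 < β := by linarith
  have hs0 : 0 ≤ s := by positivity
  have hs1 : s ≤ 1 / 15 := by
    rw [hs, div_le_iff₀ hβ0]; linarith
  refine ⟨hs1, ?_⟩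
  have hsu : s ≤ w / β := by
    rw [hs]; gcongr; nlinarith
  have hpos : 0 < 1 - 2 * s := by linarith
  have hgτ : g * τ ≤ 2 / 3 := le_trans (by gcongr) hgw
  have hgτ0 : 0 ≤ g * τ := by positivity
  have h1 : (√(1 - 2 * s))⁻¹ ≤ Real.exp (s + 2 * s ^ 2) := by
    rw [inv_le_comm₀ (Real.sqrt_pos.2 hpos) (Real.exp_pos _), ← Real.exp_neg]
    apply Real.le_sqrt_of_sq_le
    rw [← Real.exp_nat_mul]
    push_cast
    have h2 := exp_le_quadratic_of_nonpos (x := 2 * -(s + 2 * s ^ 2)) (by nlinarith)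
    refine h2.trans ?_
    nlinarith [sq_nonneg s, mul_nonneg hs0 (sq_nonneg s), mul_nonneg (sq_nonneg s) (sq_nonneg s),
      mul_nonneg (sub_nonneg.2 hs1) (sq_nonneg s),
      mul_nonneg (sub_nonneg.2 hs1) (mul_nonneg hs0 (sq_nonneg s))]
  have h2 : g * τ / (1 - 2 * s) ≤ g * τ + 2.5 * s * (g * τ) := by
    rw [div_le_iff₀ hpos]
    nlinarith [mul_nonneg hgτ0 hs0, mul_nonneg (mul_nonneg hgτ0 hs0) (sub_nonneg.2 hs1)]
  -- Everything beyond `exp (g τ)` is collected in `e ≤ 0.125`, hence `exp e ≤ 1 + 1.125 e`. With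
  -- `exp (g τ) ≤ 2` this costs `2.25 e`, and `2.25 · 2.5 ≤ 6`, `2.25 · 2 ≤ 5`.
  set e := 2.5 * s * (g * τ) + 2 * s ^ 2 with he
  have he0 : 0 ≤ e := by positivity
  have he1 : e ≤ 0.125 := by
    have a1 : s * (g * τ) ≤ 1 / 15 * (2 / 3) := by gcongr
    have a2 : s ^ 2 ≤ (1 / 15) ^ 2 := by gcongr
    rw [he]
    norm_num at a1 a2 ⊢
    linarith
  have hee : Real.exp e ≤ 1 + 1.125 * e := by
    have := exp_le_one_add_add_sq he0 (he1.trans (by norm_num))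
    norm_num at he1 ⊢
    nlinarith
  have h23 : Real.exp (g * τ) ≤ 2 := by
    refine (Real.exp_le_exp.2 hgτ).trans ?_
    have := exp_le_quartic (x := 2 / 3) (by norm_num) (by norm_num)
    norm_num at this
    linarith
  calc Real.exp (-s) * ((√(1 - 2 * s))⁻¹ * Real.exp (g * τ / (1 - 2 * s)))
      ≤ Real.exp (-s) * (Real.exp (s + 2 * s ^ 2) *
          Real.exp (g * τ + 2.5 * s * (g * τ))) := by gcongr
    _ = Real.exp (g * τ) * Real.exp e := by
        rw [← Real.exp_add, ← Real.exp_add, ← Real.exp_add, he]; ring_nf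
    _ ≤ Real.exp (g * τ) * (1 + 1.125 * e) := by gcongr
    _ ≤ Real.exp (g * τ) + 2.25 * e := by
        norm_num
        nlinarith
    _ ≤ _ := by
        have b1 : s * (g * τ) ≤ w / β * τ := by
          have : g * τ ≤ τ := by nlinarith
          gcongr
        have b2 : s ^ 2 ≤ (w / β) ^ 2 := by gcongr
        have b3 : 0 ≤ w / β * τ := by positivity
        have b4 := sq_nonneg (w / β)
        rw [he]
        norm_num
        linarith

end OLS

/-! ### Isotropic vectors: fourth moments and uniform deviations. -/

namespace OLS

/-- `W` is isotropic under `P`, with kurtosis at most `K` in every direction. -/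
structure IsIsotropic {S : Type*} [MeasurableSpace S] (P : Measure S) {r : ℕ}
    (W : S → EuclideanSpace ℝ (Fin r)) (K : ℝ) : Prop where
  measurable : Measurable W
  integral_sq : ∀ θ, ∫ z, (inner ℝ θ (W z)) ^ 2 ∂P = ‖θ‖ ^ 2
  integrable_four : ∀ θ, Integrable (fun z => (inner ℝ θ (W z) : ℝ) ^ 4) P
  integral_four_le : ∀ θ, ∫ z, (inner ℝ θ (W z)) ^ 4 ∂P ≤ K * ‖θ‖ ^ 4

namespace IsIsotropic

variable {S : Type*} [MeasurableSpace S] {P : Measure S} {r : ℕ}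
  {W : S → EuclideanSpace ℝ (Fin r)} {K : ℝ}

theorem measurable_inner (h : IsIsotropic P W K) (θ : EuclideanSpace ℝ (Fin r)) :
    Measurable (fun z => (inner ℝ θ (W z) : ℝ)) := by
  have := h.measurable
  fun_prop

theorem integrable_sq [IsProbabilityMeasure P] (h : IsIsotropic P W K) (θ : EuclideanSpace ℝ (Fin r)) :
    Integrable (fun z => (inner ℝ θ (W z) : ℝ) ^ 2) P := by
  refine Integrable.mono' ((integrable_const (1 : ℝ)).add (h.integrable_four θ))
    ((h.measurable_inner θ).pow_const 2).aestronglyMeasurable (Eventually.of_forall fun z => ?_)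
  rw [Real.norm_of_nonneg (sq_nonneg _), Pi.add_apply]
  nlinarith [sq_nonneg ((inner ℝ θ (W z) : ℝ) ^ 2 - 1)]

theorem coord_eq (x : EuclideanSpace ℝ (Fin r)) (j : Fin r) :
    x j = inner ℝ (EuclideanSpace.single j (1 : ℝ)) x := by
  rw [EuclideanSpace.inner_single_left]
  simp

theorem integrable_coord (h : IsIsotropic P W K) (j : Fin r) :
    Integrable (fun z => W z j ^ 4) P := by
  simp_rw [coord_eq]
  exact h.integrable_four _

theorem integral_coord_le (h : IsIsotropic P W K) (j : Fin r) :
    ∫ z, W z j ^ 4 ∂P ≤ K := by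
  simp_rw [coord_eq]
  simpa using h.integral_four_le (EuclideanSpace.single j (1 : ℝ))

theorem norm_four_le (x : EuclideanSpace ℝ (Fin r)) : ‖x‖ ^ 4 ≤ r * ∑ j, x j ^ 4 := by
  have h1 : ‖x‖ ^ 4 = (∑ j, x j ^ 2) ^ 2 := by
    rw [← EuclideanSpace.real_norm_sq_eq]; ring
  rw [h1]
  refine (sq_sum_le_card_mul_sum_sq (s := Finset.univ) (f := fun j => x j ^ 2)).trans_eq ?_
  simp [← pow_mul]

theorem integrable_norm_four (h : IsIsotropic P W K) : Integrable (fun z => ‖W z‖ ^ 4) P := by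
  refine Integrable.mono' ((integrable_finsetSum Finset.univ
    fun j _ => h.integrable_coord j).const_mul (r : ℝ))
    (h.measurable.norm.pow_const 4).aestronglyMeasurable (Eventually.of_forall fun z => ?_)
  rw [Real.norm_of_nonneg (by positivity)]
  exact norm_four_le _

theorem integral_norm_four_le (h : IsIsotropic P W K) : ∫ z, ‖W z‖ ^ 4 ∂P ≤ (r : ℝ) ^ 2 * K := by
  calc ∫ z, ‖W z‖ ^ 4 ∂P ≤ ∫ z, r * ∑ j, W z j ^ 4 ∂P :=
        integral_mono h.integrable_norm_four ((integrable_finsetSum Finset.univ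
          fun j _ => h.integrable_coord j).const_mul (r : ℝ)) fun z => norm_four_le _
    _ = r * ∑ j, ∫ z, W z j ^ 4 ∂P := by
        rw [integral_const_mul, integral_finsetSum _ fun j _ => h.integrable_coord j]
    _ ≤ r * ∑ _j : Fin r, K := by gcongr with j; exact h.integral_coord_le j
    _ = _ := by simp; ring

/-- The arithmetic–geometric inequality is applied coordinate by coordinate, so that only fourth
powers of linear forms remain, each controlled by `K`. -/
theorem mixed_le (θ x : EuclideanSpace ℝ (Fin r)) :
    (inner ℝ θ x) ^ 2 * ‖x‖ ^ 2 ≤ (r * (inner ℝ θ x) ^ 4 + ∑ j, x j ^ 4) / 2 := by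
  have h1 : (r : ℝ) * (inner ℝ θ x) ^ 4 = ∑ _j : Fin r, (inner ℝ θ x : ℝ) ^ 4 := by simp
  rw [EuclideanSpace.real_norm_sq_eq, h1, Finset.mul_sum, ← Finset.sum_add_distrib, Finset.sum_div]
  refine Finset.sum_le_sum fun j _ => ?_
  nlinarith [sq_nonneg ((inner ℝ θ x : ℝ) ^ 2 - x j ^ 2)]

theorem integrable_mixed_bound (h : IsIsotropic P W K) (θ : EuclideanSpace ℝ (Fin r)) :
    Integrable (fun z => (r * (inner ℝ θ (W z) : ℝ) ^ 4 + ∑ j, W z j ^ 4) / 2) P :=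
  (((h.integrable_four θ).const_mul (r : ℝ)).add
    (integrable_finsetSum Finset.univ fun j _ => h.integrable_coord j)).div_const 2

theorem integrable_mixed (h : IsIsotropic P W K) (θ : EuclideanSpace ℝ (Fin r)) :
    Integrable (fun z => (inner ℝ θ (W z) : ℝ) ^ 2 * ‖W z‖ ^ 2) P := by
  refine Integrable.mono' (h.integrable_mixed_bound θ)
    (((h.measurable_inner θ).pow_const 2).mul
      (h.measurable.norm.pow_const 2)).aestronglyMeasurable (Eventually.of_forall fun z => ?_)
  rw [Real.norm_of_nonneg (by positivity)]
  exact mixed_le _ _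

theorem integral_mixed_le (h : IsIsotropic P W K) {θ : EuclideanSpace ℝ (Fin r)} (hθ : ‖θ‖ = 1) :
    ∫ z, (inner ℝ θ (W z)) ^ 2 * ‖W z‖ ^ 2 ∂P ≤ r * K := by
  have h4 := h.integral_four_le θ
  rw [hθ] at h4
  calc ∫ z, (inner ℝ θ (W z)) ^ 2 * ‖W z‖ ^ 2 ∂P
      ≤ ∫ z, (r * (inner ℝ θ (W z) : ℝ) ^ 4 + ∑ j, W z j ^ 4) / 2 ∂P :=
        integral_mono (h.integrable_mixed θ) (h.integrable_mixed_bound θ) fun z => mixed_le _ _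
    _ = (r * ∫ z, (inner ℝ θ (W z) : ℝ) ^ 4 ∂P + ∑ j, ∫ z, W z j ^ 4 ∂P) / 2 := by
        rw [integral_div, integral_add ((h.integrable_four θ).const_mul (r : ℝ))
          (integrable_finsetSum Finset.univ fun j _ => h.integrable_coord j), integral_const_mul,
          integral_finsetSum _ fun j _ => h.integrable_coord j]
    _ ≤ (r * K + ∑ _j : Fin r, K) / 2 := by
        gcongr with j
        · linarith
        · exact h.integral_coord_le j
    _ = _ := by simp

/-- The expectation of a polynomial of degree four in `W`, with respect to the variables
`τ = l ⟨θ, W⟩²` and `u = l ‖W‖² / β`. -/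
theorem integral_quartic_le [IsProbabilityMeasure P] (h : IsIsotropic P W K) (hK : 0 ≤ K)
    {θ : EuclideanSpace ℝ (Fin r)} (hθ : ‖θ‖ = 1) {D l β : ℝ} (hD : r ≤ D) (hβ : 0 < β)
    (c₀ c₁ : ℝ) {c₂ c₃ : ℝ} (hc₂ : 0 ≤ c₂) (hc₃ : 0 ≤ c₃) :
    Integrable (fun z => c₀ + c₁ * (l * (inner ℝ θ (W z)) ^ 2) +
        (l * (inner ℝ θ (W z)) ^ 2) ^ 2 / 2 +
        c₂ * (l * ‖W z‖ ^ 2 / β * (l * (inner ℝ θ (W z)) ^ 2)) +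
        c₃ * (l * ‖W z‖ ^ 2 / β) ^ 2) P ∧
    ∫ z, (c₀ + c₁ * (l * (inner ℝ θ (W z)) ^ 2) +
        (l * (inner ℝ θ (W z)) ^ 2) ^ 2 / 2 +
        c₂ * (l * ‖W z‖ ^ 2 / β * (l * (inner ℝ θ (W z)) ^ 2)) +
        c₃ * (l * ‖W z‖ ^ 2 / β) ^ 2) ∂P ≤
      c₀ + c₁ * l + l ^ 2 * K / 2 + l ^ 2 * K * (c₂ * (D / β) + c₃ * (D / β) ^ 2) := by
  have hrw : (fun z => c₀ + c₁ * (l * (inner ℝ θ (W z)) ^ 2) +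
        (l * (inner ℝ θ (W z)) ^ 2) ^ 2 / 2 +
        c₂ * (l * ‖W z‖ ^ 2 / β * (l * (inner ℝ θ (W z)) ^ 2)) +
        c₃ * (l * ‖W z‖ ^ 2 / β) ^ 2) = fun z => (((c₀ + c₁ * l * (inner ℝ θ (W z)) ^ 2) +
        l ^ 2 / 2 * (inner ℝ θ (W z)) ^ 4) +
        c₂ * l ^ 2 / β * ((inner ℝ θ (W z)) ^ 2 * ‖W z‖ ^ 2)) +
        c₃ * l ^ 2 / β ^ 2 * ‖W z‖ ^ 4 := by
    ext z; field_simp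
  rw [hrw]
  have i1 : Integrable (fun z => c₀ + c₁ * l * (inner ℝ θ (W z)) ^ 2) P :=
    (integrable_const c₀).add ((h.integrable_sq θ).const_mul _)
  have i2 : Integrable (fun z => l ^ 2 / 2 * (inner ℝ θ (W z)) ^ 4) P :=
    (h.integrable_four θ).const_mul _
  have i3 : Integrable (fun z => c₂ * l ^ 2 / β * ((inner ℝ θ (W z)) ^ 2 * ‖W z‖ ^ 2)) P :=
    (h.integrable_mixed θ).const_mul _
  have i4 : Integrable (fun z => c₃ * l ^ 2 / β ^ 2 * ‖W z‖ ^ 4) P :=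
    h.integrable_norm_four.const_mul _
  have i12 : Integrable (fun z => (c₀ + c₁ * l * (inner ℝ θ (W z)) ^ 2) +
        l ^ 2 / 2 * (inner ℝ θ (W z)) ^ 4) P := i1.add i2
  have i123 : Integrable (fun z => ((c₀ + c₁ * l * (inner ℝ θ (W z)) ^ 2) +
        l ^ 2 / 2 * (inner ℝ θ (W z)) ^ 4) +
        c₂ * l ^ 2 / β * ((inner ℝ θ (W z)) ^ 2 * ‖W z‖ ^ 2)) P := i12.add i3
  refine ⟨i123.add i4, ?_⟩
  rw [integral_add i123 i4, integral_add i12 i3, integral_add i1 i2,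
    integral_add (integrable_const c₀) ((h.integrable_sq θ).const_mul _), integral_const_mul,
    integral_const_mul, integral_const_mul, integral_const_mul, h.integral_sq, hθ]
  have h4 := h.integral_four_le θ
  rw [hθ] at h4
  have hr : (0 : ℝ) ≤ r := Nat.cast_nonneg r
  have hm := (h.integral_mixed_le hθ).trans (mul_le_mul_of_nonneg_right hD hK)
  have hn := h.integral_norm_four_le.trans (mul_le_mul_of_nonneg_right
    (pow_le_pow_left₀ hr hD 2) hK)
  have e1 : l ^ 2 / 2 * ∫ z, (inner ℝ θ (W z) : ℝ) ^ 4 ∂P ≤ l ^ 2 / 2 * K := by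
    gcongr; linarith
  have e2 : c₂ * l ^ 2 / β * ∫ z, (inner ℝ θ (W z) : ℝ) ^ 2 * ‖W z‖ ^ 2 ∂P ≤
      c₂ * l ^ 2 / β * (D * K) := by gcongr
  have e3 : c₃ * l ^ 2 / β ^ 2 * ∫ z, ‖W z‖ ^ 4 ∂P ≤ c₃ * l ^ 2 / β ^ 2 * (D ^ 2 * K) := by gcongr
  have e4 : l ^ 2 * K * (c₂ * (D / β) + c₃ * (D / β) ^ 2) =
      c₂ * l ^ 2 / β * (D * K) + c₃ * l ^ 2 / β ^ 2 * (D ^ 2 * K) := by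
    field_simp
  rw [e4]
  simp only [integral_const, probReal_univ, smul_eq_mul, one_mul, one_pow, mul_one]
  linarith

variable [IsProbabilityMeasure P] {Ω : Type*} [MeasurableSpace Ω] {μ : Measure Ω} [IsProbabilityMeasure μ] {n : ℕ}
  {Z : Fin n → Ω → S}

/-- Uniform lower deviations of the empirical quadratic form of an isotropic vector. -/
theorem lower_deviation (h : IsIsotropic P W K) (hK : 0 ≤ K)
    (hZ : ∀ i, Measurable (Z i)) (hind : iIndepFun Z μ) (hlaw : ∀ i, μ.map (Z i) = P)
    {D l β ε : ℝ} (hD : r ≤ D) (hl0 : 0 < l) (hl2 : l ≤ 2) (hβ : 0 < β) (hε : 0 < ε) :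
    ∃ B : Set Ω, MeasurableSet B ∧ μ Bᶜ ≤ ENNReal.ofReal ε ∧ ∀ ω ∈ B, ∀ θ, ‖θ‖ = 1 →
      ∑ i, l * (1 - (inner ℝ θ (W (Z i ω))) ^ 2) ≤
        n * ((K - 1) * l ^ 2 / 2 + (1 / 6 + l / 15) * l ^ 3 +
          l ^ 2 * K * (9 * (D / β) + 15 * (D / β) ^ 2)) + β / 2 + Real.log ε⁻¹ := by
  classical
  -- Truncation makes `V` bounded. It can only decrease `⟨t, V⟩²`, which is the harmless direction
  -- since the coefficient is `-l`.
  set V : S → EuclideanSpace ℝ (Fin r) :=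
    fun z => if l * ‖W z‖ ^ 2 ≤ β then (√β)⁻¹ • W z else 0 with hV
  have hVm : Measurable V := by
    refine Measurable.ite ?_ (h.measurable.const_smul (√β)⁻¹ :) measurable_const
    exact measurableSet_le ((h.measurable.norm.pow_const 2).const_mul l) measurable_const
  have hVpos : ∀ z, l * ‖W z‖ ^ 2 ≤ β → V z = (√β)⁻¹ • W z := fun z hz => if_pos hz
  have hVneg : ∀ z, ¬ l * ‖W z‖ ^ 2 ≤ β → V z = 0 := fun z hz => if_neg hz
  have hVnorm : ∀ z, l * ‖W z‖ ^ 2 ≤ β → ‖V z‖ ^ 2 = ‖W z‖ ^ 2 / β := by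
    intro z hz
    rw [hVpos z hz, norm_smul, mul_pow, norm_inv, Real.norm_of_nonneg (Real.sqrt_nonneg _),
      inv_pow, Real.sq_sqrt hβ.le]
    ring
  have hM : ∀ z, ‖V z‖ ≤ √(1 / l) := by
    intro z
    apply Real.le_sqrt_of_sq_le
    by_cases hz : l * ‖W z‖ ^ 2 ≤ β
    · rw [hVnorm z hz, div_le_div_iff₀ hβ hl0]; linarith
    · rw [hVneg z hz]; simp; positivity
  obtain ⟨B, hB, hBε, hBt⟩ := pacBayes_quadratic hZ hind hlaw hVm (a := -l) hM
    (fun z => by nlinarith [sq_nonneg ‖V z‖]) hε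
  refine ⟨B, hB, hBε, fun ω hω θ hθ => ?_⟩
  have hsqrt : √β ≠ 0 := (Real.sqrt_pos.2 hβ).ne'
  have hinner : ∀ z, l * ‖W z‖ ^ 2 ≤ β → (inner ℝ (√β • θ) (V z) : ℝ) = inner ℝ θ (W z) := by
    intro z hz
    rw [hVpos z hz, real_inner_smul_left, real_inner_smul_right, ← mul_assoc,
      mul_inv_cancel₀ hsqrt, one_mul]
  have hinner_le : ∀ z, (inner ℝ (√β • θ) (V z) : ℝ) ^ 2 ≤ (inner ℝ θ (W z)) ^ 2 := by
    intro z
    by_cases hz : l * ‖W z‖ ^ 2 ≤ β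
    · rw [hinner z hz]
    · rw [hVneg z hz]; simp; positivity
  -- The second-order terms `l²/2 - l² + K l²/2` combine into the variance term `(K - 1) l²/2`.
  obtain ⟨hGi, hGint⟩ := h.integral_quartic_le hK hθ hD hβ (l := l)
    (1 + l + l ^ 2 / 2 + (1 / 6 + l / 15) * l ^ 3) (-(1 + l)) (c₂ := 9) (c₃ := 15)
    (by norm_num) (by norm_num)
  have hmain := hBt ω hω (√β • θ) _ hGi ?_
  · have hnorm : ‖√β • θ‖ ^ 2 = β := by
      rw [norm_smul, hθ, mul_one, Real.norm_of_nonneg (Real.sqrt_nonneg _), Real.sq_sqrt hβ.le]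
    rw [hnorm] at hmain
    calc ∑ i, l * (1 - (inner ℝ θ (W (Z i ω))) ^ 2)
        ≤ ∑ i, -l * ((inner ℝ (√β • θ) (V (Z i ω))) ^ 2 - 1) := by
          refine Finset.sum_le_sum fun i _ => ?_
          nlinarith [hinner_le (Z i ω)]
      _ ≤ _ := hmain
      _ ≤ _ := by
          gcongr
          linarith
  · intro z
    by_cases hz : l * ‖W z‖ ^ 2 ≤ β
    · rw [hinner z hz, hVnorm z hz]
      set τ := l * (inner ℝ θ (W z)) ^ 2 with hτ
      set u := l * ‖W z‖ ^ 2 / β with hu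
      have hτ0 : 0 ≤ τ := by positivity
      have hu0 : 0 ≤ u := by positivity
      have hu1 : u ≤ 1 := (div_le_one hβ).2 hz
      have e1 : - -l * (‖W z‖ ^ 2 / β + 1) = u + l := by rw [hu]; ring
      have e2 : 1 - 2 * -l * (‖W z‖ ^ 2 / β) = 1 + 2 * u := by rw [hu]; ring
      have e3 : -l * (inner ℝ θ (W z)) ^ 2 = -τ := by rw [hτ]; ring
      rw [e1, e2, e3]
      refine (smoothed_exp_neg_le hu0 hu1 hτ0 hl0.le hl2).trans ?_
      have := mul_nonneg hu0 hτ0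
      linarith
    -- Where `V` is truncated only `exp l` is to be dominated. There `u ≥ 1`, so `9 u τ` outweighs
    -- the negative term `(1 + l) τ ≤ 3 τ`.
    · rw [hVneg z hz]
      have hu1 : 1 ≤ l * ‖W z‖ ^ 2 / β := (one_le_div hβ).2 (le_of_not_ge hz)
      have hτ0 : 0 ≤ l * (inner ℝ θ (W z)) ^ 2 := by positivity
      set τ := l * (inner ℝ θ (W z)) ^ 2 with hτ
      set u := l * ‖W z‖ ^ 2 / β with hu
      have hexp : Real.exp (- -l * (‖(0 : EuclideanSpace ℝ (Fin r))‖ ^ 2 + 1)) *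
          ((√(1 - 2 * -l * ‖(0 : EuclideanSpace ℝ (Fin r))‖ ^ 2))⁻¹ *
          Real.exp (-l * (inner ℝ (√β • θ) (0 : EuclideanSpace ℝ (Fin r))) ^ 2 /
            (1 - 2 * -l * ‖(0 : EuclideanSpace ℝ (Fin r))‖ ^ 2))) = Real.exp l := by
        simp
      rw [hexp]
      refine (exp_le_quadratic_add le_rfl hl0.le hl2).trans ?_
      nlinarith [mul_nonneg hτ0 (sub_nonneg.2 hu1), sq_nonneg τ, sq_nonneg u]

/-- Uniform upper deviations of the weighted empirical quadratic form of an isotropic vector. -/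
theorem upper_deviation (h : IsIsotropic P W K) (hK : 1 ≤ K)
    (hZ : ∀ i, Measurable (Z i)) (hind : iIndepFun Z μ) (hlaw : ∀ i, μ.map (Z i) = P)
    {D l β ε : ℝ} (hD : r ≤ D) (hl0 : 0 < l) (hβ : 10 ≤ β) (hε : 0 < ε) :
    ∃ B : Set Ω, MeasurableSet B ∧ μ Bᶜ ≤ ENNReal.ofReal ε ∧ ∀ ω ∈ B, ∀ θ, ‖θ‖ = 1 →
      ∑ i, l * (max (1 - (l * ‖W (Z i ω)‖ ^ 2) ^ 2 / 3) 0 * (inner ℝ θ (W (Z i ω))) ^ 2 - 1) ≤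
        n * ((K - 1) * l ^ 2 / 2 + l ^ 2 * K * (6 * (D / β) + 5 * (D / β) ^ 2)) +
          β / 2 + Real.log ε⁻¹ := by
  have hβ0 : 0 < β := by linarith
  set φ : S → ℝ := fun z => max (1 - (l * ‖W z‖ ^ 2) ^ 2 / 3) 0 with hφ
  have hφ0 : ∀ z, 0 ≤ φ z := fun z => le_max_right _ _
  have hφm : Measurable φ := by
    have := h.measurable
    fun_prop
  -- The square root of the weight goes into the vector, so that `⟨√β • θ, V⟩²` is the weighted
  -- square.
  set V : S → EuclideanSpace ℝ (Fin r) := fun z => (√(φ z) / √β) • W z with hV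
  have hVm : Measurable V := (hφm.sqrt.div_const _).smul h.measurable
  have hVnorm : ∀ z, l * ‖V z‖ ^ 2 = φ z * (l * ‖W z‖ ^ 2) / β := by
    intro z
    simp only [hV]
    rw [norm_smul, mul_pow, Real.norm_of_nonneg (by positivity), div_pow, Real.sq_sqrt hβ0.le,
      Real.sq_sqrt (hφ0 z)]
    ring
  have hVle : ∀ z, l * ‖V z‖ ^ 2 ≤ 1 / 15 := by
    intro z
    rw [hVnorm]
    exact (smoothed_exp_le hβ le_rfl (by positivity : 0 ≤ l * ‖W z‖ ^ 2)).1
  have hM : ∀ z, ‖V z‖ ≤ √(1 / l) := by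
    intro z
    apply Real.le_sqrt_of_sq_le
    rw [le_div_iff₀ hl0]
    linarith [hVle z]
  obtain ⟨B, hB, hBε, hBt⟩ := pacBayes_quadratic hZ hind hlaw hVm (a := l) hM
    (fun z => by linarith [hVle z]) hε
  refine ⟨B, hB, hBε, fun ω hω θ hθ => ?_⟩
  have hsqrt : √β ≠ 0 := (Real.sqrt_pos.2 hβ0).ne'
  have hinner : ∀ z, (inner ℝ (√β • θ) (V z) : ℝ) ^ 2 = φ z * (inner ℝ θ (W z)) ^ 2 := by
    intro z
    simp only [hV]
    rw [real_inner_smul_left, real_inner_smul_right, ← mul_assoc, mul_div_cancel₀ _ hsqrt, mul_pow,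
      Real.sq_sqrt (hφ0 z)]
  obtain ⟨hGi, hGint⟩ := h.integral_quartic_le (by linarith) hθ hD hβ0 (l := l)
    1 1 (c₂ := 6) (c₃ := 5) (by norm_num) (by norm_num)
  -- The factor `exp (-l)` is kept outside the polynomial: `1 + l + l²/2 ≤ exp l` then absorbs the
  -- low-order terms, and no cubic remainder in `l` appears.
  have hmain := hBt ω hω (√β • θ) _ (hGi.const_mul (Real.exp (-l))) ?_
  · have hnorm : ‖√β • θ‖ ^ 2 = β := by
      rw [norm_smul, hθ, mul_one, Real.norm_of_nonneg (Real.sqrt_nonneg _), Real.sq_sqrt hβ0.le]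
    rw [hnorm] at hmain
    simp_rw [hinner] at hmain
    refine hmain.trans ?_
    rw [integral_const_mul]
    gcongr
    set D' := l ^ 2 * K * (6 * (D / β) + 5 * (D / β) ^ 2) with hD'
    have hr : (0 : ℝ) ≤ D := (Nat.cast_nonneg r).trans hD
    have hD0 : 0 ≤ D' := by positivity
    have hv : 0 ≤ (K - 1) * l ^ 2 / 2 + D' := by
      have : 0 ≤ (K - 1) * l ^ 2 := mul_nonneg (by linarith) (sq_nonneg l)
      linarith
    have hq := Real.quadratic_le_exp_of_nonneg hl0.le
    have he1 : Real.exp (-l) ≤ 1 := Real.exp_le_one_iff.2 (by linarith)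
    have he2 : Real.exp (-l) * Real.exp l = 1 := by rw [← Real.exp_add]; simp
    calc Real.exp (-l) * _ - 1 ≤ Real.exp (-l) * (Real.exp l + ((K - 1) * l ^ 2 / 2 + D')) - 1 := by
          gcongr
          linarith
      _ = Real.exp (-l) * ((K - 1) * l ^ 2 / 2 + D') := by rw [mul_add, he2]; ring
      _ ≤ _ := mul_le_of_le_one_left hv he1
  · intro z
    have hτw : l * (inner ℝ θ (W z)) ^ 2 ≤ l * ‖W z‖ ^ 2 := by
      have := abs_real_inner_le_norm θ (W z)
      rw [hθ, one_mul] at this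
      have h2 := pow_le_pow_left₀ (abs_nonneg _) this 2
      rw [sq_abs] at h2
      gcongr
    have hmain := (smoothed_exp_le hβ (by positivity) hτw).2
    have hl := hVnorm z
    have e1 : Real.exp (-l * (‖V z‖ ^ 2 + 1)) =
        Real.exp (-l) * Real.exp (-(φ z * (l * ‖W z‖ ^ 2) / β)) := by
      rw [← hl, ← Real.exp_add]; ring_nf
    have e2 : 1 - 2 * l * ‖V z‖ ^ 2 = 1 - 2 * (φ z * (l * ‖W z‖ ^ 2) / β) := by
      rw [← hl]; ring
    have e3 : l * (inner ℝ (√β • θ) (V z)) ^ 2 = φ z * (l * (inner ℝ θ (W z)) ^ 2) := by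
      rw [hinner]; ring
    rw [e1, e2, e3, mul_assoc (Real.exp (-l))]
    refine mul_le_mul_of_nonneg_left (hmain.trans ?_) (Real.exp_pos _).le
    linarith

end IsIsotropic

end OLS

/-! ### Orthonormal coordinates for the residuals. -/

namespace OLS

/-- The residual at `z`, as a linear form in `(θ, ξ)`. -/
noncomputable def residLin {d : ℕ} (z : Obs d) : Obs d →ₗ[ℝ] ℝ where
  toFun v := resid v.1 v.2 z
  map_add' v w := by simp [resid, inner_add_left]; ring
  map_smul' a v := by simp [resid, real_inner_smul_left]; ring

theorem residLin_apply {d : ℕ} (z v : Obs d) : residLin z v = resid v.1 v.2 z := rfl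

theorem measurable_resid {d : ℕ} (θ : EuclideanSpace ℝ (Fin d)) (ξ : ℝ) :
    Measurable (resid θ ξ) := by
  unfold resid
  fun_prop

theorem memLp_inner {d : ℕ} {P : Measure (Obs d)}
    (hX : MemLp (fun z : Obs d => z.1) 2 P) (θ : EuclideanSpace ℝ (Fin d)) :
    MemLp (fun z : Obs d => (inner ℝ θ z.1 : ℝ)) 2 P :=
  (innerSL ℝ θ).comp_memLp' hX

theorem memLp_resid {d : ℕ} {P : Measure (Obs d)}
    (hX : MemLp (fun z : Obs d => z.1) 2 P) (hY : MemLp (fun z : Obs d => z.2) 2 P)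
    (θ : EuclideanSpace ℝ (Fin d)) (ξ : ℝ) : MemLp (resid θ ξ) 2 P :=
  (hY.const_mul ξ).sub (memLp_inner hX θ)

theorem quadForm_nonneg {d : ℕ} (P : Measure (Obs d)) (θ : EuclideanSpace ℝ (Fin d)) (ξ : ℝ) :
    0 ≤ quadForm P θ ξ := integral_nonneg fun _ => sq_nonneg _

/-- The factorization of a linear map with values in an inner product space through orthonormal
coordinates of its range. -/
theorem exists_orthonormal_coordinates {V H : Type*} [AddCommGroup V] [Module ℝ V]
    [FiniteDimensional ℝ V] [NormedAddCommGroup H] [InnerProductSpace ℝ H] (T : V →ₗ[ℝ] H) :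
    ∃ (r : ℕ) (v : Fin r → V) (c : V →ₗ[ℝ] EuclideanSpace ℝ (Fin r)),
      r ≤ Module.finrank ℝ V ∧ (∀ θ, c (∑ j, θ j • v j) = θ) ∧ (∀ w, ‖c w‖ = ‖T w‖) ∧
      ∀ w, T w = T (∑ j, c w j • v j) := by
  set b := stdOrthonormalBasis ℝ (LinearMap.range T) with hb
  have hv : ∀ j, ∃ v, T v = b j := fun j => (b j).2
  choose v hv using hv
  set c : V →ₗ[ℝ] EuclideanSpace ℝ (Fin (Module.finrank ℝ (LinearMap.range T))) :=
    b.repr.toLinearEquiv.toLinearMap ∘ₗ T.rangeRestrict with hc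
  have hc' : ∀ w, c w = b.repr ⟨T w, LinearMap.mem_range_self T w⟩ := fun w => rfl
  refine ⟨_, v, c, LinearMap.finrank_range_le T, fun θ => ?_, fun w => ?_, fun w => ?_⟩
  · have h := b.repr.apply_symm_apply θ
    rw [← b.sum_repr_symm] at h
    rw [hc']
    refine Eq.trans ?_ h
    congr 1
    ext1
    simp [map_sum, hv]
  · rw [hc', LinearIsometryEquiv.norm_map, Submodule.coe_norm]
  · have h := b.sum_repr ⟨T w, LinearMap.mem_range_self T w⟩
    have h2 := congrArg Subtype.val h
    rw [map_sum]
    simp only [map_smul, hv]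
    rw [← hc'] at h2
    simpa using h2.symm

/-- The residuals, as a linear map to `L²`. -/
noncomputable def residL2 {d : ℕ} {P : Measure (Obs d)}
    (hmem : ∀ v : Obs d, MemLp (fun z => residLin z v) 2 P) : Obs d →ₗ[ℝ] Lp ℝ 2 P where
  toFun v := (hmem v).toLp
  map_add' v w := by
    rw [← MemLp.toLp_add]
    congr 1
    ext z; simp
  map_smul' a v := by
    rw [RingHom.id_apply, ← MemLp.toLp_const_smul]
    congr 1
    ext z; simp

/-- The coordinates of `(X, Y)` in an orthonormal basis of the span of the residuals in `L²`. -/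
theorem exists_isotropic {d : ℕ} {P : Measure (Obs d)} [IsProbabilityMeasure P]
    (hX : MemLp (fun z : Obs d => z.1) 2 P) (hY : MemLp (fun z : Obs d => z.2) 2 P) {K : ℝ}
    (h4 : ∀ θ ξ, Integrable (fun z => resid θ ξ z ^ 4) P)
    (hK : ∀ θ ξ, ∫ z, resid θ ξ z ^ 4 ∂P ≤ K * quadForm P θ ξ ^ 2) :
    ∃ (r : ℕ) (W : Obs d → EuclideanSpace ℝ (Fin r)) (c : Obs d →ₗ[ℝ] EuclideanSpace ℝ (Fin r)),
      r ≤ d + 1 ∧ IsIsotropic P W K ∧ Function.Surjective c ∧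
      (∀ θ ξ, quadForm P θ ξ = ‖c (θ, ξ)‖ ^ 2) ∧
      ∀ᵐ z ∂P, ∀ θ ξ, resid θ ξ z = inner ℝ (c (θ, ξ)) (W z) := by
  have hmem : ∀ v : Obs d, MemLp (fun z => residLin z v) 2 P := fun v => memLp_resid hX hY v.1 v.2
  set T := residL2 hmem
  have hT : ∀ v, T v = (hmem v).toLp := fun _ => rfl
  have hnormT : ∀ v : Obs d, ‖T v‖ ^ 2 = quadForm P v.1 v.2 := by
    intro v
    rw [← real_inner_self_eq_norm_sq, L2.inner_def]
    refine integral_congr_ae ?_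
    filter_upwards [(hmem v).coeFn_toLp] with z hz
    rw [hT, hz]
    simp [residLin_apply, sq]
  clear_value T
  obtain ⟨r, v, c, hr, hcv, hcn, hexp⟩ := exists_orthonormal_coordinates T
  have hnorm : ∀ w : Obs d, ‖c w‖ ^ 2 = quadForm P w.1 w.2 := by
    intro w
    rw [hcn, hnormT]
  -- The coordinates are residuals at preimages `v j` of the basis vectors, so `W` is a genuine
  -- function of `z` and not a class in `L²`.
  set W : Obs d → EuclideanSpace ℝ (Fin r) :=
    fun z => WithLp.toLp 2 (fun j => residLin z (v j)) with hW
  have hinner : ∀ θ z, (inner ℝ θ (W z) : ℝ) = residLin z (∑ j, θ j • v j) := by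
    intro θ z
    rw [map_sum, PiLp.inner_apply]
    refine Finset.sum_congr rfl fun j _ => ?_
    simp [hW, mul_comm]
  have hqW : ∀ θ : EuclideanSpace ℝ (Fin r), quadForm P (∑ j, θ j • v j).1 (∑ j, θ j • v j).2 = ‖θ‖ ^ 2 := by
    intro θ
    rw [← hnorm, hcv]
  refine ⟨r, W, c, ?_, ⟨?_, ?_, ?_, ?_⟩, fun θ => ⟨_, hcv θ⟩, fun θ ξ => (hnorm (θ, ξ)).symm, ?_⟩
  · refine hr.trans ?_
    simp [Module.finrank_prod]
  · have : ∀ j, Measurable fun z => residLin z (v j) := fun j => measurable_resid _ _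
    fun_prop
  · intro θ
    simp_rw [hinner, residLin_apply]
    exact hqW θ
  · intro θ
    simp_rw [hinner, residLin_apply]
    exact h4 _ _
  · intro θ
    simp_rw [hinner, residLin_apply]
    refine (hK _ _).trans_eq ?_
    rw [hqW]; ring
  -- A residual of zero `L²` norm vanishes only almost surely. A finite basis of the kernel provides
  -- one null set valid for all `(θ, ξ)`.
  · set k := Module.finBasis ℝ (LinearMap.ker T) with hk
    have hker : ∀ᵐ z ∂P, ∀ i, residLin z (k i : Obs d) = 0 := by
      rw [ae_all_iff]
      intro i
      have h1 : T (k i : Obs d) = 0 := (k i).2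
      rw [hT] at h1
      have h2 := (MemLp.toLp_eq_toLp_iff (hmem (k i : Obs d)) (MemLp.zero (p := 2))).1
        (h1.trans (MemLp.toLp_zero _).symm)
      exact h2
    filter_upwards [hker] with z hz θ ξ
    have hall : ∀ w ∈ LinearMap.ker T, residLin z w = 0 := by
      intro w hw
      have h1 : (residLin z) ∘ₗ (LinearMap.ker T).subtype = 0 :=
        k.ext fun i => by simpa using hz i
      exact LinearMap.congr_fun h1 ⟨w, hw⟩
    rw [hinner, ← residLin_apply z (θ, ξ), ← sub_eq_zero, ← map_sub]
    apply hall
    rw [LinearMap.mem_ker, map_sub, sub_eq_zero]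
    exact hexp _

end OLS

/-! ### The Gram matrix, the whitened design and exponential moments. -/

namespace OLS

variable {d : ℕ} {P : Measure (Obs d)}

theorem integrable_inner_mul_inner (hX : MemLp (fun z : Obs d => z.1) 2 P)
    (a b : EuclideanSpace ℝ (Fin d)) :
    Integrable (fun z : Obs d => (inner ℝ a z.1 * inner ℝ b z.1 : ℝ)) P :=
  (memLp_inner hX a).integrable_mul (memLp_inner hX b)

theorem integral_inner_mul_inner (hX : MemLp (fun z : Obs d => z.1) 2 P)
    (a b : EuclideanSpace ℝ (Fin d)) :
    ∫ z, (inner ℝ a z.1 * inner ℝ b z.1 : ℝ) ∂P = dotProduct a.ofLp ((gram P).mulVec b.ofLp) := by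
  have hcoord : ∀ i j : Fin d, Integrable (fun z : Obs d => z.1 i * z.1 j) P := by
    intro i j
    have h := integrable_inner_mul_inner hX (EuclideanSpace.single i (1 : ℝ))
      (EuclideanSpace.single j (1 : ℝ))
    simpa [EuclideanSpace.inner_single_left] using h
  have h1 : ∀ z : Obs d, (inner ℝ a z.1 * inner ℝ b z.1 : ℝ) =
      ∑ i, ∑ j, a i * b j * (z.1 i * z.1 j) := by
    intro z
    rw [PiLp.inner_apply, PiLp.inner_apply, Finset.sum_mul_sum]
    refine Finset.sum_congr rfl fun i _ => Finset.sum_congr rfl fun j _ => ?_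
    simp only [RCLike.inner_apply, conj_trivial]
    ring
  simp_rw [h1]
  rw [integral_finsetSum _ fun i _ => integrable_finsetSum _ fun j _ => (hcoord i j).const_mul _]
  simp only [dotProduct, Matrix.mulVec, Finset.mul_sum]
  refine Finset.sum_congr rfl fun i _ => ?_
  rw [integral_finsetSum _ fun j _ => (hcoord i j).const_mul _]
  refine Finset.sum_congr rfl fun j _ => ?_
  rw [integral_const_mul, gram, Matrix.of_apply]
  ring

theorem integral_inner_mul_eigenvector (hX : MemLp (fun z : Obs d => z.1) 2 P)
    (a : EuclideanSpace ℝ (Fin d)) (j : Fin d) :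
    ∫ z, (inner ℝ a z.1 * inner ℝ ((gram_isHermitian P).eigenvectorBasis j) z.1 : ℝ) ∂P =
      (gram_isHermitian P).eigenvalues j *
        inner ℝ a ((gram_isHermitian P).eigenvectorBasis j) := by
  rw [integral_inner_mul_inner hX, Matrix.IsHermitian.mulVec_eigenvectorBasis,
    dotProduct_smul, smul_eq_mul, PiLp.inner_apply]
  congr 1
  simp [dotProduct, mul_comm]

theorem integral_sq_eigenvector (hX : MemLp (fun z : Obs d => z.1) 2 P) (j : Fin d) :
    ∫ z, (inner ℝ ((gram_isHermitian P).eigenvectorBasis j) z.1) ^ 2 ∂P =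
      (gram_isHermitian P).eigenvalues j := by
  have h := integral_inner_mul_eigenvector hX ((gram_isHermitian P).eigenvectorBasis j) j
  simp_rw [sq]
  rw [h, real_inner_self_eq_norm_sq, OrthonormalBasis.norm_eq_one]
  simp

theorem eigenvalues_gram_nonneg (hX : MemLp (fun z : Obs d => z.1) 2 P) (j : Fin d) :
    0 ≤ (gram_isHermitian P).eigenvalues j := by
  rw [← integral_sq_eigenvector hX]
  exact integral_nonneg fun _ => sq_nonneg _

theorem integral_inner_sq (hX : MemLp (fun z : Obs d => z.1) 2 P)
    (θ : EuclideanSpace ℝ (Fin d)) :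
    ∫ z, (inner ℝ θ z.1) ^ 2 ∂P = ∑ j, (gram_isHermitian P).eigenvalues j *
      (inner ℝ θ ((gram_isHermitian P).eigenvectorBasis j)) ^ 2 := by
  set u := (gram_isHermitian P).eigenvectorBasis with hu
  have h1 : ∀ z : Obs d, (inner ℝ θ z.1 : ℝ) ^ 2 =
      ∑ j, inner ℝ θ (u j) * (inner ℝ θ z.1 * inner ℝ (u j) z.1) := by
    intro z
    rw [sq]
    nth_rewrite 2 [← u.sum_inner_mul_inner θ z.1]
    rw [Finset.mul_sum]
    refine Finset.sum_congr rfl fun j _ => by ring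
  simp_rw [h1]
  rw [integral_finsetSum _ fun j _ => (integrable_inner_mul_inner hX θ (u j)).const_mul _]
  refine Finset.sum_congr rfl fun j _ => ?_
  rw [integral_const_mul, hu, integral_inner_mul_eigenvector hX]
  ring

theorem whiteNorm_sq (P : Measure (Obs d)) (x : EuclideanSpace ℝ (Fin d)) :
    whiteNorm P x ^ 2 = ∑ j, ((√((gram_isHermitian P).eigenvalues j))⁻¹ *
      inner ℝ ((gram_isHermitian P).eigenvectorBasis j) x) ^ 2 := by
  set u := (gram_isHermitian P).eigenvectorBasis with hu
  set y : EuclideanSpace ℝ (Fin d) :=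
    WithLp.toLp 2 fun j => (√((gram_isHermitian P).eigenvalues j))⁻¹ * inner ℝ (u j) x with hy
  have h1 : Matrix.toEuclideanLin (gramInvSqrt P) x = u.repr.symm y := by
    rw [← u.sum_repr_symm]
    ext k
    rw [Matrix.toLpLin_apply]
    simp only [gramInvSqrt, ← Matrix.mulVec_mulVec, WithLp.ofLp_sum, Finset.sum_apply,
      WithLp.ofLp_smul, Pi.smul_apply, smul_eq_mul]
    rw [Matrix.mulVec, dotProduct]
    refine Finset.sum_congr rfl fun j _ => ?_
    rw [Matrix.IsHermitian.eigenvectorUnitary_apply, mul_comm, Matrix.mulVec_diagonal]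
    congr 1
    simp only [hy]
    congr 1
    rw [Matrix.mulVec, dotProduct, PiLp.inner_apply]
    refine Finset.sum_congr rfl fun i _ => ?_
    rw [Matrix.star_apply, Matrix.IsHermitian.eigenvectorUnitary_apply]
    simp [hu, mul_comm]
  rw [whiteNorm, h1, LinearIsometryEquiv.norm_map, EuclideanSpace.real_norm_sq_eq]

theorem whiteNorm_nonneg (P : Measure (Obs d)) (x : EuclideanSpace ℝ (Fin d)) :
    0 ≤ whiteNorm P x := norm_nonneg _

theorem measurable_whiteNorm (P : Measure (Obs d)) :
    Measurable (fun z : Obs d => whiteNorm P z.1) := by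
  have h : Continuous (Matrix.toEuclideanLin (gramInvSqrt P)) :=
    LinearMap.continuous_of_finiteDimensional _
  exact (h.comp continuous_fst).norm.measurable

/-- A nonnegative function with vanishing integral of its square vanishes almost everywhere. -/
theorem ae_eq_zero_of_integral_sq {f : Obs d → ℝ} (hf : MemLp f 2 P)
    (h : ∫ z, f z ^ 2 ∂P = 0) : ∀ᵐ z ∂P, f z = 0 := by
  rw [integral_eq_zero_iff_of_nonneg (fun _ => sq_nonneg _) hf.integrable_sq] at h
  filter_upwards [h] with z hz
  exact pow_eq_zero_iff two_ne_zero |>.1 hz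

/-- Cauchy–Schwarz in an eigenbasis of `G`, with weights `√λ_j` and their inverses. If `λ_j = 0`,
the coordinate of `X` along that eigenvector vanishes almost surely, which makes up for the zero in
`G^{-1/2}`; finitely many null sets serve every `θ`. -/
theorem ae_inner_sq_le (hX : MemLp (fun z : Obs d => z.1) 2 P) :
    ∀ᵐ z ∂P, ∀ θ : EuclideanSpace ℝ (Fin d),
      (inner ℝ θ z.1) ^ 2 ≤ (∫ z, (inner ℝ θ z.1) ^ 2 ∂P) * whiteNorm P z.1 ^ 2 := by
  set u := (gram_isHermitian P).eigenvectorBasis with hu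
  have h0 : ∀ᵐ z ∂P, ∀ j, (gram_isHermitian P).eigenvalues j = 0 → inner ℝ (u j) z.1 = (0 : ℝ) := by
    rw [ae_all_iff]
    intro j
    by_cases hj : (gram_isHermitian P).eigenvalues j = 0
    · have := ae_eq_zero_of_integral_sq (memLp_inner hX (u j))
        ((integral_sq_eigenvector hX j).trans hj)
      filter_upwards [this] with z hz _ using hz
    · exact Eventually.of_forall fun z h => absurd h hj
  filter_upwards [h0] with z hz θ
  have h1 : (inner ℝ θ z.1 : ℝ) = ∑ j, (√((gram_isHermitian P).eigenvalues j) * inner ℝ θ (u j)) *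
      ((√((gram_isHermitian P).eigenvalues j))⁻¹ * inner ℝ (u j) z.1) := by
    rw [← u.sum_inner_mul_inner θ z.1]
    refine Finset.sum_congr rfl fun j _ => ?_
    rcases (eigenvalues_gram_nonneg hX j).eq_or_lt with h | h
    · rw [hz j h.symm]; simp
    · have := (Real.sqrt_pos.2 h).ne'
      field_simp
  rw [h1, integral_inner_sq hX, whiteNorm_sq]
  refine (Finset.sum_mul_sq_le_sq_mul_sq _ _ _).trans_eq ?_
  congr 1
  refine Finset.sum_congr rfl fun j _ => ?_
  rw [mul_pow, Real.sq_sqrt (eigenvalues_gram_nonneg hX j)]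

/-- Square integrability from an exponential moment of a power. -/
theorem integrable_sq_of_exp_moment [IsProbabilityMeasure P] {f : Obs d → ℝ} (hf : Measurable f)
    (hf0 : ∀ z, 0 ≤ f z) {p α c : ℝ} (hp : 0 < p) (hα : 0 < α)
    (h : ∫⁻ z, ENNReal.ofReal (Real.exp (α / 2 * (f z ^ p - c))) ∂P ≤ 1) :
    Integrable (fun z => f z ^ 2) P := by
  have hm : Measurable fun z => Real.exp (α / 2 * (f z ^ p - c)) := by fun_prop
  have hi : Integrable (fun z => Real.exp (α / 2 * (f z ^ p - c))) P :=
    (lintegral_ofReal_ne_top_iff_integrable hm.aestronglyMeasurable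
      (Eventually.of_forall fun z => (Real.exp_pos _).le)).1 (ne_top_of_le_ne_top ENNReal.one_ne_top h)
  -- The rate `α p / 4` becomes exactly `α / 2` once raised to the power `2 / p`.
  have ha : 0 < α * p / 4 := by positivity
  refine Integrable.mono' (hi.const_mul (((α * p / 4)⁻¹) ^ (2 / p) * Real.exp (α / 2 * c)))
    (hf.pow_const 2).aestronglyMeasurable (Eventually.of_forall fun z => ?_)
  rw [Real.norm_of_nonneg (sq_nonneg _)]
  have hy : 0 ≤ f z ^ p := Real.rpow_nonneg (hf0 z) p
  have h1 : f z ^ p ≤ (α * p / 4)⁻¹ * Real.exp (α * p / 4 * f z ^ p) := by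
    rw [inv_mul_eq_div, le_div_iff₀ ha]
    have := Real.add_one_le_exp (α * p / 4 * f z ^ p)
    linarith
  have h2 : f z ^ 2 = (f z ^ p) ^ (2 / p) := by
    rw [← Real.rpow_mul (hf0 z), mul_div_cancel₀ _ hp.ne']
    norm_cast
  rw [h2]
  refine (Real.rpow_le_rpow hy h1 (by positivity)).trans_eq ?_
  rw [Real.mul_rpow (by positivity) (Real.exp_pos _).le, mul_assoc, ← Real.exp_add, ← Real.exp_mul]
  congr 2
  field_simp
  ring

/-- Markov's inequality for an exponential moment of a power. -/
theorem measure_le_of_exp_moment {f : Obs d → ℝ} (hf : Measurable f)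
    {p α c t : ℝ} (hα : 0 < α) (ht : 0 < t)
    (h : ∫⁻ z, ENNReal.ofReal (Real.exp (α / 2 * (f z ^ p - c))) ∂P ≤ 1) :
    P {z | c + 2 * α⁻¹ * Real.log t ≤ f z ^ p} ≤ ENNReal.ofReal t⁻¹ := by
  have hm : Measurable fun z => ENNReal.ofReal (Real.exp (α / 2 * (f z ^ p - c))) := by fun_prop
  have hsub : {z | c + 2 * α⁻¹ * Real.log t ≤ f z ^ p} ⊆
      {z | ENNReal.ofReal t ≤ ENNReal.ofReal (Real.exp (α / 2 * (f z ^ p - c)))} := by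
    intro z hz
    rw [Set.mem_ofPred_eq] at hz ⊢
    apply ENNReal.ofReal_le_ofReal
    rw [← Real.log_le_iff_le_exp ht]
    have : 2 * α⁻¹ * Real.log t ≤ f z ^ p - c := by linarith
    have h2 := mul_le_mul_of_nonneg_left this (by positivity : 0 ≤ α / 2)
    refine le_trans (le_of_eq ?_) h2
    field_simp
  refine (measure_mono hsub).trans ?_
  refine (meas_ge_le_lintegral_div hm.aemeasurable (by simpa using ht)
    ENNReal.ofReal_ne_top).trans ?_
  rw [ENNReal.ofReal_inv_of_pos ht, ← one_div]
  gcongr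

end OLS

/-! ### Orthogonality of the noise and kurtosis of the residuals. -/

namespace OLS

variable {d : ℕ} {P : Measure (Obs d)}

/-- The normalized squared noise `(Y - ⟨θs, X⟩)² / R(θs)`. -/
noncomputable def noiseRatio (P : Measure (Obs d)) (θs : EuclideanSpace ℝ (Fin d)) (z : Obs d) : ℝ :=
  (z.2 - inner ℝ θs z.1) ^ 2 / risk P θs

theorem risk_nonneg (P : Measure (Obs d)) (θ : EuclideanSpace ℝ (Fin d)) : 0 ≤ risk P θ :=
  integral_nonneg fun _ => sq_nonneg _

theorem noiseRatio_nonneg (P : Measure (Obs d)) (θs : EuclideanSpace ℝ (Fin d)) (z : Obs d) :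
    0 ≤ noiseRatio P θs z := div_nonneg (sq_nonneg _) (risk_nonneg P θs)

theorem measurable_noiseRatio (P : Measure (Obs d)) (θs : EuclideanSpace ℝ (Fin d)) :
    Measurable (noiseRatio P θs) := by
  unfold noiseRatio
  fun_prop

theorem risk_eq_quadForm (P : Measure (Obs d)) (θ : EuclideanSpace ℝ (Fin d)) :
    risk P θ = quadForm P θ 1 := by
  simp [risk, quadForm, resid]

theorem memLp_noise (hX : MemLp (fun z : Obs d => z.1) 2 P)
    (hY : MemLp (fun z : Obs d => z.2) 2 P) (θ : EuclideanSpace ℝ (Fin d)) :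
    MemLp (fun z : Obs d => z.2 - inner ℝ θ z.1) 2 P :=
  hY.sub (memLp_inner hX θ)

theorem integral_add_mul_sq {f g : Obs d → ℝ} (hf : MemLp f 2 P) (hg : MemLp g 2 P) (t : ℝ) :
    ∫ z, (f z + t * g z) ^ 2 ∂P =
      ∫ z, f z ^ 2 ∂P + 2 * t * ∫ z, f z * g z ∂P + t ^ 2 * ∫ z, g z ^ 2 ∂P := by
  have h1 : ∀ z, (f z + t * g z) ^ 2 = f z ^ 2 + 2 * t * (f z * g z) + t ^ 2 * g z ^ 2 := by
    intro z; ring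
  simp_rw [h1]
  have hfg : Integrable (fun z => f z * g z) P := hf.integrable_mul hg
  have i12 : Integrable (fun z => f z ^ 2 + 2 * t * (f z * g z)) P :=
    hf.integrable_sq.add (hfg.const_mul (2 * t))
  rw [integral_add i12 (hg.integrable_sq.const_mul (t ^ 2)),
    integral_add hf.integrable_sq (hfg.const_mul (2 * t)), integral_const_mul, integral_const_mul]

theorem eq_zero_of_quadratic_nonneg {c m : ℝ} (hm0 : 0 ≤ m)
    (h : ∀ t : ℝ, 0 ≤ 2 * t * c + t ^ 2 * m) : c = 0 := by
  -- The minimiser would be `-c / m`; the shift by one covers `m = 0`.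
  have h1 := h (-c / (m + 1))
  have hm1 : 0 < m + 1 := by linarith
  have h2 : 2 * (-c / (m + 1)) * c + (-c / (m + 1)) ^ 2 * m =
      -(c ^ 2 * (m + 2)) / (m + 1) ^ 2 := by
    field_simp
    ring
  rw [h2, neg_div, neg_nonneg] at h1
  have h3 : 0 ≤ c ^ 2 * (m + 2) / (m + 1) ^ 2 := by positivity
  have h4 := le_antisymm h1 h3
  rw [div_eq_zero_iff] at h4
  rcases h4 with h4 | h4
  · rcases mul_eq_zero.1 h4 with h5 | h5
    · exact pow_eq_zero_iff two_ne_zero |>.1 h5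
    · linarith
  · exact absurd h4 (by positivity)

/-- The noise is orthogonal to the design. -/
theorem integral_noise_mul_inner (hX : MemLp (fun z : Obs d => z.1) 2 P)
    (hY : MemLp (fun z : Obs d => z.2) 2 P) {θs : EuclideanSpace ℝ (Fin d)}
    (hmin : ∀ θ, risk P θs ≤ risk P θ) (θ : EuclideanSpace ℝ (Fin d)) :
    ∫ z, (z.2 - inner ℝ θs z.1) * inner ℝ θ z.1 ∂P = 0 := by
  set c := ∫ z, (z.2 - inner ℝ θs z.1) * inner ℝ θ z.1 ∂P with hc
  set m := ∫ z, (inner ℝ θ z.1) ^ 2 ∂P with hm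
  have hm0 : 0 ≤ m := integral_nonneg fun _ => sq_nonneg _
  have h : ∀ t : ℝ, 0 ≤ 2 * t * c + t ^ 2 * m := by
    intro t
    have h1 := hmin (θs - t • θ)
    have h2 : risk P (θs - t • θ) = risk P θs + 2 * t * c + t ^ 2 * m := by
      rw [risk, risk, hc, hm, ← integral_add_mul_sq (memLp_noise hX hY θs) (memLp_inner hX θ)]
      refine integral_congr_ae (Eventually.of_forall fun z => ?_)
      simp only [inner_sub_left, real_inner_smul_left]
      ring
    linarith
  exact eq_zero_of_quadratic_nonneg hm0 h

theorem resid_decomp (θs θ : EuclideanSpace ℝ (Fin d)) (ξ : ℝ) (z : Obs d) :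
    resid θ ξ z = inner ℝ (ξ • θs - θ) z.1 + ξ * (z.2 - inner ℝ θs z.1) := by
  rw [resid, inner_sub_left, real_inner_smul_left]; ring

/-- Pythagoras: the first-order condition at `θs` removes the cross term. -/
theorem quadForm_decomp (hX : MemLp (fun z : Obs d => z.1) 2 P)
    (hY : MemLp (fun z : Obs d => z.2) 2 P) {θs : EuclideanSpace ℝ (Fin d)}
    (hmin : ∀ θ, risk P θs ≤ risk P θ) (θ : EuclideanSpace ℝ (Fin d)) (ξ : ℝ) :
    quadForm P θ ξ = ∫ z, (inner ℝ (ξ • θs - θ) z.1) ^ 2 ∂P + ξ ^ 2 * risk P θs := by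
  simp_rw [quadForm, resid_decomp θs θ ξ]
  rw [integral_add_mul_sq (memLp_inner hX _) (memLp_noise hX hY θs)]
  have := integral_noise_mul_inner hX hY hmin (ξ • θs - θ)
  simp_rw [mul_comm] at this ⊢
  rw [this, risk]
  ring

theorem ae_noise_sq_eq (hX : MemLp (fun z : Obs d => z.1) 2 P)
    (hY : MemLp (fun z : Obs d => z.2) 2 P) (θs : EuclideanSpace ℝ (Fin d)) :
    ∀ᵐ z ∂P, (z.2 - inner ℝ θs z.1) ^ 2 = risk P θs * noiseRatio P θs z := by
  rcases (risk_nonneg P θs).eq_or_lt with h | h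
  · filter_upwards [ae_eq_zero_of_integral_sq (memLp_noise hX hY θs) h.symm] with z hz
    rw [hz, ← h]; simp
  · refine Eventually.of_forall fun z => ?_
    rw [noiseRatio, mul_div_cancel₀ _ h.ne']

/-- Cauchy–Schwarz for `(√A, √B)` and `(√α, √β)`, fitted to the orthogonal decomposition of `N`. -/
theorem add_sq_le_of_sq_le {a b A B α β : ℝ} (hA : 0 ≤ A) (hB : 0 ≤ B) (hα : 0 ≤ α) (hβ : 0 ≤ β)
    (ha : a ^ 2 ≤ A * α) (hb : b ^ 2 ≤ B * β) : (a + b) ^ 2 ≤ (A + B) * (α + β) := by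
  have h1 : (a * b) ^ 2 ≤ ((A * β + B * α) / 2) ^ 2 := by
    have : (a * b) ^ 2 ≤ (A * α) * (B * β) := by
      rw [mul_pow]; gcongr
    nlinarith [sq_nonneg (A * β - B * α)]
  have h2 : a * b ≤ (A * β + B * α) / 2 :=
    le_trans (le_abs_self _) (abs_le_of_sq_le_sq h1 (by positivity))
  nlinarith

theorem ae_resid_sq_le (hX : MemLp (fun z : Obs d => z.1) 2 P)
    (hY : MemLp (fun z : Obs d => z.2) 2 P) {θs : EuclideanSpace ℝ (Fin d)}
    (hmin : ∀ θ, risk P θs ≤ risk P θ) :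
    ∀ᵐ z ∂P, ∀ θ ξ, resid θ ξ z ^ 2 ≤
      quadForm P θ ξ * (whiteNorm P z.1 ^ 2 + noiseRatio P θs z) := by
  filter_upwards [ae_inner_sq_le hX, ae_noise_sq_eq hX hY θs] with z h1 h2 θ ξ
  rw [resid_decomp θs, quadForm_decomp hX hY hmin]
  refine add_sq_le_of_sq_le (integral_nonneg fun _ => sq_nonneg _)
    (mul_nonneg (sq_nonneg _) (risk_nonneg P θs)) (sq_nonneg _) (noiseRatio_nonneg P θs z)
    (h1 _) ?_
  rw [mul_pow, h2, mul_assoc]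

/-- Minkowski's inequality in `L²`. The bound on the cross term divides by the two norms, which may
vanish, hence the passage through `η > 0`. -/
theorem integral_add_sq_le {f g : Obs d → ℝ} {s t : ℝ} (hs : 0 ≤ s) (ht : 0 ≤ t)
    (hf : MemLp f 2 P) (hg : MemLp g 2 P) (hfs : ∫ z, f z ^ 2 ∂P ≤ s ^ 2)
    (hgt : ∫ z, g z ^ 2 ∂P ≤ t ^ 2) : ∫ z, (f z + g z) ^ 2 ∂P ≤ (s + t) ^ 2 := by
  have hfg : Integrable (fun z => f z * g z) P := hf.integrable_mul hg
  have hcs : ∀ η : ℝ, 0 < η → ∫ z, f z * g z ∂P ≤ (s + η) * (t + η) := by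
    intro η hη
    have hs' : 0 < s + η := by linarith
    have ht' : 0 < t + η := by linarith
    have hle : ∀ z, f z * g z ≤
        (t + η) / (2 * (s + η)) * f z ^ 2 + (s + η) / (2 * (t + η)) * g z ^ 2 := by
      intro z
      have : (t + η) / (2 * (s + η)) * f z ^ 2 + (s + η) / (2 * (t + η)) * g z ^ 2 - f z * g z =
          ((t + η) * f z - (s + η) * g z) ^ 2 / (2 * (s + η) * (t + η)) := by
        field_simp
        ring
      have h2 : 0 ≤ ((t + η) * f z - (s + η) * g z) ^ 2 / (2 * (s + η) * (t + η)) := by positivity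
      linarith
    have i1 : Integrable (fun z => (t + η) / (2 * (s + η)) * f z ^ 2) P :=
      hf.integrable_sq.const_mul _
    have i2 : Integrable (fun z => (s + η) / (2 * (t + η)) * g z ^ 2) P :=
      hg.integrable_sq.const_mul _
    calc ∫ z, f z * g z ∂P
        ≤ ∫ z, ((t + η) / (2 * (s + η)) * f z ^ 2 + (s + η) / (2 * (t + η)) * g z ^ 2) ∂P :=
          integral_mono hfg (i1.add i2) hle
      _ = (t + η) / (2 * (s + η)) * ∫ z, f z ^ 2 ∂P +
          (s + η) / (2 * (t + η)) * ∫ z, g z ^ 2 ∂P := by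
          rw [integral_add i1 i2, integral_const_mul, integral_const_mul]
      _ ≤ (t + η) / (2 * (s + η)) * (s + η) ^ 2 + (s + η) / (2 * (t + η)) * (t + η) ^ 2 := by
          gcongr
          · refine hfs.trans ?_; gcongr; linarith
          · refine hgt.trans ?_; gcongr; linarith
      _ = (s + η) * (t + η) := by field_simp; ring
  have hlim : Tendsto (fun η : ℝ => (s + η) * (t + η)) (nhdsWithin 0 (Set.Ioi 0))
      (nhds (s * t)) := by
    have : Continuous fun η : ℝ => (s + η) * (t + η) := by fun_prop
    have h := (this.tendsto 0).mono_left (nhdsWithin_le_nhds (s := Set.Ioi 0))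
    simpa using h
  have hst : ∫ z, f z * g z ∂P ≤ s * t :=
    ge_of_tendsto hlim (eventually_nhdsWithin_of_forall fun η hη => hcs η hη)
  have h := integral_add_mul_sq hf hg 1
  simp only [one_mul] at h
  rw [h]
  nlinarith

theorem memLp_whiteNorm_sq [IsProbabilityMeasure P] {p α η : ℝ} (hp : 0 < p) (hα : 0 < α)
    (h : DesignExpMoment P p α η) : MemLp (fun z : Obs d => whiteNorm P z.1 ^ 2) 2 P := by
  have hm : Measurable fun z : Obs d => whiteNorm P z.1 ^ 2 := (measurable_whiteNorm P).pow_const 2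
  rw [memLp_two_iff_integrable_sq hm.aestronglyMeasurable]
  refine integrable_sq_of_exp_moment hm (fun z => sq_nonneg _) (c := (d : ℝ) ^ p + η) hp hα ?_
  refine le_trans (le_of_eq ?_) h
  refine lintegral_congr fun z => ?_
  rw [← Real.rpow_natCast, ← Real.rpow_mul (whiteNorm_nonneg P _), Nat.cast_ofNat, sub_sub]

theorem memLp_noiseRatio [IsProbabilityMeasure P] {θs : EuclideanSpace ℝ (Fin d)} {q α η : ℝ} (hq : 0 < q) (hα : 0 < α)
    (h : NoiseExpMoment P θs q α η) : MemLp (noiseRatio P θs) 2 P := by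
  have hm := measurable_noiseRatio P θs
  rw [memLp_two_iff_integrable_sq hm.aestronglyMeasurable]
  refine integrable_sq_of_exp_moment hm (noiseRatio_nonneg P θs) (c := 1 + η) hq hα ?_
  refine le_trans (le_of_eq ?_) h
  refine lintegral_congr fun z => ?_
  rw [noiseRatio, Real.div_rpow (sq_nonneg _) (risk_nonneg P θs), sub_sub]

theorem integrable_inner_four (hX : MemLp (fun z : Obs d => z.1) 2 P)
    (hw : MemLp (fun z : Obs d => whiteNorm P z.1 ^ 2) 2 P) (θ : EuclideanSpace ℝ (Fin d)) :
    Integrable (fun z : Obs d => (inner ℝ θ z.1 : ℝ) ^ 4) P := by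
  refine Integrable.mono' (hw.integrable_sq.const_mul ((∫ z, (inner ℝ θ z.1) ^ 2 ∂P) ^ 2))
    (by apply Measurable.aestronglyMeasurable; fun_prop) ?_
  filter_upwards [ae_inner_sq_le hX] with z hz
  rw [Real.norm_of_nonneg (by positivity), ← mul_pow]
  calc (inner ℝ θ z.1 : ℝ) ^ 4 = ((inner ℝ θ z.1) ^ 2) ^ 2 := by ring
    _ ≤ _ := by gcongr; exact hz θ

/-- Needed because `sSup` of an unbounded set is `0`, so that `κ₁` would bound nothing. -/
theorem bddAbove_kurtDesign (hX : MemLp (fun z : Obs d => z.1) 2 P)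
    (hw : MemLp (fun z : Obs d => whiteNorm P z.1 ^ 2) 2 P) :
    BddAbove {m : ℝ | ∃ θ : EuclideanSpace ℝ (Fin d),
      ∫ z, (inner ℝ θ z.1) ^ 2 ∂P ≤ 1 ∧ m = ∫ z, (inner ℝ θ z.1) ^ 4 ∂P} := by
  refine ⟨∫ z, (whiteNorm P z.1 ^ 2) ^ 2 ∂P, ?_⟩
  rintro _ ⟨θ, hθ, rfl⟩
  refine integral_mono_ae (integrable_inner_four hX hw θ) hw.integrable_sq ?_
  filter_upwards [ae_inner_sq_le hX] with z hz
  have h1 : (inner ℝ θ z.1 : ℝ) ^ 2 ≤ whiteNorm P z.1 ^ 2 :=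
    (hz θ).trans (mul_le_of_le_one_left (sq_nonneg _) hθ)
  calc (inner ℝ θ z.1 : ℝ) ^ 4 = ((inner ℝ θ z.1) ^ 2) ^ 2 := by ring
    _ ≤ _ := by gcongr

theorem kurtDesign_nonneg (P : Measure (Obs d)) : 0 ≤ kurtDesign P := by
  apply Real.sSup_nonneg
  rintro _ ⟨θ, -, rfl⟩
  exact integral_nonneg fun _ => by positivity

theorem kurtNoise_nonneg (P : Measure (Obs d)) (θs : EuclideanSpace ℝ (Fin d)) :
    0 ≤ kurtNoise P θs := by
  rw [kurtNoise]
  split_ifs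
  · exact div_nonneg (integral_nonneg fun _ => by positivity) (sq_nonneg _)
  · exact le_rfl

theorem integral_inner_four_le (hX : MemLp (fun z : Obs d => z.1) 2 P)
    (hw : MemLp (fun z : Obs d => whiteNorm P z.1 ^ 2) 2 P) (θ : EuclideanSpace ℝ (Fin d)) :
    ∫ z, (inner ℝ θ z.1) ^ 4 ∂P ≤ kurtDesign P * (∫ z, (inner ℝ θ z.1) ^ 2 ∂P) ^ 2 := by
  set m := ∫ z, (inner ℝ θ z.1) ^ 2 ∂P with hm
  have hm0 : 0 ≤ m := integral_nonneg fun _ => sq_nonneg _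
  rcases hm0.eq_or_lt with h | h
  · have h0 := ae_eq_zero_of_integral_sq (memLp_inner hX θ) h.symm
    have : ∫ z, (inner ℝ θ z.1) ^ 4 ∂P = ∫ _, (0 : ℝ) ∂P := by
      refine integral_congr_ae ?_
      filter_upwards [h0] with z hz
      rw [hz]; simp
    rw [this, ← h]; simp
  · have hs : 0 < √m := Real.sqrt_pos.2 h
    have h2 : ∀ k : ℕ, ∫ z, (inner ℝ ((√m)⁻¹ • θ) z.1) ^ k ∂P =
        ((√m)⁻¹) ^ k * ∫ z, (inner ℝ θ z.1) ^ k ∂P := by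
      intro k
      simp_rw [real_inner_smul_left, mul_pow]
      rw [integral_const_mul]
    have h3 : ∫ z, (inner ℝ ((√m)⁻¹ • θ) z.1) ^ 4 ∂P ≤ kurtDesign P := by
      refine le_csSup (bddAbove_kurtDesign hX hw) ⟨(√m)⁻¹ • θ, ?_, rfl⟩
      rw [h2, ← hm, inv_pow, Real.sq_sqrt hm0, inv_mul_cancel₀ h.ne']
    rw [h2, inv_pow, inv_mul_le_iff₀ (by positivity)] at h3
    refine h3.trans_eq ?_
    have : √m ^ 4 = m ^ 2 := by
      calc √m ^ 4 = (√m ^ 2) ^ 2 := by ring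
        _ = _ := by rw [Real.sq_sqrt hm0]
    rw [this]; ring

theorem integral_noiseRatio_sq_le (P : Measure (Obs d)) (θs : EuclideanSpace ℝ (Fin d)) :
    ∫ z, noiseRatio P θs z ^ 2 ∂P ≤ kurtNoise P θs := by
  rw [kurtNoise]
  split_ifs with h
  · apply le_of_eq
    rw [← integral_div]
    refine integral_congr_ae (Eventually.of_forall fun z => ?_)
    simp only [noiseRatio]
    rw [div_pow]
    congr 1
    ring
  · have h0 : risk P θs = 0 := le_antisymm (not_lt.1 h) (risk_nonneg P θs)
    simp [noiseRatio, h0]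

theorem integrable_resid_four (hX : MemLp (fun z : Obs d => z.1) 2 P)
    (hY : MemLp (fun z : Obs d => z.2) 2 P) {θs : EuclideanSpace ℝ (Fin d)}
    (hmin : ∀ θ, risk P θs ≤ risk P θ)
    (hw : MemLp (fun z : Obs d => whiteNorm P z.1 ^ 2) 2 P) (hν : MemLp (noiseRatio P θs) 2 P)
    (θ : EuclideanSpace ℝ (Fin d)) (ξ : ℝ) : Integrable (fun z => resid θ ξ z ^ 4) P := by
  refine Integrable.mono' ((hw.add hν).integrable_sq.const_mul (quadForm P θ ξ ^ 2))
    ((measurable_resid θ ξ).pow_const 4).aestronglyMeasurable ?_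
  filter_upwards [ae_resid_sq_le hX hY hmin] with z hz
  rw [Real.norm_of_nonneg (by positivity), ← mul_pow]
  calc resid θ ξ z ^ 4 = (resid θ ξ z ^ 2) ^ 2 := by ring
    _ ≤ _ := by gcongr; exact hz θ ξ

/-- The kurtosis of all the residuals is at most `(√κ₁ + √κ₂)²`. -/
theorem integral_resid_four_le (hX : MemLp (fun z : Obs d => z.1) 2 P)
    (hY : MemLp (fun z : Obs d => z.2) 2 P) {θs : EuclideanSpace ℝ (Fin d)}
    (hmin : ∀ θ, risk P θs ≤ risk P θ)
    (hw : MemLp (fun z : Obs d => whiteNorm P z.1 ^ 2) 2 P) (hν : MemLp (noiseRatio P θs) 2 P)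
    (θ : EuclideanSpace ℝ (Fin d)) (ξ : ℝ) :
    ∫ z, resid θ ξ z ^ 4 ∂P ≤ kurtSum P θs * quadForm P θ ξ ^ 2 := by
  set θ' := ξ • θs - θ with hθ'
  set m := ∫ z, (inner ℝ θ' z.1) ^ 2 ∂P with hm
  have hm0 : 0 ≤ m := integral_nonneg fun _ => sq_nonneg _
  -- The squared design part is normalised like the noise. When `m = 0`, division by zero makes `f`
  -- vanish, in agreement with the form being null almost surely.
  set f : Obs d → ℝ := fun z => (inner ℝ θ' z.1) ^ 2 / m with hf
  have hfm : Measurable f := by fun_prop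
  have hf0 : ∀ z, 0 ≤ f z := fun z => by positivity
  have hfsq : ∀ z, f z ^ 2 = (inner ℝ θ' z.1) ^ 4 / m ^ 2 := fun z => by
    simp only [hf]; rw [div_pow]; congr 1; ring
  have hfL : MemLp f 2 P := by
    rw [memLp_two_iff_integrable_sq hfm.aestronglyMeasurable]
    simp_rw [hfsq]
    exact (integrable_inner_four hX hw θ').div_const _
  have hfint : ∫ z, f z ^ 2 ∂P ≤ √(kurtDesign P) ^ 2 := by
    rw [Real.sq_sqrt (kurtDesign_nonneg P)]
    simp_rw [hfsq]
    rw [integral_div]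
    rcases hm0.eq_or_lt with h | h
    · rw [← h]; simpa using kurtDesign_nonneg P
    · rw [div_le_iff₀ (by positivity)]
      exact integral_inner_four_le hX hw θ'
  have hνint : ∫ z, noiseRatio P θs z ^ 2 ∂P ≤ √(kurtNoise P θs) ^ 2 := by
    rw [Real.sq_sqrt (kurtNoise_nonneg P θs)]
    exact integral_noiseRatio_sq_le P θs
  have hae : ∀ᵐ z ∂P, resid θ ξ z ^ 2 ≤ quadForm P θ ξ * (f z + noiseRatio P θs z) := by
    have hin : ∀ᵐ z ∂P, (inner ℝ θ' z.1) ^ 2 = m * f z := by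
      rcases hm0.eq_or_lt with h | h
      · filter_upwards [ae_eq_zero_of_integral_sq (memLp_inner hX θ') h.symm] with z hz
        rw [hz, ← h]; simp
      · exact Eventually.of_forall fun z => (mul_div_cancel₀ _ h.ne').symm
    filter_upwards [hin, ae_noise_sq_eq hX hY θs] with z h1 h2
    rw [resid_decomp θs, quadForm_decomp hX hY hmin]
    refine add_sq_le_of_sq_le hm0 (mul_nonneg (sq_nonneg _) (risk_nonneg P θs)) (hf0 z)
      (noiseRatio_nonneg P θs z) h1.le ?_
    rw [mul_pow, h2, mul_assoc]
  calc ∫ z, resid θ ξ z ^ 4 ∂P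
      ≤ ∫ z, quadForm P θ ξ ^ 2 * (f z + noiseRatio P θs z) ^ 2 ∂P := by
        refine integral_mono_ae (integrable_resid_four hX hY hmin hw hν θ ξ)
          ((hfL.add hν).integrable_sq.const_mul _) ?_
        filter_upwards [hae] with z hz
        rw [← mul_pow]
        calc resid θ ξ z ^ 4 = (resid θ ξ z ^ 2) ^ 2 := by ring
          _ ≤ _ := by gcongr
    _ = quadForm P θ ξ ^ 2 * ∫ z, (f z + noiseRatio P θs z) ^ 2 ∂P := integral_const_mul _ _
    _ ≤ quadForm P θ ξ ^ 2 * kurtSum P θs := by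
        gcongr
        exact integral_add_sq_le (Real.sqrt_nonneg _) (Real.sqrt_nonneg _) hfL hν hfint hνint
    _ = _ := mul_comm _ _

end OLS

namespace OLS

/-! ### Least squares under a uniform control of the quadratic form -/

theorem sumSq_eq {d n : ℕ} (s : Fin n → Obs d) (θ : EuclideanSpace ℝ (Fin d)) (hn : 0 < n) :
    sumSq s θ = n * empForm s θ 1 := by
  have : (n : ℝ) ≠ 0 := by positivity
  simp only [sumSq, empForm, resid, one_mul]
  field_simp

theorem sumSq_add_smul {d n : ℕ} (s : Fin n → Obs d) (θ u : EuclideanSpace ℝ (Fin d)) (t : ℝ) :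
    sumSq s (θ + t • u) = sumSq s θ + 2 * t * (-∑ i, ((s i).2 - inner ℝ θ (s i).1) * inner ℝ u (s i).1)
      + t ^ 2 * ∑ i, (inner ℝ u (s i).1) ^ 2 := by
  simp only [sumSq, ← Finset.sum_neg_distrib, Finset.mul_sum, ← Finset.sum_add_distrib]
  refine Finset.sum_congr rfl fun i _ => ?_
  rw [inner_add_left, real_inner_smul_left]
  ring

theorem sumSq_add_smul_of_min {d n : ℕ} (s : Fin n → Obs d) {θ : EuclideanSpace ℝ (Fin d)}
    (hθ : ∀ θ', sumSq s θ ≤ sumSq s θ') (u : EuclideanSpace ℝ (Fin d)) (t : ℝ) :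
    sumSq s (θ + t • u) = sumSq s θ + t ^ 2 * ∑ i, (inner ℝ u (s i).1) ^ 2 := by
  have h0 : -∑ i, ((s i).2 - inner ℝ θ (s i).1) * inner ℝ u (s i).1 = 0 := by
    refine eq_zero_of_quadratic_nonneg (m := ∑ i, (inner ℝ u (s i).1) ^ 2)
      (Finset.sum_nonneg fun _ _ => sq_nonneg _) fun t => ?_
    have := hθ (θ + t • u)
    rw [sumSq_add_smul] at this
    linarith
  rw [sumSq_add_smul, h0]
  ring

/-- The empirical risk takes equal values at `θhat ± t u` with `u = θhat - θs`, whereas the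
population risks there are `R(θs) + (1 ± t)² m`, `m` being the excess risk. The relative error bound
at both points yields `2 t m ≤ δ (R(θs) + m + t² m)`, to be optimised in `t`. -/
theorem excess_risk_le {d n : ℕ} {P : Measure (Obs d)} (hn : 0 < n)
    (hX : MemLp (fun z : Obs d => z.1) 2 P) (hY : MemLp (fun z : Obs d => z.2) 2 P)
    {θs : EuclideanSpace ℝ (Fin d)} (hmin : ∀ θ, risk P θs ≤ risk P θ) {s : Fin n → Obs d} {δ : ℝ}
    (hδ0 : 0 ≤ δ) (hδ1 : δ < 1)
    (h : ∀ θ ξ, |empForm s θ ξ - quadForm P θ ξ| ≤ δ * quadForm P θ ξ)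
    {θhat : EuclideanSpace ℝ (Fin d)} (hθ : ∀ θ, sumSq s θhat ≤ sumSq s θ) :
    risk P θhat - risk P θs ≤ δ ^ 2 / ((1 - δ) * (1 - δ ^ 2) * n) * sumSq s θhat ∧
      δ ^ 2 / ((1 - δ) * (1 - δ ^ 2) * n) * sumSq s θhat ≤ δ ^ 2 / (1 - δ) ^ 2 * risk P θs := by
  have hn' : (0 : ℝ) < n := by positivity
  set u := θhat - θs with hu
  set m := ∫ z, (inner ℝ u z.1) ^ 2 ∂P with hm
  have hm0 : 0 ≤ m := integral_nonneg fun _ => sq_nonneg _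
  have hrisk : ∀ t : ℝ, quadForm P (θhat + t • u) 1 = risk P θs + (1 + t) ^ 2 * m := by
    intro t
    rw [quadForm_decomp hX hY hmin]
    have e1 : (1 : ℝ) • θs - (θhat + t • u) = -((1 + t) • u) := by rw [hu]; module
    have e2 : ∫ z, (inner ℝ (-((1 + t) • u)) z.1) ^ 2 ∂P = (1 + t) ^ 2 * m := by
      simp_rw [inner_neg_left, real_inner_smul_left, neg_sq, mul_pow]
      rw [integral_const_mul]
    rw [e1, e2]; ring
  have hemp : ∀ t : ℝ, empForm s (θhat + t • u) 1 = empForm s (θhat + (-t) • u) 1 := by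
    intro t
    have h1 := sumSq_add_smul_of_min s hθ u t
    have h2 := sumSq_add_smul_of_min s hθ u (-t)
    rw [sumSq_eq s _ hn] at h1 h2
    have : (n : ℝ) * empForm s (θhat + t • u) 1 = n * empForm s (θhat + (-t) • u) 1 := by
      rw [h1, h2]; ring
    exact mul_left_cancel₀ hn'.ne' this
  have hkey : ∀ t : ℝ, 2 * t * m ≤ δ * (risk P θs + m + t ^ 2 * m) := by
    intro t
    have h1 := (abs_le.1 (h (θhat + t • u) 1)).1
    have h2 := (abs_le.1 (h (θhat + (-t) • u) 1)).2
    rw [hrisk] at h1 h2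
    rw [← hemp] at h2
    nlinarith
  have hQ : risk P θhat = risk P θs + m := by
    have := hrisk 0
    rw [risk_eq_quadForm]
    simpa using this
  have hR := risk_nonneg P θs
  have hmδ : m ≤ δ ^ 2 * (risk P θs + m) := by
    rcases hδ0.eq_or_lt with h0 | h0
    · have := hkey 1
      rw [← h0] at this ⊢
      linarith
    · have h1 := hkey δ⁻¹
      have h2 := mul_le_mul_of_nonneg_left h1 h0.le
      have e1 : δ * (2 * δ⁻¹ * m) = 2 * m := by field_simp
      have e2 : δ * (δ * (risk P θs + m + δ⁻¹ ^ 2 * m)) = δ ^ 2 * (risk P θs + m) + m := by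
        field_simp
      rw [e1, e2] at h2
      linarith
  have hδ2 : 0 < 1 - δ ^ 2 := by nlinarith
  have hδ' : 0 < 1 - δ := by linarith
  set E := empForm s θhat 1 with hE
  have hlow : (1 - δ) * (risk P θs + m) ≤ E := by
    have h1 := (abs_le.1 (h θhat 1)).1
    rw [← risk_eq_quadForm, hQ] at h1
    linarith
  have hup : E ≤ (1 + δ) * risk P θs := by
    have h1 := (abs_le.1 (h θs 1)).2
    rw [← risk_eq_quadForm] at h1
    have h2 := hθ θs
    rw [sumSq_eq s _ hn, sumSq_eq s _ hn] at h2
    have h3 := le_of_mul_le_mul_left h2 hn'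
    linarith
  have hE0 : 0 ≤ E := le_trans (by positivity) hlow
  have e : δ ^ 2 / ((1 - δ) * (1 - δ ^ 2) * n) * sumSq s θhat =
      δ ^ 2 / ((1 - δ) * (1 - δ ^ 2)) * E := by
    rw [sumSq_eq s _ hn, ← hE]
    field_simp
  rw [e, hQ]
  constructor
  · calc risk P θs + m - risk P θs = m := by ring
      _ ≤ δ ^ 2 * (risk P θs + m) := hmδ
      _ ≤ δ ^ 2 * (E / (1 - δ)) := by
          gcongr; rw [le_div_iff₀ hδ']; linarith
      _ = δ ^ 2 / (1 - δ) * E := by ring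
      _ ≤ δ ^ 2 / ((1 - δ) * (1 - δ ^ 2)) * E := by
          gcongr
          nlinarith [sq_nonneg δ]
  · calc δ ^ 2 / ((1 - δ) * (1 - δ ^ 2)) * E
        ≤ δ ^ 2 / ((1 - δ) * (1 - δ ^ 2)) * ((1 + δ) * risk P θs) := by gcongr
      _ = _ := by
        have : 1 - δ ^ 2 = (1 - δ) * (1 + δ) := by ring
        rw [this]
        field_simp

/-! ### Extended real bounds -/

theorem upperBound_of_lt {δ γ : ℝ} (hδ : δ < 1) (hγ : γ < 1) :
    upperBound δ γ = (((δ + γ) / ((1 - δ) * (1 - γ)) : ℝ) : EReal) := by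
  have h1 : 0 < 1 - δ := by linarith
  have h2 : 0 < 1 - γ := by linarith
  rw [upperBound, extDiv, max_eq_left h1.le, max_eq_left h2.le, if_neg (by positivity)]

/-- Strict positivity of `δ` keeps the numerator nonzero and so excludes the convention `0/0 = 1`.
-/
theorem upperBound_eq_top {δ γ : ℝ} (hδ0 : 0 < δ) (hγ0 : 0 ≤ γ) (h : 1 ≤ δ ∨ 1 ≤ γ) :
    upperBound δ γ = ⊤ := by
  have h0 : max (1 - δ) 0 * max (1 - γ) 0 = 0 := by
    rcases h with h | h
    · rw [max_eq_right (by linarith), zero_mul]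
    · rw [max_eq_right (a := 1 - γ) (by linarith), mul_zero]
  rw [upperBound, extDiv, if_pos h0, if_neg (by positivity)]

theorem ratio_mono {δ γ γ' : ℝ} (hδ0 : 0 ≤ δ) (hδ : δ < 1) (hγ0 : 0 ≤ γ) (hγ : γ ≤ γ') (hγ' : γ' < 1) :
    (δ + γ) / ((1 - δ) * (1 - γ)) ≤ (δ + γ') / ((1 - δ) * (1 - γ')) := by
  have h1 : 0 < 1 - δ := by linarith
  have h2 : 0 < 1 - γ' := by linarith
  have h3 : 0 ≤ δ + γ' := by linarith
  gcongr

theorem upperBound_mono {δ γ γ' : ℝ} (hδ0 : 0 < δ) (hγ0 : 0 ≤ γ) (hγ : γ ≤ γ') :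
    upperBound δ γ ≤ upperBound δ γ' := by
  by_cases h : δ < 1 ∧ γ' < 1
  · rw [upperBound_of_lt h.1 (hγ.trans_lt h.2), upperBound_of_lt h.1 h.2, EReal.coe_le_coe_iff]
    exact ratio_mono hδ0.le h.1 hγ0 hγ h.2
  · rw [upperBound_eq_top hδ0 (hγ0.trans hγ) (by
      by_contra hc; push Not at hc; exact h hc)]
    exact le_top

theorem neg_div_eq {μ γ : ℝ} (h : 2 * μ < 1) :
    -((μ / (1 - 2 * μ) + γ) / (1 + μ / (1 - 2 * μ))) = (1 - γ) * (1 - 2 * μ) / (1 - μ) - 1 := by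
  have h1 : 1 - 2 * μ ≠ 0 := by linarith
  have h2 : 1 - μ ≠ 0 := by linarith
  have h3 : 1 + μ / (1 - 2 * μ) = (1 - μ) / (1 - 2 * μ) := by
    rw [eq_div_iff h1, add_mul, div_mul_cancel₀ _ h1]; ring
  rw [h3, div_div_eq_mul_div, add_mul, div_mul_cancel₀ _ h1]
  field_simp
  ring

/-- The upper bound on the ratio of quadratic forms. -/
theorem ratio_upper {μ γ ρ : ℝ} (h0 : 0 ≤ μ) (h : 2 * μ < 1) (hδ : μ / (1 - 2 * μ) < 1)
    (hγ0 : 0 ≤ γ) (hγ : γ < 1) (hρ : ρ * (1 - γ) ≤ 1 + μ) :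
    ρ - 1 ≤ (μ / (1 - 2 * μ) + γ) / ((1 - μ / (1 - 2 * μ)) * (1 - γ)) := by
  have h1 : 0 < 1 - 2 * μ := by linarith
  have hγ' : 0 < 1 - γ := by linarith
  set δ := μ / (1 - 2 * μ) with hδdef
  have hδ0 : 0 ≤ δ := by positivity
  have hδ' : 0 < 1 - δ := by linarith
  have hμδ : μ ≤ δ := by rw [hδdef, le_div_iff₀ h1]; nlinarith
  rw [le_div_iff₀ (by positivity)]
  have h2 : (1 + μ) * (1 - δ) ≤ 1 := by nlinarith
  have h3 : ρ * (1 - γ) * (1 - δ) ≤ (1 + μ) * (1 - δ) := by gcongr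
  have h4 : 0 ≤ δ * γ := by positivity
  nlinarith

/-- By `neg_div_eq` the left side is one plus the announced lower bound, with `γ₋ = l²/3`; the right
side is what the deviation inequality provides. -/
theorem ratio_lower {l μ : ℝ} (hl : 0 ≤ l) (hμ : 0 ≤ μ) (h : l / 2 + 2 * μ < 1) :
    (1 - l ^ 2 / 3) * (1 - 2 * μ) / (1 - μ) ≤ 1 - μ - (1 / 6 + l / 15) * l ^ 2 := by
  have hμ1 : 0 < 1 - μ := by linarith
  rw [div_le_iff₀ hμ1]
  -- This is the difference of the two sides after multiplication by `1 - μ`. The bracket may be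
  -- negative for `μ > 1/7`, but then `l ≤ 2 - 4/7 = 10/7`, and the quadratic in `μ` that remains is
  -- positive, with its minimum near `0.238`.
  have key : 0 ≤ μ ^ 2 + l ^ 2 * (1 / 6 - μ / 2 - l / 15 + μ * l / 15) := by
    have hl2 : l ≤ 2 - 4 * μ := by linarith
    have hb : 1 / 30 - 7 / 30 * μ ≤ 1 / 6 - μ / 2 - l / 15 + μ * l / 15 := by
      have : 0 ≤ μ * l := by positivity
      linarith
    rcases le_total (μ * 7) 1 with h7 | h7
    · have : 0 ≤ 1 / 6 - μ / 2 - l / 15 + μ * l / 15 := by linarith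
      positivity
    · have h1 : l ^ 2 ≤ (10 / 7) ^ 2 := by
        have : l ≤ 10 / 7 := by linarith
        gcongr
      have h2 : l ^ 2 * (1 / 30 - 7 / 30 * μ) ≤
          l ^ 2 * (1 / 6 - μ / 2 - l / 15 + μ * l / 15) := by gcongr
      have h3 : (10 / 7) ^ 2 * (1 / 30 - 7 / 30 * μ) ≤ l ^ 2 * (1 / 30 - 7 / 30 * μ) := by
        apply mul_le_mul_of_nonpos_right h1
        linarith
      nlinarith [sq_nonneg (μ - 0.238)]
  nlinarith

theorem abs_sub_one_le {δ γ ρ b : ℝ} (hδ0 : 0 ≤ δ) (hδ : δ < 1) (hγ0 : 0 ≤ b) (hbγ : b ≤ γ)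
    (hγ : γ < 1) (hlow : -((δ + b) / (1 + δ)) ≤ ρ - 1)
    (hup : ρ - 1 ≤ (δ + γ) / ((1 - δ) * (1 - γ))) :
    |ρ - 1| ≤ (δ + γ) / ((1 - δ) * (1 - γ)) := by
  rw [abs_le]
  refine ⟨?_, hup⟩
  refine le_trans ?_ hlow
  rw [neg_le_neg_iff]
  have h1 : 0 < 1 - δ := by linarith
  have h2 : 0 < 1 - γ := by linarith
  have h3 : 0 ≤ γ := hγ0.trans hbγ
  gcongr
  nlinarith [mul_nonneg hδ0 h3]

theorem extDiv_of_ne {a b : ℝ} (hb : b ≠ 0) : extDiv a b = ((a / b : ℝ) : EReal) := if_neg hb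

theorem extDiv_zero_zero : extDiv 0 0 = ((1 : ℝ) : EReal) := by simp [extDiv]

/-- The extended real form of the two-sided bound on a ratio `ρ`. -/
theorem ereal_bounds {δ b γ γ' ρ : ℝ} (hδ0 : 0 < δ) (hb : 0 ≤ b) (hbγ : b ≤ γ') (hγ0 : 0 ≤ γ)
    (hγ : γ ≤ γ') (hlow : -((δ + b) / (1 + δ)) ≤ ρ - 1)
    (hup : δ < 1 → γ < 1 → ρ - 1 ≤ (δ + γ) / ((1 - δ) * (1 - γ))) :
    ((-((δ + b) / (1 + δ)) : ℝ) : EReal) ≤ (ρ : EReal) - 1 ∧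
      (ρ : EReal) - 1 ≤ upperBound δ γ ∧ upperBound δ γ ≤ upperBound δ γ' ∧
      ((((ρ : EReal) - 1).abs : ℝ≥0∞) : EReal) ≤ upperBound δ γ' := by
  have e : (ρ : EReal) - 1 = ((ρ - 1 : ℝ) : EReal) := by simp
  rw [e]
  have hU : ((ρ - 1 : ℝ) : EReal) ≤ upperBound δ γ := by
    by_cases h : δ < 1 ∧ γ < 1
    · rw [upperBound_of_lt h.1 h.2, EReal.coe_le_coe_iff]
      exact hup h.1 h.2
    · rw [upperBound_eq_top hδ0 hγ0 (by by_contra hc; push Not at hc; exact h hc)]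
      exact le_top
  refine ⟨EReal.coe_le_coe_iff.2 hlow, hU, upperBound_mono hδ0 hγ0 hγ, ?_⟩
  by_cases h : δ < 1 ∧ γ' < 1
  · rw [upperBound_of_lt h.1 h.2, EReal.abs_def, EReal.coe_ennreal_ofReal, EReal.coe_le_coe_iff,
      max_eq_left (abs_nonneg _)]
    exact abs_sub_one_le hδ0.le h.1 hb hbγ h.2 hlow
      ((hup h.1 (hγ.trans_lt h.2)).trans (ratio_mono hδ0.le h.1 hγ0 hγ h.2))
  · rw [upperBound_eq_top hδ0 (hγ0.trans hγ) (by by_contra hc; push Not at hc; exact h hc)]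
    exact le_top

end OLS

/-! ### Choice of the parameters of the posteriors. -/

namespace OLS

/-- The choice of the inverse temperature `l` and of the concentration `β` of the posteriors. -/
theorem exists_parameters {K D e N : ℝ} (hK : 1 < K) (hD : 1 ≤ D) (he : 0 < e) (hN : 0 < N) :
    ∃ l β : ℝ, 0 < l ∧ l ^ 2 = 2 * (e + 0.73 * D) / ((K - 1) * N) ∧ 10 ≤ β ∧
      N * ((K - 1) * l ^ 2 / 2 + l ^ 2 * K * (9 * (D / β) + 15 * (D / β) ^ 2)) + β / 2 + e ≤
        N * l * (√(2 * (K - 1) / N * (e + 0.73 * D)) + 6.81 * √K * √(2 * D / N)) ∧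
      ((20 * √K * √D + (5 / 2 + 1 / (2 * (K - 1))) * √(2 * (K - 1) * (e + 0.73 * D))) ^ 2 < N →
        l / 2 + 2 * (√(2 * (K - 1) / N * (e + 0.73 * D)) + 6.81 * √K * √(2 * D / N)) < 1) := by
  have hK1 : 0 < K - 1 := by linarith
  have hK0 : 0 < K := by linarith
  have hD0 : 0 < D := by linarith
  obtain ⟨L, hL⟩ : ∃ L, L = e + 0.73 * D := ⟨_, rfl⟩
  rw [← hL]
  have hLD : 0.73 * D ≤ L := by rw [hL]; linarith
  have hL0 : 0 < L := lt_of_lt_of_le (by positivity) hLD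
  set l := √(2 * L / ((K - 1) * N)) with hl
  set q := √(K * D / N) with hq
  have hl0 : 0 < l := Real.sqrt_pos.2 (by positivity)
  have hq0 : 0 < q := Real.sqrt_pos.2 (by positivity)
  have hl2 : l ^ 2 = 2 * L / ((K - 1) * N) := Real.sq_sqrt (by positivity)
  have hq2 : q ^ 2 = K * D / N := Real.sq_sqrt (by positivity)
  have hlN : l ^ 2 * ((K - 1) * N) = 2 * L := by rw [hl2]; field_simp
  have hqN : q ^ 2 * N = K * D := by rw [hq2]; field_simp
  have hm : √(2 * (K - 1) / N * L) = (K - 1) * l := by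
    rw [← Real.sqrt_sq (by positivity : 0 ≤ (K - 1) * l)]
    congr 1
    rw [mul_pow, hl2]
    field_simp
  have hs2 : √K * √(2 * D / N) = √2 * q := by
    rw [hq, ← Real.sqrt_mul hK0.le, ← Real.sqrt_mul (by norm_num)]
    congr 1
    ring
  have h2lo : (1.4 : ℝ) ≤ √2 := Real.le_sqrt_of_sq_le (by norm_num)
  have h2hi : √2 ≤ (1.415 : ℝ) := Real.sqrt_le_iff.2 ⟨by norm_num, by norm_num⟩
  rw [hm, mul_assoc (6.81 : ℝ), hs2]
  -- Up to a constant, `β` balances the entropy `β / 2` against the term in `D / β`. As `e = L -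
  -- 0.73 D`, the left side is `2L + 5.5 l N q + (15/81 - 0.73) D`; the right side is `2L + 6.81 √2
  -- l N q`.
  refine ⟨l, 9 * l * N * q, hl0, hl2, ?_, ?_, ?_⟩
  -- For `β ≥ 10`: `(l N q)² = 2 L K D / (K - 1) ≥ 2 · 0.73`, hence `l N q ≥ 1.2`.
  · have hx0 : 0 < l * N * q := by positivity
    have hx : (l * N * q) ^ 2 * (K - 1) = 2 * L * (K * D) := by
      rw [← hlN, ← hqN]; ring
    have hx2 : 1.46 ≤ (l * N * q) ^ 2 := by
      have h1 : 1.46 * (K - 1) ≤ (l * N * q) ^ 2 * (K - 1) := by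
        rw [hx]
        have h3 : 0.73 ≤ L * D := by norm_num at hLD ⊢; nlinarith
        have h4 : K - 1 ≤ K := by linarith
        norm_num at h3 ⊢
        nlinarith
      exact le_of_mul_le_mul_right h1 hK1
    have : 1.2 ≤ l * N * q := by
      by_contra hc
      push Not at hc
      norm_num at hc hx2
      nlinarith
    norm_num at this
    linarith
  · have hx0 : 0 < l * N * q := by positivity
    have e1 : N * ((K - 1) * l ^ 2 / 2) = L := by linarith
    have e2 : N * (l ^ 2 * K * (9 * (D / (9 * l * N * q)))) = l * N * q := by
      have : N * (l ^ 2 * K * (9 * (D / (9 * l * N * q)))) = l * (K * D) / q := by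
        field_simp
      rw [this, ← hqN]; field_simp
    have e3 : N * (l ^ 2 * K * (15 * (D / (9 * l * N * q)) ^ 2)) = 15 / 81 * D := by
      have : N * (l ^ 2 * K * (15 * (D / (9 * l * N * q)) ^ 2)) =
          15 / 81 * D * (K * D) / (q ^ 2 * N) := by
        field_simp
        norm_num
      rw [this, hqN]; field_simp
    have e4 : N * ((K - 1) * l ^ 2 / 2 + l ^ 2 * K *
        (9 * (D / (9 * l * N * q)) + 15 * (D / (9 * l * N * q)) ^ 2)) =
        N * ((K - 1) * l ^ 2 / 2) + N * (l ^ 2 * K * (9 * (D / (9 * l * N * q)))) +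
        N * (l ^ 2 * K * (15 * (D / (9 * l * N * q)) ^ 2)) := by ring
    rw [e4, e1, e2, e3]
    have e5 : N * l * ((K - 1) * l + 6.81 * (√2 * q)) =
        2 * L + 6.81 * √2 * (l * N * q) := by rw [← hlN]; ring
    rw [e5]
    have h9 : 9 ≤ 6.81 * √2 := by norm_num at h2lo ⊢; linarith
    have h10 : 9 * (l * N * q) ≤ 6.81 * √2 * (l * N * q) := by gcongr
    norm_num at hL hLD
    linarith
  · intro h
    have hsN : 0 < √N := Real.sqrt_pos.2 hN
    have h1 : 20 * √K * √D + (5 / 2 + 1 / (2 * (K - 1))) * √(2 * (K - 1) * L) < √N :=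
      Real.lt_sqrt_of_sq_lt h
    have e1 : √K * √D = q * √N := by
      rw [hq, ← Real.sqrt_mul hK0.le, ← Real.sqrt_mul (by positivity)]
      congr 1; field_simp
    have e2 : √(2 * (K - 1) * L) = (K - 1) * l * √N := by
      rw [← hm, ← Real.sqrt_mul (by positivity)]
      congr 1; field_simp
    rw [mul_assoc (20 : ℝ), e1, e2] at h1
    have e3 : 20 * (q * √N) + (5 / 2 + 1 / (2 * (K - 1))) * ((K - 1) * l * √N) =
        (20 * q + 5 / 2 * ((K - 1) * l) + l / 2) * √N := by
      field_simp
      ring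
    rw [e3] at h1
    have h2 : 20 * q + 5 / 2 * ((K - 1) * l) + l / 2 < 1 := by
      by_contra hc
      push Not at hc
      nlinarith
    -- The constant `20` in the threshold exceeds `2 · 6.81 · 1.415`.
    have h3 : √2 * q ≤ 1.415 * q := by gcongr
    have h4 : 0 < (K - 1) * l := by positivity
    norm_num at h3 ⊢
    linarith

end OLS

namespace OLS

/-! ### Order of magnitude of the sample size and of the bounds -/

theorem sq_integral_le {d : ℕ} {P : Measure (Obs d)} [IsProbabilityMeasure P] {f : Obs d → ℝ}
    (hf : MemLp f 2 P) : (∫ z, f z ∂P) ^ 2 ≤ ∫ z, f z ^ 2 ∂P := by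
  have h := integral_add_mul_sq hf (memLp_const (1 : ℝ)) (-∫ z, f z ∂P)
  have h0 : 0 ≤ ∫ z, (f z + -(∫ z, f z ∂P) * 1) ^ 2 ∂P := integral_nonneg fun _ => sq_nonneg _
  rw [h] at h0
  simp at h0
  nlinarith

/-- In a direction with positive second moment, Jensen's inequality gives `(E⟨θ, X⟩²)² ≤ E⟨θ, X⟩⁴ ≤
κ₁ (E⟨θ, X⟩²)²`. -/
theorem one_le_kurtDesign {d : ℕ} {P : Measure (Obs d)} [IsProbabilityMeasure P]
    (hX : MemLp (fun z : Obs d => z.1) 2 P)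
    (hw : MemLp (fun z : Obs d => whiteNorm P z.1 ^ 2) 2 P) (hne : ¬ ∀ᵐ z ∂P, z.1 = 0) :
    1 ≤ kurtDesign P := by
  obtain ⟨θ, hθ⟩ : ∃ θ : EuclideanSpace ℝ (Fin d), ∫ z, (inner ℝ θ z.1) ^ 2 ∂P ≠ 0 := by
    by_contra hc
    push Not at hc
    apply hne
    have h : ∀ᵐ z ∂P, ∀ j, inner ℝ (EuclideanSpace.single j (1 : ℝ)) z.1 = (0 : ℝ) := by
      rw [ae_all_iff]
      exact fun j => ae_eq_zero_of_integral_sq (memLp_inner hX _) (hc _)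
    filter_upwards [h] with z hz
    ext j
    have := hz j
    rwa [← IsIsotropic.coord_eq] at this
  have hpos : 0 < ∫ z, (inner ℝ θ z.1) ^ 2 ∂P :=
    lt_of_le_of_ne (integral_nonneg fun _ => sq_nonneg _) hθ.symm
  have hL : MemLp (fun z : Obs d => (inner ℝ θ z.1 : ℝ) ^ 2) 2 P := by
    rw [memLp_two_iff_integrable_sq (by apply Measurable.aestronglyMeasurable; fun_prop)]
    simp_rw [← pow_mul]
    exact integrable_inner_four hX hw θ
  have h1 := sq_integral_le hL
  simp_rw [← pow_mul] at h1
  have h2 := h1.trans (integral_inner_four_le hX hw θ)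
  by_contra hc
  push Not at hc
  nlinarith [pow_pos hpos 2]

theorem one_le_kurtNoise {d : ℕ} {P : Measure (Obs d)} [IsProbabilityMeasure P]
    (hX : MemLp (fun z : Obs d => z.1) 2 P) (hY : MemLp (fun z : Obs d => z.2) 2 P)
    {θs : EuclideanSpace ℝ (Fin d)} (hmin : ∀ θ, risk P θs ≤ risk P θ)
    (hw : MemLp (fun z : Obs d => whiteNorm P z.1 ^ 2) 2 P) (hν : MemLp (noiseRatio P θs) 2 P)
    (hpos : 0 < risk P θs) : 1 ≤ kurtNoise P θs := by
  have h4 := integrable_resid_four hX hY hmin hw hν θs 1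
  simp only [resid, one_mul] at h4
  have hL : MemLp (fun z : Obs d => (z.2 - inner ℝ θs z.1) ^ 2) 2 P := by
    rw [memLp_two_iff_integrable_sq (by apply Measurable.aestronglyMeasurable; fun_prop)]
    simp_rw [← pow_mul]
    exact h4
  have h1 := sq_integral_le hL
  simp_rw [← pow_mul] at h1
  rw [kurtNoise, if_pos hpos, le_div_iff₀ (by positivity), one_mul]
  exact h1

theorem kurtSum_le {d : ℕ} (P : Measure (Obs d)) (θs : EuclideanSpace ℝ (Fin d)) :
    kurtSum P θs ≤ 2 * (kurtDesign P + kurtNoise P θs) := by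
  have h1 := Real.sq_sqrt (kurtDesign_nonneg P)
  have h2 := Real.sq_sqrt (kurtNoise_nonneg P θs)
  rw [kurtSum]
  nlinarith [sq_nonneg (√(kurtDesign P) - √(kurtNoise P θs))]

theorem logTerm_le {d : ℕ} {ε : ℝ} (hd : 1 ≤ d) (hε : 0 < ε) (hε1 : ε < 1) :
    0 < Real.log ε⁻¹ ∧ 0 < logTerm d ε ∧ logTerm d ε ≤ 1.46 * (d + Real.log ε⁻¹) := by
  have hlog : 0 < Real.log ε⁻¹ := Real.log_pos ((one_lt_inv₀ hε).2 hε1)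
  have hd' : (1 : ℝ) ≤ d := by exact_mod_cast hd
  refine ⟨hlog, ?_, ?_⟩
  · unfold logTerm; positivity
  · unfold logTerm
    linarith

theorem sampleThreshold_le {K κ : ℝ} {d : ℕ} {ε : ℝ} (hK : 4 ≤ K) (hKκ : K ≤ 2 * κ) (hd : 1 ≤ d)
    (hε : 0 < ε) (hε1 : ε < 1) :
    sampleThreshold K d ε ≤ 10000 * (κ * (d + Real.log ε⁻¹)) := by
  obtain ⟨hlog, hL0, hL⟩ := logTerm_le hd hε hε1
  have hd' : (1 : ℝ) ≤ d := by exact_mod_cast hd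
  set Λ := Real.log ε⁻¹
  have hK1 : 0 < K - 1 := by linarith
  have h1 : 5 / 2 + 1 / (2 * (K - 1)) ≤ 8 / 3 := by
    have : 1 / (2 * (K - 1)) ≤ 1 / 6 := by
      apply one_div_le_one_div_of_le <;> linarith
    linarith
  have h1' : 0 < 5 / 2 + 1 / (2 * (K - 1)) := by positivity
  have hx : (20 * √K * √((d : ℝ) + 1)) ^ 2 = 400 * (K * (d + 1)) := by
    rw [mul_pow, mul_pow, Real.sq_sqrt (by linarith), Real.sq_sqrt (by linarith)]
    ring
  have hy : ((5 / 2 + 1 / (2 * (K - 1))) * √(2 * (K - 1) * logTerm d ε)) ^ 2 ≤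
      8 ^ 2 / 3 ^ 2 * (2 * (K - 1) * logTerm d ε) := by
    rw [mul_pow, Real.sq_sqrt (by positivity), ← div_pow]
    gcongr
  have hKL : (K - 1) * logTerm d ε ≤ K * (1.46 * (d + Λ)) := by gcongr; linarith
  have hKd : K * ((d : ℝ) + 1) ≤ K * (2 * (d + Λ)) := by gcongr; linarith
  have hKr : K * (d + Λ) ≤ 2 * κ * (d + Λ) := by gcongr
  have hr : 0 ≤ K * (d + Λ) := by positivity
  have hadd : sampleThreshold K d ε ≤ 2 * (20 * √K * √((d : ℝ) + 1)) ^ 2 +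
      2 * ((5 / 2 + 1 / (2 * (K - 1))) * √(2 * (K - 1) * logTerm d ε)) ^ 2 := by
    rw [sampleThreshold]
    nlinarith [sq_nonneg (20 * √K * √((d : ℝ) + 1) -
      (5 / 2 + 1 / (2 * (K - 1))) * √(2 * (K - 1) * logTerm d ε))]
  rw [hx] at hadd
  norm_num at hy hKL hadd
  linarith

theorem mu_le {K κ : ℝ} {d n : ℕ} {ε : ℝ} (hK : 1 < K) (hKκ : K ≤ 2 * κ) (hd : 1 ≤ d)
    (hε : 0 < ε) (hε1 : ε < 1) :
    mu K d n ε ≤ 22 * √(κ * (d + Real.log ε⁻¹) / n) := by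
  obtain ⟨hlog, hL0, hL⟩ := logTerm_le hd hε hε1
  have hd' : (1 : ℝ) ≤ d := by exact_mod_cast hd
  set Λ := Real.log ε⁻¹
  have hκ : 0 < κ := by linarith
  set x := √(κ * (d + Λ) / n) with hx
  have hx0 : 0 ≤ x := Real.sqrt_nonneg _
  have hx2 : x ^ 2 = κ * (d + Λ) / n := Real.sq_sqrt (by positivity)
  have h1 : √(2 * (K - 1) / n * logTerm d ε) ≤ 2.5 * x := by
    refine Real.sqrt_le_iff.2 ⟨by positivity, ?_⟩
    rw [mul_pow, hx2, div_mul_eq_mul_div, ← mul_div_assoc]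
    refine div_le_div_of_nonneg_right ?_ (Nat.cast_nonneg n)
    have : 2 * (K - 1) * logTerm d ε ≤ 2 * (2 * κ) * (1.46 * (d + Λ)) := by
      gcongr; linarith
    have h0 : 0 ≤ κ * (d + Λ) := by positivity
    norm_num at this ⊢
    nlinarith
  have h2 : √K * √(2 * ((d : ℝ) + 1) / n) ≤ 2.85 * x := by
    rw [← Real.sqrt_mul (by linarith)]
    refine Real.sqrt_le_iff.2 ⟨by positivity, ?_⟩
    rw [mul_pow, hx2, ← mul_div_assoc, ← mul_div_assoc]
    refine div_le_div_of_nonneg_right ?_ (Nat.cast_nonneg n)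
    have : K * (2 * ((d : ℝ) + 1)) ≤ 2 * κ * (2 * (2 * (d + Λ))) := by
      gcongr; linarith
    have h0 : 0 ≤ κ * (d + Λ) := by positivity
    norm_num at this ⊢
    nlinarith
  rw [mu, mul_assoc]
  norm_num at h1 h2 ⊢
  linarith

/-- With exponent `1/8`, the squared bracket in `γ̂₊` is `O(n^(1/4))`, hence `γ̂₊ = O(n^(-3/4))`,
negligible against `n^(-1/2)`. -/
theorem eventually_log_rpow_le (a : ℝ) {b r ε : ℝ} (hb : 0 < b) (hr : 0 < r) (hε : 0 < ε) :
    ∀ᶠ x : ℝ in atTop, 0 ≤ a + b * Real.log (x / ε) ∧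
      (a + b * Real.log (x / ε)) ^ r ≤ x ^ (1 / 8 : ℝ) := by
  have hlog := Real.tendsto_log_atTop
  have hlo := isLittleO_log_rpow_rpow_atTop r (by norm_num : (0 : ℝ) < 1 / 8)
  have hc : 0 < ((b + 1) ^ r)⁻¹ := by positivity
  filter_upwards [hlo.bound hc, hlog.eventually_ge_atTop ((b * Real.log ε - a) / b),
    hlog.eventually_ge_atTop (a - b * Real.log ε), hlog.eventually_ge_atTop 0,
    eventually_gt_atTop 0] with x h1 h2 h3 h4 h5
  have e : a + b * Real.log (x / ε) = a - b * Real.log ε + b * Real.log x := by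
    rw [Real.log_div h5.ne' hε.ne']; ring
  rw [div_le_iff₀ hb] at h2
  have h0 : 0 ≤ a + b * Real.log (x / ε) := by rw [e]; linarith
  refine ⟨h0, ?_⟩
  have h6 : a + b * Real.log (x / ε) ≤ (b + 1) * Real.log x := by rw [e]; linarith
  rw [Real.norm_of_nonneg (by positivity), Real.norm_of_nonneg (by positivity)] at h1
  calc (a + b * Real.log (x / ε)) ^ r ≤ ((b + 1) * Real.log x) ^ r := by gcongr
    _ = (b + 1) ^ r * Real.log x ^ r := Real.mul_rpow (by positivity) h4
    _ ≤ (b + 1) ^ r * (((b + 1) ^ r)⁻¹ * x ^ (1 / 8 : ℝ)) := by gcongr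
    _ = x ^ (1 / 8 : ℝ) := by field_simp

theorem mu_nonneg {K : ℝ} {d n : ℕ} {ε : ℝ} : 0 ≤ mu K d n ε := by
  unfold mu; positivity

/-- The bounds are eventually of order `√((κ₁ + κ₂) (d + log ε⁻¹) / n)`. -/
theorem eventually_bounds {K κ : ℝ} {d : ℕ} {ε p q α₁ α₂ η₁ η₂ : ℝ} (hK : 1 < K)
    (hKκ : K ≤ 2 * κ) (hd : 1 ≤ d) (hε : 0 < ε) (hε1 : ε < 1) (hp : 0 < p) (hq : 0 < q)
    (hα₁ : 0 < α₁) (hα₂ : 0 < α₂) :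
    ∀ᶠ n : ℕ in atTop, 0 ≤ deltaHat K d n ε ∧ deltaHat K d n ε < 1 ∧
      0 ≤ gammaHat K d n ε p q α₁ α₂ η₁ η₂ ∧ gammaHat K d n ε p q α₁ α₂ η₁ η₂ < 1 ∧
      (deltaHat K d n ε + gammaHat K d n ε p q α₁ α₂ η₁ η₂) /
        ((1 - deltaHat K d n ε) * (1 - gammaHat K d n ε p q α₁ α₂ η₁ η₂)) ≤
        26 * √(κ * (d + Real.log ε⁻¹) / n) := by
  obtain ⟨hlog, hL0, hL⟩ := logTerm_le hd hε hε1
  have hd' : (1 : ℝ) ≤ d := by exact_mod_cast hd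
  have hκ : 0 < κ := by linarith
  have hK1 : 0 < K - 1 := by linarith
  set rate := κ * (d + Real.log ε⁻¹) with hrate
  have hrate0 : 0 < rate := by positivity
  -- The first `4` bounds `(1 + δ̂)²`; the second comes from `(2 n^(1/8))²`.
  set M := 2 * logTerm d ε * 4 / (3 * (K - 1)) * 4 with hM
  have hM0 : 0 < M := by positivity
  have hlim : Tendsto (fun n : ℕ => √(rate / n)) atTop (nhds 0) := by
    have h := (tendsto_const_nhds (x := rate)).div_atTop (tendsto_natCast_atTop_atTop (R := ℝ))
    have := (Real.continuous_sqrt.tendsto 0).comp h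
    rw [Real.sqrt_zero] at this
    exact this
  have hpow : ∀ᶠ x : ℝ in atTop, M / √rate ≤ x ^ (1 / 4 : ℝ) :=
    (tendsto_rpow_atTop (by norm_num : (0 : ℝ) < 1 / 4)).eventually_ge_atTop _
  filter_upwards [hlim.eventually_le_const (by norm_num : (0 : ℝ) < 1 / 1000),
    tendsto_natCast_atTop_atTop.eventually (eventually_log_rpow_le ((d : ℝ) ^ p + η₁)
      (b := 2 * α₁⁻¹) (r := 2 / p) (ε := ε) (by positivity) (by positivity) hε),
    tendsto_natCast_atTop_atTop.eventually (eventually_log_rpow_le (1 + η₂)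
      (b := 2 * α₂⁻¹) (r := 2 / q) (ε := ε) (by positivity) (by positivity) hε),
    tendsto_natCast_atTop_atTop.eventually hpow, eventually_ge_atTop 1] with n hx h1 h2 h3 hn
  have hn0 : (0 : ℝ) < n := by positivity
  have hmu := mu_le (n := n) hK hKκ hd hε hε1
  rw [← hrate] at hmu
  have hmu0 := mu_nonneg (K := K) (d := d) (n := n) (ε := ε)
  set x := √(rate / n) with hxdef
  have hx0 : 0 ≤ x := Real.sqrt_nonneg _
  have hden : 0 < 1 - 2 * mu K d n ε := by linarith
  have hδ0 : 0 ≤ deltaHat K d n ε := div_nonneg hmu0 hden.le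
  have hδx : deltaHat K d n ε ≤ 24 * x := by
    rw [deltaHat, div_le_iff₀ hden]
    nlinarith
  have hγ0 : 0 ≤ gammaHat K d n ε p q α₁ α₂ η₁ η₂ := by
    unfold gammaHat; positivity
  have hγx : gammaHat K d n ε p q α₁ α₂ η₁ η₂ ≤ x := by
    have e1 : gammaHat K d n ε p q α₁ α₂ η₁ η₂ ≤
        2 * logTerm d ε * 2 ^ 2 / (3 * (K - 1) * n) *
          ((n : ℝ) ^ (1 / 8 : ℝ) + (n : ℝ) ^ (1 / 8 : ℝ)) ^ 2 := by
      unfold gammaHat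
      have hb1 := Real.rpow_nonneg h1.1 (2 / p)
      have hb2 := Real.rpow_nonneg h2.1 (2 / q)
      gcongr
      · linarith
      · exact h1.2
      · exact h2.2
    have e2 : ((n : ℝ) ^ (1 / 8 : ℝ)) ^ 2 = (n : ℝ) ^ (1 / 4 : ℝ) := by
      rw [← Real.rpow_natCast, ← Real.rpow_mul hn0.le]; norm_num
    have e3 : (n : ℝ) ^ (1 / 4 : ℝ) * (n : ℝ) ^ (1 / 4 : ℝ) = √n := by
      rw [← Real.rpow_add hn0, Real.sqrt_eq_rpow]; norm_num
    set y := (n : ℝ) ^ (1 / 4 : ℝ) with hy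
    have hy0 : 0 < y := Real.rpow_pos_of_pos hn0 _
    have hn4 : (n : ℝ) = √n * √n := (Real.mul_self_sqrt hn0.le).symm
    have hsr : 0 < √rate := Real.sqrt_pos.2 hrate0
    have hsn : 0 < √(n : ℝ) := Real.sqrt_pos.2 hn0
    refine e1.trans ?_
    have e4 : 2 * logTerm d ε * 2 ^ 2 / (3 * (K - 1) * n) *
          ((n : ℝ) ^ (1 / 8 : ℝ) + (n : ℝ) ^ (1 / 8 : ℝ)) ^ 2 = M * y / n := by
      rw [← e2, hM]; field_simp; ring
    rw [e4, hxdef, Real.sqrt_div hrate0.le, div_le_div_iff₀ hn0 hsn]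
    rw [div_le_iff₀ hsr] at h3
    calc M * y * √n ≤ (y * √rate) * y * √n := by gcongr
      _ = √rate * ((y * y) * √n) := by ring
      _ = √rate * n := by rw [e3, ← hn4]
  refine ⟨hδ0, by linarith, hγ0, by linarith, ?_⟩
  have hδ1 : 0 < 1 - deltaHat K d n ε := by linarith
  have hγ1 : 0 < 1 - gammaHat K d n ε p q α₁ α₂ η₁ η₂ := by linarith
  rw [div_le_iff₀ (by positivity)]
  -- The numerator is at most `24 x + x`, and `25 ≤ 26 · 0.97`.
  have hp1 : 0.97 ≤ (1 - deltaHat K d n ε) * (1 - gammaHat K d n ε p q α₁ α₂ η₁ η₂) := by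
    norm_num
    nlinarith
  have hp2 := mul_le_mul_of_nonneg_left hp1 (by positivity : 0 ≤ 26 * x)
  norm_num at hp2
  linarith

end OLS

namespace OLS

/-! ### The event on which the bounds hold -/

section Event

variable {d n : ℕ} {P : Measure (Obs d)} {Ω : Type*} [MeasurableSpace Ω] {μ : Measure Ω}
  {Z : Fin n → Ω → Obs d}

/-- A union bound for a sample of size `n`. -/
theorem measure_iUnion_preimage_le (hn : 0 < n) (hZ : ∀ i, Measurable (Z i))
    (hlaw : ∀ i, μ.map (Z i) = P) {E : Set (Obs d)} (hE : MeasurableSet E) {ε : ℝ}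
    (h : P E ≤ ENNReal.ofReal (n / ε)⁻¹) :
    μ (⋃ i, Z i ⁻¹' E) ≤ ENNReal.ofReal ε := by
  have hn' : (0 : ℝ) < n := by positivity
  calc μ (⋃ i, Z i ⁻¹' E) ≤ ∑ i, μ (Z i ⁻¹' E) := measure_iUnion_fintype_le _ _
    _ = ∑ _i : Fin n, P E := by
      refine Finset.sum_congr rfl fun i _ => ?_
      rw [← hlaw i, Measure.map_apply (hZ i) hE]
    _ ≤ ∑ _i : Fin n, ENNReal.ofReal (n / ε)⁻¹ := Finset.sum_le_sum fun _ _ => h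
    _ = ENNReal.ofReal ε := by
      rw [Finset.sum_const, Finset.card_univ, Fintype.card_fin, nsmul_eq_mul,
        ← ENNReal.ofReal_natCast, ← ENNReal.ofReal_mul hn'.le]
      congr 1
      rw [inv_div]
      field_simp

/-- An almost sure property holds for the whole sample outside of a measurable null set. -/
theorem exists_measurableSet_of_ae (hZ : ∀ i, Measurable (Z i)) (hlaw : ∀ i, μ.map (Z i) = P)
    {Q : Obs d → Prop} (hQ : ∀ᵐ z ∂P, Q z) :
    ∃ B : Set Ω, MeasurableSet B ∧ μ Bᶜ = 0 ∧ ∀ ω ∈ B, ∀ i, Q (Z i ω) := by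
  set E := toMeasurable P {z | ¬ Q z} with hE
  have hEm : MeasurableSet E := measurableSet_toMeasurable _ _
  have hE0 : P E = 0 := (measure_toMeasurable _).trans (ae_iff.1 hQ)
  refine ⟨(⋃ i, Z i ⁻¹' E)ᶜ, (MeasurableSet.iUnion fun i => hZ i hEm).compl, ?_, ?_⟩
  · rw [compl_compl, measure_iUnion_null_iff]
    intro i
    rw [← Measure.map_apply (hZ i) hEm, hlaw i, hE0]
  · intro ω hω i
    by_contra hc
    exact hω (Set.mem_iUnion.2 ⟨i, subset_toMeasurable _ _ hc⟩)

theorem ofReal_one_sub_le_measure_inter [IsProbabilityMeasure μ] {B₀ B₁ B₂ B₃ B₄ : Set Ω} {ε : ℝ}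
    (hε : 0 ≤ ε) (h₀ : μ B₀ᶜ = 0) (h₁ : μ B₁ᶜ ≤ ENNReal.ofReal ε) (h₂ : μ B₂ᶜ ≤ ENNReal.ofReal ε)
    (h₃ : μ B₃ᶜ ≤ ENNReal.ofReal ε) (h₄ : μ B₄ᶜ ≤ ENNReal.ofReal ε)
    (hm : MeasurableSet (B₀ ∩ (B₁ ∩ (B₂ ∩ (B₃ ∩ B₄))))) :
    ENNReal.ofReal (1 - 4 * ε) ≤ μ (B₀ ∩ (B₁ ∩ (B₂ ∩ (B₃ ∩ B₄)))) := by
  have hc : μ (B₀ ∩ (B₁ ∩ (B₂ ∩ (B₃ ∩ B₄))))ᶜ ≤ ENNReal.ofReal (4 * ε) := by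
    simp only [Set.compl_inter]
    have e : ENNReal.ofReal (4 * ε) = 0 + (ENNReal.ofReal ε + (ENNReal.ofReal ε +
        (ENNReal.ofReal ε + ENNReal.ofReal ε))) := by
      rw [← ENNReal.ofReal_add hε hε, ← ENNReal.ofReal_add hε (by positivity),
        ← ENNReal.ofReal_add hε (by positivity), zero_add]
      congr 1; ring
    rw [e]
    refine (measure_union_le _ _).trans (add_le_add h₀.le ?_)
    refine (measure_union_le _ _).trans (add_le_add h₁ ?_)
    refine (measure_union_le _ _).trans (add_le_add h₂ ?_)
    exact (measure_union_le _ _).trans (add_le_add h₃ h₄)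
  rw [← compl_compl (B₀ ∩ (B₁ ∩ (B₂ ∩ (B₃ ∩ B₄)))), prob_compl_eq_one_sub hm.compl,
    ENNReal.ofReal_sub _ (by positivity), ENNReal.ofReal_one]
  exact tsub_le_tsub_left hc 1

end Event

/-! ### Deterministic consequences -/

section Radius

variable {d n r : ℕ} {P : Measure (Obs d)} {s : Fin n → Obs d}
  {W : Obs d → EuclideanSpace ℝ (Fin r)} {c : Obs d →ₗ[ℝ] EuclideanSpace ℝ (Fin r)}

/-- Surjectivity of `c` provides `(θ, ξ)` in the direction of `W (s i)`, where the residual equals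
`‖W (s i)‖`. If this vector is zero, its inverse norm is `0` and the same choice works. -/
theorem norm_le_radius (hc : Function.Surjective c) (hN : ∀ θ ξ, quadForm P θ ξ = ‖c (θ, ξ)‖ ^ 2)
    (hs : ∀ i θ ξ, resid θ ξ (s i) = inner ℝ (c (θ, ξ)) (W (s i))) (i : Fin n) :
    ‖W (s i)‖ ≤ radius P s := by
  refine le_trans ?_ (le_ciSup (Set.finite_range _).bddAbove i)
  obtain ⟨⟨θ, ξ⟩, hv⟩ := hc (‖W (s i)‖⁻¹ • W (s i))
  refine le_csSup ⟨‖W (s i)‖, ?_⟩ ⟨θ, ξ, ?_, ?_⟩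
  · rintro _ ⟨θ, ξ, h, rfl⟩
    rw [hN] at h
    rw [hs]
    have h1 : ‖c (θ, ξ)‖ ≤ 1 := by nlinarith [norm_nonneg (c (θ, ξ))]
    exact (real_inner_le_norm _ _).trans (mul_le_of_le_one_left (norm_nonneg _) h1)
  · rw [hN, hv, norm_smul, norm_inv, norm_norm]
    exact pow_le_one₀ (by positivity) (inv_mul_le_one)
  · rw [hs, hv, real_inner_smul_left, real_inner_self_eq_norm_sq]
    rcases eq_or_ne ‖W (s i)‖ 0 with h | h
    · simp [h]
    · field_simp

theorem radius_le_sqrt (hn : 0 < n) {b : ℝ}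
    (h : ∀ i θ ξ, resid θ ξ (s i) ^ 2 ≤ quadForm P θ ξ * b) : radius P s ≤ √b := by
  have : Nonempty (Fin n) := ⟨⟨0, hn⟩⟩
  refine ciSup_le fun i => csSup_le ⟨_, 0, 0, ?_, rfl⟩ ?_
  · simp [quadForm, resid]
  · rintro _ ⟨θ, ξ, hq, rfl⟩
    by_cases hb : 0 ≤ b
    · exact Real.le_sqrt_of_sq_le ((h i θ ξ).trans (mul_le_of_le_one_left hb hq))
    · have h1 := h i θ ξ
      have h2 := mul_nonneg (quadForm_nonneg P θ ξ) (not_le.1 hb |>.le |> neg_nonneg.2)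
      have h3 : resid θ ξ (s i) ^ 2 ≤ 0 := by linarith
      have h4 : resid θ ξ (s i) = 0 := pow_eq_zero_iff two_ne_zero |>.1 (le_antisymm h3 (sq_nonneg _))
      rw [h4]
      exact Real.sqrt_nonneg _

end Radius

/-- Control of the ratio `ρ` between the empirical and the population form in one direction. -/
theorem ratio_bounds {n r : ℕ} (hn : 0 < n) {w : Fin n → EuclideanSpace ℝ (Fin r)}
    {θ : EuclideanSpace ℝ (Fin r)} {l m γ R a b : ℝ} (hl : 0 < l) (hw : ∀ i, ‖w i‖ ≤ R)
    (hγ : l ^ 2 / 3 * R ^ 4 ≤ γ)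
    (hlow : ∑ i, l * (1 - (inner ℝ θ (w i)) ^ 2) ≤ a) (ha : a ≤ n * (l * (m + (1 / 6 + l / 15) * l ^ 2)))
    (hup : ∑ i, l * (max (1 - (l * ‖w i‖ ^ 2) ^ 2 / 3) 0 * (inner ℝ θ (w i)) ^ 2 - 1) ≤ b)
    (hb : b ≤ n * (l * m)) :
    1 - m - (1 / 6 + l / 15) * l ^ 2 ≤ 1 / (n : ℝ) * ∑ i, (inner ℝ θ (w i)) ^ 2 ∧
      (1 / (n : ℝ) * ∑ i, (inner ℝ θ (w i)) ^ 2) * (1 - γ) ≤ 1 + m := by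
  have hn' : (0 : ℝ) < n := by positivity
  set S := ∑ i, (inner ℝ θ (w i) : ℝ) ^ 2 with hS
  have e1 : ∑ i, l * (1 - (inner ℝ θ (w i) : ℝ) ^ 2) = l * (n - S) := by
    rw [← Finset.mul_sum, Finset.sum_sub_distrib]; simp [hS]
  constructor
  · rw [e1] at hlow
    have h1 : l * (n - S) ≤ l * (n * (m + (1 / 6 + l / 15) * l ^ 2)) := by linarith
    have h2 := le_of_mul_le_mul_left h1 hl
    rw [one_div_mul_eq_div, le_div_iff₀ hn']
    linarith
  · have e2 : l * (S * (1 - γ) - n) ≤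
        ∑ i, l * (max (1 - (l * ‖w i‖ ^ 2) ^ 2 / 3) 0 * (inner ℝ θ (w i)) ^ 2 - 1) := by
      rw [← Finset.mul_sum, Finset.sum_sub_distrib, hS, Finset.sum_mul]
      simp only [Finset.sum_const, Finset.card_univ, Fintype.card_fin, nsmul_eq_mul, mul_one]
      refine mul_le_mul_of_nonneg_left (sub_le_sub_right (Finset.sum_le_sum fun i _ => ?_) _) hl.le
      rw [mul_comm]
      refine mul_le_mul_of_nonneg_right (le_trans ?_ (le_max_left _ _)) (sq_nonneg _)
      have h4 : ‖w i‖ ^ 4 ≤ R ^ 4 := by gcongr; exact hw i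
      have h5 : l ^ 2 / 3 * ‖w i‖ ^ 4 ≤ l ^ 2 / 3 * R ^ 4 := by gcongr
      have e : (l * ‖w i‖ ^ 2) ^ 2 / 3 = l ^ 2 / 3 * ‖w i‖ ^ 4 := by ring
      rw [e]
      linarith
    have h1 : l * (S * (1 - γ) - n) ≤ l * (n * m) := by linarith
    have h2 := le_of_mul_le_mul_left h1 hl
    rw [one_div_mul_eq_div, div_mul_eq_mul_div, div_le_iff₀ hn']
    linarith

/-- The deterministic bound of the fourth power of the radius. -/
theorem add_sq_le_rpow {d : ℕ} {w ν A₁ A₂ p q : ℝ} (hd : d = 0 → w = 0) (hA₁ : 1 ≤ d → 1 ≤ A₁)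
    (hA₁' : 0 ≤ A₁) (hA₂ : 1 ≤ A₂) (hp : 0 < p) (hq : 0 < q) (hw0 : 0 ≤ w) (hν0 : 0 ≤ ν)
    (hw : w ^ p < A₁) (hν : ν ^ q < A₂) : w + ν ≤ A₁ ^ (2 / p) + A₂ ^ (2 / q) := by
  have key : ∀ {x A t : ℝ}, 0 < t → 0 ≤ x → 1 ≤ A → x ^ t < A → x ≤ A ^ (2 / t) := by
    intro x A t ht hx hA h
    calc x = (x ^ t) ^ (1 / t) := by
          rw [← Real.rpow_mul hx, mul_one_div_cancel ht.ne', Real.rpow_one]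
      _ ≤ A ^ (1 / t) := by gcongr
      _ ≤ A ^ (2 / t) := Real.rpow_le_rpow_of_exponent_le hA (by gcongr; norm_num)
  refine add_le_add ?_ (key hq hν0 hA₂ hν)
  -- For `d = 0` the base `A₁` may be below one, so passing from exponent `1/p` to `2/p` could fail;
  -- but then `w = 0`.
  rcases Nat.eq_zero_or_pos d with h | h
  · rw [hd h]; positivity
  · exact key hp hw0 (hA₁ h) hw

end OLS

/-! ### The event of probability at least `1 - 4ε`. -/

namespace OLS

/-- With high probability, the ratio of the empirical to the population form is controlled
uniformly, and the data-dependent remainder is below its deterministic counterpart. -/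
theorem exists_event_ratio_bounds {d n : ℕ} {P : Measure (Obs d)} [IsProbabilityMeasure P]
    (hX : MemLp (fun z : Obs d => z.1) 2 P) (hY : MemLp (fun z : Obs d => z.2) 2 P)
    {θs : EuclideanSpace ℝ (Fin d)} (hmin : ∀ θ, risk P θs ≤ risk P θ)
    {p q α₁ α₂ η₁ η₂ : ℝ} (hp : 0 < p) (hq : 0 < q) (hα₁ : 0 < α₁) (hα₂ : 0 < α₂) (hη₁ : 0 < η₁)
    (hη₂ : 0 < η₂) (hdes : DesignExpMoment P p α₁ η₁) (hnoise : NoiseExpMoment P θs q α₂ η₂)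
    (hK : 1 < kurtSum P θs) {ε : ℝ} (hε : 0 < ε) (hε1 : ε < 1)
    (hn : sampleThreshold (kurtSum P θs) d ε < n)
    {Ω : Type*} [MeasurableSpace Ω] {μ : Measure Ω} [IsProbabilityMeasure μ]
    {Z : Fin n → Ω → Obs d} (hZ : ∀ i, Measurable (Z i)) (hind : iIndepFun Z μ)
    (hlaw : ∀ i, μ.map (Z i) = P) :
    ∃ B : Set Ω, MeasurableSet B ∧ ENNReal.ofReal (1 - 4 * ε) ≤ μ B ∧ ∀ ω ∈ B,
      0 < deltaHat (kurtSum P θs) d n ε ∧ 0 ≤ gammaMinus (kurtSum P θs) d n ε ∧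
      gammaMinus (kurtSum P θs) d n ε ≤ gammaHat (kurtSum P θs) d n ε p q α₁ α₂ η₁ η₂ ∧
      0 ≤ gammaPlus (kurtSum P θs) d n ε (radius P fun i => Z i ω) ∧
      gammaPlus (kurtSum P θs) d n ε (radius P fun i => Z i ω) ≤
        gammaHat (kurtSum P θs) d n ε p q α₁ α₂ η₁ η₂ ∧
      ∀ θ ξ, ∃ ρ : ℝ, extDiv (empForm (fun i => Z i ω) θ ξ) (quadForm P θ ξ) = (ρ : EReal) ∧
        empForm (fun i => Z i ω) θ ξ = ρ * quadForm P θ ξ ∧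
        -((deltaHat (kurtSum P θs) d n ε + gammaMinus (kurtSum P θs) d n ε) /
          (1 + deltaHat (kurtSum P θs) d n ε)) ≤ ρ - 1 ∧
        (deltaHat (kurtSum P θs) d n ε < 1 →
          gammaPlus (kurtSum P θs) d n ε (radius P fun i => Z i ω) < 1 →
          ρ - 1 ≤ (deltaHat (kurtSum P θs) d n ε +
              gammaPlus (kurtSum P θs) d n ε (radius P fun i => Z i ω)) /
            ((1 - deltaHat (kurtSum P θs) d n ε) *
              (1 - gammaPlus (kurtSum P θs) d n ε (radius P fun i => Z i ω)))) := by
  have hw := memLp_whiteNorm_sq hp hα₁ hdes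
  have hν := memLp_noiseRatio hq hα₂ hnoise
  obtain ⟨r, W, c, hr, hiso, hc, hN, hae⟩ := exists_isotropic hX hY
    (integrable_resid_four hX hY hmin hw hν) (integral_resid_four_le hX hY hmin hw hν)
  set K := kurtSum P θs with hKdef
  have hn0 : (0 : ℝ) < n := lt_of_le_of_lt (sq_nonneg _) hn
  have hnpos : 0 < n := by exact_mod_cast hn0
  have hlog : 0 < Real.log ε⁻¹ := Real.log_pos ((one_lt_inv₀ hε).2 hε1)
  have hlogn : 0 ≤ Real.log (n / ε) := by
    apply Real.log_nonneg
    rw [one_le_div hε]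
    have : (1 : ℝ) ≤ n := by exact_mod_cast hnpos
    linarith
  have hD : (1 : ℝ) ≤ (d : ℝ) + 1 := by linarith [(Nat.cast_nonneg d : (0 : ℝ) ≤ d)]
  have hrD : (r : ℝ) ≤ (d : ℝ) + 1 := by exact_mod_cast hr
  have hK1 : 0 < K - 1 := by linarith
  obtain ⟨l, β, hl0, hl, hβ, hbudget, hthr⟩ := exists_parameters hK hD hlog hn0
  have hβ0 : 0 < β := by linarith
  -- The sample size enters here: `l / 2 + 2μ < 1` contains both `l ≤ 2` and `2μ < 1`.
  have hthr := hthr hn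
  have hmu : √(2 * (K - 1) / n * (Real.log ε⁻¹ + 0.73 * ((d : ℝ) + 1))) +
      6.81 * √K * √(2 * ((d : ℝ) + 1) / n) = mu K d n ε := rfl
  rw [hmu] at hbudget hthr
  have hmu0 : 0 < mu K d n ε := by
    unfold mu logTerm
    positivity
  set m := mu K d n ε with hm
  have hm2 : 2 * m < 1 := by linarith
  have hden : 0 < 1 - 2 * m := by linarith
  have hδdef : deltaHat K d n ε = m / (1 - 2 * m) := rfl
  have hδ0 : 0 < deltaHat K d n ε := by rw [hδdef]; positivity
  have hγm : gammaMinus K d n ε = l ^ 2 / 3 := by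
    rw [gammaMinus, hl, logTerm]
    field_simp
  set δ := deltaHat K d n ε with hδ
  have hγm0 : 0 ≤ gammaMinus K d n ε := by rw [hγm]; positivity
  set A₁ := (d : ℝ) ^ p + η₁ + 2 * α₁⁻¹ * Real.log (n / ε) with hA₁
  set A₂ := 1 + η₂ + 2 * α₂⁻¹ * Real.log (n / ε) with hA₂
  have hA₁0 : 0 ≤ A₁ := by positivity
  have hA₁1 : 1 ≤ d → 1 ≤ A₁ := by
    intro h
    have h1 : (1 : ℝ) ≤ (d : ℝ) ^ p := Real.one_le_rpow (by exact_mod_cast h) hp.le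
    have h2 : 0 ≤ 2 * α₁⁻¹ * Real.log (n / ε) := by positivity
    linarith
  have hA₂1 : 1 ≤ A₂ := by
    have h2 : 0 ≤ 2 * α₂⁻¹ * Real.log (n / ε) := by positivity
    linarith
  have hγh : gammaHat K d n ε p q α₁ α₂ η₁ η₂ =
      l ^ 2 / 3 * (A₁ ^ (2 / p) + A₂ ^ (2 / q)) ^ 2 * (1 + δ) ^ 2 := by
    rw [← hγm, gammaHat, gammaMinus]
    ring
  have hδsq : 1 ≤ (1 + δ) ^ 2 := one_le_pow₀ (by linarith)
  have hA : 1 ≤ A₁ ^ (2 / p) + A₂ ^ (2 / q) := by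
    have h1 := Real.rpow_nonneg hA₁0 (2 / p)
    have h2 : 1 ≤ A₂ ^ (2 / q) := Real.one_le_rpow hA₂1 (by positivity)
    linarith
  -- the events
  obtain ⟨B₀, hB₀m, hB₀, hB₀'⟩ := exists_measurableSet_of_ae hZ hlaw
    (hae.and (ae_resid_sq_le hX hY hmin))
  obtain ⟨B₁, hB₁m, hB₁, hB₁'⟩ := hiso.lower_deviation (by linarith) hZ hind hlaw hrD hl0
    (by linarith) hβ0 hε
  obtain ⟨B₂, hB₂m, hB₂, hB₂'⟩ := hiso.upper_deviation hK.le hZ hind hlaw hrD hl0 hβ hε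
  have hE₁m : MeasurableSet {z : Obs d | A₁ ≤ (whiteNorm P z.1 ^ 2) ^ p} :=
    measurableSet_le measurable_const (((measurable_whiteNorm P).pow_const 2).pow_const p)
  have hE₂m : MeasurableSet {z : Obs d | A₂ ≤ noiseRatio P θs z ^ q} :=
    measurableSet_le measurable_const ((measurable_noiseRatio P θs).pow_const q)
  have hE₁ := measure_iUnion_preimage_le hnpos hZ hlaw hE₁m (ε := ε)
    (measure_le_of_exp_moment ((measurable_whiteNorm P).pow_const 2) hα₁ (by positivity) <| by
      refine le_trans (le_of_eq ?_) hdes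
      refine lintegral_congr fun z => ?_
      rw [← Real.rpow_natCast, ← Real.rpow_mul (whiteNorm_nonneg P _), Nat.cast_ofNat, sub_sub])
  have hE₂ := measure_iUnion_preimage_le hnpos hZ hlaw hE₂m (ε := ε)
    (measure_le_of_exp_moment (measurable_noiseRatio P θs) hα₂ (by positivity) <| by
      refine le_trans (le_of_eq ?_) hnoise
      refine lintegral_congr fun z => ?_
      rw [noiseRatio, Real.div_rpow (sq_nonneg _) (risk_nonneg P θs), sub_sub])
  have hBm : MeasurableSet (B₀ ∩ (B₁ ∩ (B₂ ∩
      ((⋃ i, Z i ⁻¹' {z : Obs d | A₁ ≤ (whiteNorm P z.1 ^ 2) ^ p})ᶜ ∩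
        (⋃ i, Z i ⁻¹' {z : Obs d | A₂ ≤ noiseRatio P θs z ^ q})ᶜ)))) :=
    hB₀m.inter (hB₁m.inter (hB₂m.inter ((MeasurableSet.iUnion fun i => hZ i hE₁m).compl.inter
      (MeasurableSet.iUnion fun i => hZ i hE₂m).compl)))
  refine ⟨_, hBm, ofReal_one_sub_le_measure_inter hε.le hB₀ hB₁ hB₂ (by rwa [compl_compl])
    (by rwa [compl_compl]) hBm, ?_⟩
  rintro ω ⟨h0, h1, h2, h3, h4⟩
  replace h0 := hB₀' ω h0
  replace h1 := hB₁' ω h1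
  replace h2 := hB₂' ω h2
  replace h3 : ∀ i, (whiteNorm P (Z i ω).1 ^ 2) ^ p < A₁ := fun i => by
    by_contra hcon
    exact h3 (Set.mem_iUnion.2 ⟨i, not_lt.1 hcon⟩)
  replace h4 : ∀ i, noiseRatio P θs (Z i ω) ^ q < A₂ := fun i => by
    by_contra hcon
    exact h4 (Set.mem_iUnion.2 ⟨i, not_lt.1 hcon⟩)
  set s : Fin n → Obs d := fun i => Z i ω with hs
  have hWR : ∀ i, ‖W (s i)‖ ≤ radius P s := norm_le_radius hc hN fun i => (h0 i).1
  have hR0 : 0 ≤ radius P s := (norm_nonneg _).trans (hWR ⟨0, hnpos⟩)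
  have hR : radius P s ≤ √(A₁ ^ (2 / p) + A₂ ^ (2 / q)) := by
    refine radius_le_sqrt hnpos fun i θ ξ => ((h0 i).2 θ ξ).trans ?_
    refine mul_le_mul_of_nonneg_left ?_ (quadForm_nonneg P θ ξ)
    refine add_sq_le_rpow (d := d) ?_ hA₁1 hA₁0 hA₂1 hp hq (sq_nonneg _) (noiseRatio_nonneg _ _ _)
      (h3 i) (h4 i)
    rintro rfl
    simp [whiteNorm_sq]
  have hR4 : radius P s ^ 4 ≤ (A₁ ^ (2 / p) + A₂ ^ (2 / q)) ^ 2 := by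
    calc radius P s ^ 4 = (radius P s ^ 2) ^ 2 := by ring
      _ ≤ (√(A₁ ^ (2 / p) + A₂ ^ (2 / q)) ^ 2) ^ 2 := by gcongr
      _ = _ := by rw [Real.sq_sqrt (by linarith)]
  have hγp : gammaPlus K d n ε (radius P s) = l ^ 2 / 3 * radius P s ^ 4 * (1 + δ) ^ 2 := by
    rw [gammaPlus, hγm]
  have hγp0 : 0 ≤ gammaPlus K d n ε (radius P s) := by rw [hγp]; positivity
  refine ⟨hδ0, hγm0, ?_, hγp0, ?_, fun θ ξ => ?_⟩
  · rw [hγm, hγh, mul_assoc]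
    exact le_mul_of_one_le_right (by positivity) (one_le_mul_of_one_le_of_one_le
      (one_le_pow₀ hA) hδsq)
  · rw [hγp, hγh]
    gcongr
  set γ := gammaPlus K d n ε (radius P s) with hγ
  -- In a degenerate direction both forms vanish on the event, and the ratio is `1` by convention.
  rcases eq_or_ne (c (θ, ξ)) 0 with hz | hz
  · have hq0 : quadForm P θ ξ = 0 := by rw [hN, hz]; simp
    have he0 : empForm s θ ξ = 0 := by
      have h : ∀ i, resid θ ξ (s i) = 0 := fun i => by
        rw [(h0 i).1, hz, inner_zero_left]
      simp [empForm, h]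
    refine ⟨1, by rw [hq0, he0, extDiv_zero_zero], by rw [hq0, he0, mul_zero], ?_, fun h5 h6 => ?_⟩
    · have : 0 ≤ (δ + gammaMinus K d n ε) / (1 + δ) := by positivity
      linarith
    · rw [sub_self]
      exact div_nonneg (by positivity) (mul_nonneg (by linarith) (by linarith))
  · have hz' : 0 < ‖c (θ, ξ)‖ := norm_pos_iff.2 hz
    have hq0 : quadForm P θ ξ ≠ 0 := by rw [hN]; positivity
    set u := ‖c (θ, ξ)‖⁻¹ • c (θ, ξ) with hu
    have hu1 : ‖u‖ = 1 := by
      rw [hu, norm_smul, norm_inv, norm_norm, inv_mul_cancel₀ hz'.ne']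
    have hsum : empForm s θ ξ = (1 / (n : ℝ) * ∑ i, (inner ℝ u (W (s i))) ^ 2) *
        quadForm P θ ξ := by
      rw [empForm, hN, mul_assoc, Finset.sum_mul]
      congr 1
      refine Finset.sum_congr rfl fun i _ => ?_
      rw [(h0 i).1, hu, real_inner_smul_left, mul_pow, mul_right_comm, ← mul_pow,
        inv_mul_cancel₀ hz'.ne', one_pow, one_mul]
    -- The parameters were budgeted for the constants `9` and `15` of the lower deviations; those of
    -- the upper ones, `6` and `5`, are smaller.
    have hrem : 0 ≤ (n : ℝ) * (l ^ 2 * K * (9 * (((d : ℝ) + 1) / β) +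
        15 * (((d : ℝ) + 1) / β) ^ 2) - l ^ 2 * K * (6 * (((d : ℝ) + 1) / β) +
        5 * (((d : ℝ) + 1) / β) ^ 2)) := by
      have : l ^ 2 * K * (9 * (((d : ℝ) + 1) / β) +
        15 * (((d : ℝ) + 1) / β) ^ 2) - l ^ 2 * K * (6 * (((d : ℝ) + 1) / β) +
        5 * (((d : ℝ) + 1) / β) ^ 2) = l ^ 2 * K * (3 * (((d : ℝ) + 1) / β) +
        10 * (((d : ℝ) + 1) / β) ^ 2) := by ring
      rw [this]
      positivity
    have hγR : l ^ 2 / 3 * radius P s ^ 4 ≤ γ := by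
      rw [hγp]
      exact le_mul_of_one_le_right (by positivity) hδsq
    obtain ⟨hlow, hup⟩ := ratio_bounds (m := m) hnpos hl0 hWR hγR (h1 u hu1) (by linarith)
      (h2 u hu1) (by linarith)
    refine ⟨1 / (n : ℝ) * ∑ i, (inner ℝ u (W (s i))) ^ 2, ?_, hsum, ?_, fun h5 h6 => ?_⟩
    · rw [extDiv_of_ne hq0, hsum, mul_div_cancel_right₀ _ hq0]
    · rw [hδdef, neg_div_eq hm2, hγm]
      have := ratio_lower hl0.le hmu0.le hthr
      linarith
    · rw [hδdef] at h5 ⊢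
      exact ratio_upper hmu0.le hm2 h5 hγp0 h6 hup

end OLS

/-! ### Assembly of the final statement. -/

theorem proposition4p5 :
    -- `C` is a numerical constant: it depends on nothing
    ∃ C : ℝ, 0 < C ∧
    ∀ (d : ℕ) (P : Measure (Obs d)) [IsProbabilityMeasure P],
    MemLp (fun z : Obs d => z.1) 2 P → MemLp (fun z : Obs d => z.2) 2 P →
    ∀ (θs : EuclideanSpace ℝ (Fin d)), (∀ θ, risk P θs ≤ risk P θ) →
    ∀ (p q α₁ α₂ η₁ η₂ : ℝ), 0 < p → p ≤ 1 → 0 < q → q ≤ 1 →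
    0 < α₁ → 0 < α₂ → 0 < η₁ → 0 < η₂ →
    DesignExpMoment P p α₁ η₁ → NoiseExpMoment P θs q α₂ η₂ →
    1 < kurtSum P θs →
    ∀ ε : ℝ, 0 < ε →
    let K : ℝ := kurtSum P θs
    let rate : ℝ := (kurtDesign P + kurtNoise P θs) * (d + Real.log ε⁻¹)
    let γhat : ℕ → ℝ := fun n => gammaHat K d n ε p q α₁ α₂ η₁ η₂
    let δ : ℕ → ℝ := fun n =>
      (deltaHat K d n ε + γhat n) / ((1 - deltaHat K d n ε) * (1 - γhat n))
    -- order of magnitude of the required sample size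
    (0 < risk P θs → ¬ (∀ᵐ z ∂P, z.1 = 0) → ε < 1 → sampleThreshold K d ε ≤ C * rate) ∧
    -- first order of magnitude of the bounds when the sample size tends to infinity
    (1 ≤ d → ε < 1 →
      (∀ᶠ n : ℕ in atTop,
        upperBound (deltaHat K d n ε) (γhat n) ≤ ((C * √(rate / n) : ℝ) : EReal)) ∧
      (∀ᶠ n : ℕ in atTop, δ n ^ 2 ≤ C * (rate / n))) ∧
    -- non-asymptotic bounds
    (∀ n : ℕ, sampleThreshold K d ε < n →
      ∀ (Ω : Type*) [MeasurableSpace Ω] (μ : Measure Ω) [IsProbabilityMeasure μ]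
        (Z : Fin n → Ω → Obs d), (∀ i, Measurable (Z i)) → iIndepFun Z μ →
        (∀ i, μ.map (Z i) = P) →
      ∃ B : Set Ω, MeasurableSet B ∧ ENNReal.ofReal (1 - 4 * ε) ≤ μ B ∧
        ∀ ω ∈ B,
          let s : Fin n → Obs d := fun i => Z i ω
          let δhat : ℝ := deltaHat K d n ε
          let γminus : ℝ := gammaMinus K d n ε
          let γplus : ℝ := gammaPlus K d n ε (radius P s)
          (∀ (θ : EuclideanSpace ℝ (Fin d)) (ξ : ℝ),
            ((-((δhat + γminus) / (1 + δhat)) : ℝ) : EReal) ≤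
                extDiv (empForm s θ ξ) (quadForm P θ ξ) - 1 ∧
              extDiv (empForm s θ ξ) (quadForm P θ ξ) - 1 ≤ upperBound δhat γplus ∧
              upperBound δhat γplus ≤ upperBound δhat (γhat n) ∧
              ((extDiv (empForm s θ ξ) (quadForm P θ ξ) - 1).abs : EReal) ≤
                upperBound δhat (γhat n)) ∧
          -- the bounds for the empirical risk minimizer are `+∞` unless `δ < 1`
          (δhat < 1 → γhat n < 1 → δ n < 1 →
            ∀ θhat : EuclideanSpace ℝ (Fin d), (∀ θ, sumSq s θhat ≤ sumSq s θ) →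
              risk P θhat - risk P θs ≤
                  δ n ^ 2 / ((1 - δ n) * (1 - δ n ^ 2) * n) * sumSq s θhat ∧
                δ n ^ 2 / ((1 - δ n) * (1 - δ n ^ 2) * n) * sumSq s θhat ≤
                  δ n ^ 2 / (1 - δ n) ^ 2 * risk P θs)) := by
  -- The size is set by the sample threshold; the asymptotic bounds use only `26` and `26² = 676`.
  refine ⟨10000, by norm_num, ?_⟩
  intro d P _ hX hY θs hmin p q α₁ α₂ η₁ η₂ hp _ hq _ hα₁ hα₂ hη₁ hη₂ hdes hnoise hK ε hε K rate γhat δ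
  have hw := memLp_whiteNorm_sq hp hα₁ hdes
  have hν := memLp_noiseRatio hq hα₂ hnoise
  have hKκ : K ≤ 2 * (kurtDesign P + kurtNoise P θs) := kurtSum_le P θs
  refine ⟨fun hpos hne hε1 => ?_, fun hd hε1 => ?_, ?_⟩
  · have hd : 1 ≤ d := by
      rw [Nat.one_le_iff_ne_zero]
      rintro rfl
      exact hne (Eventually.of_forall fun z => Subsingleton.elim _ _)
    refine sampleThreshold_le ?_ hKκ hd hε hε1
    have h1 : 1 ≤ √(kurtDesign P) := Real.one_le_sqrt.2 (one_le_kurtDesign hX hw hne)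
    have h2 : 1 ≤ √(kurtNoise P θs) :=
      Real.one_le_sqrt.2 (one_le_kurtNoise hX hY hmin hw hν hpos)
    have h3 : (2 : ℝ) ^ 2 ≤ (√(kurtDesign P) + √(kurtNoise P θs)) ^ 2 := by gcongr; linarith
    norm_num at h3
    exact h3
  · have h := eventually_bounds (η₁ := η₁) (η₂ := η₂) hK hKκ hd hε hε1 hp hq hα₁ hα₂
    constructor
    · filter_upwards [h] with n hn
      obtain ⟨-, h2, -, h4, h5⟩ := hn
      rw [upperBound_of_lt h2 h4, EReal.coe_le_coe_iff]
      exact h5.trans (mul_le_mul_of_nonneg_right (by norm_num) (Real.sqrt_nonneg _))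
    · filter_upwards [h] with n hn
      obtain ⟨h1, h2, h3, h4, h5⟩ := hn
      have hlog : 0 < Real.log ε⁻¹ := Real.log_pos ((one_lt_inv₀ hε).2 hε1)
      have hrate : 0 ≤ rate / n := div_nonneg (mul_nonneg
        (add_nonneg (kurtDesign_nonneg P) (kurtNoise_nonneg P θs)) (by positivity)) (by positivity)
      have h0 : 0 ≤ δ n :=
        div_nonneg (add_nonneg h1 h3) (mul_nonneg (by linarith) (by linarith))
      calc δ n ^ 2 ≤ (26 * √(rate / n)) ^ 2 := by gcongr
        _ = 676 * (rate / n) := by rw [mul_pow, Real.sq_sqrt hrate]; norm_num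
        _ ≤ 10000 * (rate / n) := mul_le_mul_of_nonneg_right (by norm_num) hrate
  · intro n hn Ω _ μ _ Z hZ hind hlaw
    -- For `ε ≥ 1/4` the empty event suffices; otherwise `ε < 1`, so `log ε⁻¹` is positive.
    rcases le_or_gt 1 (4 * ε) with h4 | h4
    · refine ⟨∅, MeasurableSet.empty, ?_, fun ω hω => hω.elim⟩
      rw [ENNReal.ofReal_of_nonpos (by linarith)]
      exact zero_le
    have hnpos : 0 < n := by
      have : (0 : ℝ) < n := lt_of_le_of_lt (sq_nonneg _) hn
      exact_mod_cast this
    obtain ⟨B, hB, hμB, h⟩ := exists_event_ratio_bounds hX hY hmin hp hq hα₁ hα₂ hη₁ hη₂ hdes hnoise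
      hK hε (by linarith) hn hZ hind hlaw
    refine ⟨B, hB, hμB, fun ω hω => ?_⟩
    obtain ⟨hδ0, hγm0, hγm, hγp0, hγp, hρ⟩ := h ω hω
    refine ⟨fun θ ξ => ?_, fun hδ1 hγ1 hδn θhat hθ => ?_⟩
    · obtain ⟨ρ, e, -, hlow, hup⟩ := hρ θ ξ
      rw [e]
      exact ereal_bounds hδ0 hγm0 hγm hγp0 hγp hlow hup
    · have hδn0 : 0 ≤ δ n := div_nonneg (add_nonneg hδ0.le (hγm0.trans hγm))
        (mul_nonneg (sub_nonneg.2 hδ1.le) (sub_nonneg.2 hγ1.le))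
      refine excess_risk_le hnpos hX hY hmin hδn0 hδn (fun θ ξ => ?_) hθ
      obtain ⟨ρ, -, e, hlow, hup⟩ := hρ θ ξ
      rw [e, ← sub_one_mul, abs_mul, abs_of_nonneg (quadForm_nonneg P θ ξ)]
      refine mul_le_mul_of_nonneg_right ?_ (quadForm_nonneg P θ ξ)
      exact abs_sub_one_le hδ0.le hδ1 hγm0 hγm hγ1 hlow ((hup hδ1 (hγp.trans_lt hγ1)).trans
        (ratio_mono hδ0.le hδ1 hγp0 hγp hγ1))
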